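/- **Setting.** Let $q=p^f$ be a power of a prime $p$, let $\varepsilon_1,\dots,\varepsilon_6$ be an orthonormal basis, and let $\Phi^+=\{\varepsilon_i\pm\varepsilon_j \mid 1\le i<j\le 6\}$ be the positive roots of type $\mathrm D_6$. Number them $\alpha_1,\dots,\alpha_{30}$ by height, where $\alpha_i=\varepsilon_i-\varepsilon_{i+1}$ for $i\le 5$, $\alpha_6=\varepsilon_5+\varepsilon_6$, and $\alpha_7,\dots,\alpha_{30}$ are $$\varepsilon_1-\varepsilon_3,\ \varepsilon_2-\varepsilon_4,\ \varepsilon_3-\varepsilon_5,\ \varepsilon_4-\varepsilon_6,\ \varepsilon_4+\varepsilon_6,\ \varepsilon_1-\varepsilon_4,\ \varepsilon_2-\varepsilon_5,\ \varepsilon_3-\varepsilon_6,\ \varepsilon_3+\varepsilon_6,\ \varepsilon_4+\varepsilon_5,\ \varepsilon_1-\varepsilon_5,\ \varepsilon_2-\varepsilon_6,$$ $$\varepsilon_2+\varepsilon_6,\ \varepsilon_3+\varepsilon_5,\ \varepsilon_1-\varepsilon_6,\ \varepsilon_1+\varepsilon_6,\ \varepsilon_2+\varepsilon_5,\ \varepsilon_3+\varepsilon_4,\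 \varepsilon_1+\varepsilon_5,\ \varepsilon_2+\varepsilon_4,\ \varepsilon_1+\varepsilon_4,\ \varepsilon_2+\varepsilon_3,\ \varepsilon_1+\varepsilon_3,\ \varepsilon_1+\varepsilon_2.$$ Let $\mathrm{UD}_6(q)$ be the group generated by the root elements $x_i(t)=x_{\alpha_i}(t)$ ($t\in\mathbb F_q$, $1\le i\le 30$) in the split orthogonal group of dimension $12$ over $\mathbb F_q$, with signs of the root vectors as follows: on the basis $e_1,\dots,e_6,e_{-1},\dots,e_{-6}$, with matrix units $E_{a,b}$, $$x_{\varepsilon_i-\varepsilon_j}(t)=1+t(E_{i,j}-E_{-j,-i}),\qquad x_{\varepsilon_i+\varepsilon_j}(t)=1+t(E_{i,-j}-E_{j,-i}).$$ For $\mathcal B\subseteq\Phi^+$ let $X_{\mathcal B}$ be the subgroup generated by the $x_\alpha(t)$, $\alpha\in\mathcal B$, $t\in\mathbb F_q$. The $[4,18,18]$-core of $\mathrm{UD}_6(q)$ is given by $$\mathcal S=\{\alpha_i \mid i=1,2,4,5,6,7,10,11,12,14,15,16,17,18,19,21,22,28\},\qquad \mathcal Z=\{\alpha_{16},\alpha_{21},\alpha_{22},\alpha_{28}\}$$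 and the quattern group $X_{\mathcal S}=X_{\mathcal P}/X_{\mathcal K}$, where $\mathcal P=\Phi^+\setminus\{\alpha_3,\alpha_8,\alpha_9,\alpha_{13}\}$ and $\mathcal K=\mathcal P\setminus\mathcal S$. (One has $|\mathcal Z|=4$ and $|\mathcal S|=18$, and $18$ unordered pairs of roots of $\mathcal S$ have their sum in $\mathcal S$.) We write $x_i(t)$ also for the image in $X_{\mathcal S}$. Let $\operatorname{Irr}(X_{\mathcal S})_{\mathcal Z}$ be the set of complex irreducible characters of $X_{\mathcal S}$ whose kernel does not contain the image of $X_\alpha$, for any $\alpha\in\mathcal Z$. Put $\phi(t)=e^{2\pi i\operatorname{Tr}(t)/p}$ with $\operatorname{Tr}:\mathbb F_q\to\mathbb F_p$ the trace, and let $H\le X_{\mathcal S}$ be generated by the $x_i(t)$ with $i\in\{2,4,7,10,11,16,17,18,19,21,22,28\}$. Below, $a=(a_{16},a_{21},a_{22},a_{28})$ runs over $(\mathbb F_q^\times)^4$. **Labels, $p\ne2$.** For $b_2,b_4\in\mathbb F_q$ let $\chi^{a}_{b_2,b_4}$ be the character of $X_{\mathcal S}$ induced from the linear character of $H$ which maps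 $x_i(t)$ to $\phi(a_it)$ for $i=16,21,22,28$, to $\phi(b_it)$ for $i=2,4$, and to $1$ for $i=7,10,11,17,18,19$. **Labels, $p=2$.** Put $u=a_{21}a_{22}a_{28}$, $v=a_{16}a_{21}a_{22}$ and $$x_{1,14,15}(t)=x_1(a_{28}t)x_{14}(a_{22}t)x_{15}(a_{21}t),\qquad x_{5,6,12}(t)=x_5(a_{22}t)x_6(a_{21}t)x_{12}(a_{16}t),$$ $$x_{7,18,19}(t)=x_7(a_{28}t)x_{18}(a_{22}t)x_{19}(a_{21}t),\qquad x_{10,11,17}(t)=x_{10}(a_{22}t)x_{11}(a_{21}t)x_{17}(a_{16}t).$$ For $c,c'\in\mathbb F_q$ let $H_{a,c,c'}=\langle H,\ x_{1,14,15}(c/u),\ x_{5,6,12}(c'/v)\rangle$, and let $\Psi_{a,c,c'}$ be the set of linear characters $\psi$ of $H_{a,c,c'}$ such that, for all $t\in\mathbb F_q$, $\psi(x_i(t))=\phi(a_it)$ for $i=16,21,22,28$, $\psi(x_{7,18,19}(t))=\phi(ct)$, $\psi(x_{10,11,17}(t))=\phi(c't)$, and $\psi(x_i(t))=1$ for $i=11,17,18,19$.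 For $d_{1,14,15},d_2,d_4,d_{5,6,12}\in\mathbb Z/2$ and $c,c'\in\mathbb F_q^\times$ consider the conditions $$(\mathrm A)\quad \psi(x_{1,14,15}(c/u))=(-1)^{d_{1,14,15}},\ \ \psi(x_2(u/c^2))=(-1)^{d_2};$$ $$(\mathrm B)\quad \psi(x_4(v/c'^2))=(-1)^{d_4},\ \ \psi(x_{5,6,12}(c'/v))=(-1)^{d_{5,6,12}}.$$ * $\mathcal F^1$ consists of the characters $\chi^{a}$ induced from a $\psi\in\Psi_{a,0,0}$; * $\mathcal F^2$ consists of the characters $\chi^{c,a}_{d_{1,14,15},d_2}$ with $c=a_{7,18,19}\in\mathbb F_q^\times$, induced from a $\psi\in\Psi_{a,c,0}$ with (A); * $\mathcal F^3$ consists of the characters $\chi^{c',a}_{d_4,d_{5,6,12}}$ with $c'=a_{10,11,17}\in\mathbb F_q^\times$, induced from a $\psi\in\Psi_{a,0,c'}$ with (B); * $\mathcal F^4$ consists of the characters $\chi^{c,c',a}_{d_{1,14,15},d_2,d_4,d_{5,6,12}}$ with $c,c'\in\mathbb F_q^\times$, induced from a $\psi\in\Psi_{a,c,c'}$ with (A)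 and (B). **Proposition 5.2.** * If $p\ne2$, then $\operatorname{Irr}(X_{\mathcal S})_{\mathcal Z}=\{\chi^{a}_{b_2,b_4}\}$, each label determines exactly one character, distinct labels give distinct characters, and these are $q^2(q-1)^4$ characters, all of degree $q^6$. * If $p=2$, then $\operatorname{Irr}(X_{\mathcal S})_{\mathcal Z}=\mathcal F^1\sqcup\mathcal F^2\sqcup\mathcal F^3\sqcup\mathcal F^4$ (a disjoint union). In each family every label determines exactly one character (a linear character $\psi$ as required exists, and the induced character does not depend on its choice), and distinct labels give distinct characters. Moreover * $\mathcal F^1$ consists of $(q-1)^4$ characters of degree $q^6$; * $\mathcal F^2$ and $\mathcal F^3$ consist of $4(q-1)^5$ characters each, of degree $q^6/2$; * $\mathcal F^4$ consists of $16(q-1)^6$ characters of degree $q^6/4$. -/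

import Mathlib

namespace UD6

/-! ### The positive roots of type `D₆` -/

/-- The positive roots of the root system of type `D₆`, for an orthonormal basis `ε₀, …, ε₅`:
for `i < j`, the triple `(i, j, false)` is the root `ε_i - ε_j` and `(i, j, true)` is the root
`ε_i + ε_j`. -/
abbrev PosRoot := {r : Fin 6 × Fin 6 × Bool // r.1 < r.2.1}

/-- A positive root as a vector, in the coordinates given by `ε₀, …, ε₅`. -/
def PosRoot.vec (r : PosRoot) : Fin 6 → ℤ :=
  fun k => if k = r.1.1 then 1 else if k = r.1.2.1 then (if r.1.2.2 then 1 else -1) else 0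

/-- The relation `α + β = γ` between positive roots. -/
def IsSum (α β γ : PosRoot) : Prop := α.vec + β.vec = γ.vec

/-- The vector `v` of a positive root, encoded in the single integer `∑ v_k 7^k`. -/
def PosRoot.code (r : PosRoot) : ℤ :=
  bif r.1.2.2 then Int.ofNat (7 ^ r.1.1.val + 7 ^ r.1.2.1.val)
  else Int.subNatNat (7 ^ r.1.1.val) (7 ^ r.1.2.1.val)

theorem PosRoot.code_eq (r : PosRoot) : r.code = r.vec 0 + 7 * r.vec 1 + 49 * r.vec 2 +
    343 * r.vec 3 + 2401 * r.vec 4 + 16807 * r.vec 5 := by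
  revert r; decide +kernel

theorem PosRoot.vec_bound (r : PosRoot) (k : Fin 6) : -1 ≤ r.vec k ∧ r.vec k ≤ 1 := by
  unfold PosRoot.vec
  split_ifs <;> simp

theorem isSum_iff_code (α β γ : PosRoot) : α.code + β.code = γ.code ↔ IsSum α β γ := by
  have h := fun k => And.intro (α.vec_bound k) (And.intro (β.vec_bound k) (γ.vec_bound k))
  have h0 := h 0
  have h1 := h 1
  have h2 := h 2
  have h3 := h 3
  have h4 := h 4
  have h5 := h 5
  rw [IsSum, funext_iff, Fin.forall_fin_succ, Fin.forall_fin_succ, Fin.forall_fin_succ,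
    Fin.forall_fin_succ, Fin.forall_fin_succ, Fin.forall_fin_one]
  change _ ↔ α.vec 0 + β.vec 0 = γ.vec 0 ∧ α.vec 1 + β.vec 1 = γ.vec 1 ∧
    α.vec 2 + β.vec 2 = γ.vec 2 ∧ α.vec 3 + β.vec 3 = γ.vec 3 ∧
    α.vec 4 + β.vec 4 = γ.vec 4 ∧ α.vec 5 + β.vec 5 = γ.vec 5
  rw [α.code_eq, β.code_eq, γ.code_eq]
  clear h
  omega

instance (α β γ : PosRoot) : Decidable (IsSum α β γ) :=
  decidable_of_iff _ (isSum_iff_code α β γ)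

/-- The root `ε_i - ε_j`. -/
def minusRoot (i j : Fin 6) (h : i < j := by decide) : PosRoot := ⟨(i, j, false), h⟩

/-- The root `ε_i + ε_j`. -/
def plusRoot (i j : Fin 6) (h : i < j := by decide) : PosRoot := ⟨(i, j, true), h⟩

/-- The numbering `α₁, …, α₃₀` of the positive roots by increasing height. The simple roots are
`α₁, …, α₆`, where `α₁ - α₂ - α₃ - α₄` is a chain in the Dynkin diagram and `α₅`, `α₆` are both
joined to `α₄`. (The value outside `1, …, 30` is never used.) -/
def root : ℕ → PosRoot
  | 1 => minusRoot 0 1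
  | 2 => minusRoot 1 2
  | 3 => minusRoot 2 3
  | 4 => minusRoot 3 4
  | 5 => minusRoot 4 5
  | 6 => plusRoot 4 5
  | 7 => minusRoot 0 2    -- α₁ + α₂
  | 8 => minusRoot 1 3    -- α₂ + α₃
  | 9 => minusRoot 2 4    -- α₃ + α₄
  | 10 => minusRoot 3 5   -- α₄ + α₅
  | 11 => plusRoot 3 5    -- α₄ + α₆
  | 12 => minusRoot 0 3   -- α₁ + α₂ + α₃
  | 13 => minusRoot 1 4   -- α₂ + α₃ + α₄
  | 14 => minusRoot 2 5   -- α₃ + α₄ + α₅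
  | 15 => plusRoot 2 5    -- α₃ + α₄ + α₆
  | 16 => plusRoot 3 4    -- α₄ + α₅ + α₆
  | 17 => minusRoot 0 4   -- α₁ + α₂ + α₃ + α₄
  | 18 => minusRoot 1 5   -- α₂ + α₃ + α₄ + α₅
  | 19 => plusRoot 1 5    -- α₂ + α₃ + α₄ + α₆
  | 20 => plusRoot 2 4    -- α₃ + α₄ + α₅ + α₆
  | 21 => minusRoot 0 5   -- α₁ + α₂ + α₃ + α₄ + α₅
  | 22 => plusRoot 0 5    -- α₁ + α₂ + α₃ + α₄ + α₆
  | 23 => plusRoot 1 4    -- α₂ + α₃ + α₄ + α₅ + α₆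
  | 24 => plusRoot 2 3    -- α₃ + 2α₄ + α₅ + α₆
  | 25 => plusRoot 0 4    -- α₁ + α₂ + α₃ + α₄ + α₅ + α₆
  | 26 => plusRoot 1 3    -- α₂ + α₃ + 2α₄ + α₅ + α₆
  | 27 => plusRoot 0 3    -- α₁ + α₂ + α₃ + 2α₄ + α₅ + α₆
  | 28 => plusRoot 1 2    -- α₂ + 2α₃ + 2α₄ + α₅ + α₆
  | 29 => plusRoot 0 2    -- α₁ + α₂ + 2α₃ + 2α₄ + α₅ + α₆
  | 30 => plusRoot 0 1    -- α₁ + 2α₂ + 2α₃ + 2α₄ + α₅ + α₆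
  | _ => minusRoot 0 1

/-! ### Root subgroups

The group is realised on a space of dimension `12` with basis `e₀, …, e₅` (indices `inl i`),
`e₋₀, …, e₋₅` (indices `inr i`) carrying the quadratic form `∑ x_i x_{-i}`. -/

section Roots

variable (F : Type*) [Field F]

/-- The root vector of `α` in the Lie algebra of the split orthogonal group in dimension `12`. -/
def rootVector (α : PosRoot) : Matrix (Fin 6 ⊕ Fin 6) (Fin 6 ⊕ Fin 6) F :=
  match α with
  | ⟨(i, j, false), _⟩ =>
      Matrix.single (Sum.inl i) (Sum.inl j) 1 - Matrix.single (Sum.inr j) (Sum.inr i) 1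
  | ⟨(i, j, true), _⟩ =>
      Matrix.single (Sum.inl i) (Sum.inr j) 1 - Matrix.single (Sum.inl j) (Sum.inr i) 1

variable {F}

theorem single_mul_single_ite (i j k l : Fin 6 ⊕ Fin 6) :
    (Matrix.single i j (1 : F)) * Matrix.single k l 1 =
      if j = k then Matrix.single i l 1 else 0 := by
  split_ifs with h
  · subst h; simp
  · exact Matrix.single_mul_single_of_ne _ _ _ _ h _

theorem rootVector_sq (α : PosRoot) : rootVector F α * rootVector F α = 0 := by
  obtain ⟨⟨i, j, b⟩, h⟩ := α
  have h1 : i ≠ j := ne_of_lt h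
  cases b <;> simp [rootVector, mul_sub, sub_mul, h1, h1.symm]

/-- The root element `x_α(t) = 1 + t N_α`, where `N_α` is the root vector (of square zero). -/
def rootElt (α : PosRoot) (t : F) : GL (Fin 6 ⊕ Fin 6) F where
  val := 1 + t • rootVector F α
  inv := 1 - t • rootVector F α
  val_inv := by simp [mul_sub, add_mul, rootVector_sq]
  inv_val := by simp [mul_add, sub_mul, rootVector_sq]

variable (F) in
/-- `X_𝒜`, the subgroup generated by the root subgroups `X_α = {x_α(t) | t ∈ F}` with `α ∈ 𝒜`.
For `𝒜` the set of all positive roots, this is `UD₆(q)`; if `𝒜` is closed under addition of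
roots, it is the product of the root subgroups `X_α`, `α ∈ 𝒜`. -/
def rootProduct (A : Finset PosRoot) : Subgroup (GL (Fin 6 ⊕ Fin 6) F) :=
  Subgroup.closure {g | ∃ α ∈ A, ∃ t : F, g = rootElt α t}

theorem rootElt_mem {A : Finset PosRoot} {α : PosRoot} (h : α ∈ A) (t : F) :
    rootElt α t ∈ rootProduct F A :=
  Subgroup.subset_closure ⟨α, h, t, rfl⟩

theorem rootElt_inv (α : PosRoot) (t : F) : (rootElt α t)⁻¹ = rootElt α (-t) := by
  apply Units.ext
  change 1 - t • rootVector F α = 1 + (-t) • rootVector F α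
  simp [sub_eq_add_neg]

/-! ### Commutators of root elements, and quattern groups -/

theorem vec_minusRoot (i j : Fin 6) (h : i < j) :
    (minusRoot i j h).vec = Pi.single i 1 - Pi.single j 1 := by
  funext k
  by_cases h1 : k = i <;> by_cases h2 : k = j <;>
    have := h.ne <;> simp_all [minusRoot, PosRoot.vec]

theorem vec_plusRoot (i j : Fin 6) (h : i < j) :
    (plusRoot i j h).vec = Pi.single i 1 + Pi.single j 1 := by
  funext k
  by_cases h1 : k = i <;> by_cases h2 : k = j <;>
    have := h.ne <;> simp_all [plusRoot, PosRoot.vec]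

theorem rootVector_minusRoot (i j : Fin 6) (h : i < j) :
    rootVector F (minusRoot i j h) =
      Matrix.single (Sum.inl i) (Sum.inl j) 1 - Matrix.single (Sum.inr j) (Sum.inr i) 1 := rfl

theorem rootVector_plusRoot (i j : Fin 6) (h : i < j) :
    rootVector F (plusRoot i j h) =
      Matrix.single (Sum.inl i) (Sum.inr j) 1 - Matrix.single (Sum.inl j) (Sum.inr i) 1 := rfl

theorem rootVector_sandwich (β δ : PosRoot) :
    rootVector F β * rootVector F δ * rootVector F β = 0 := by
  obtain ⟨⟨i, j, b⟩, h⟩ := β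
  obtain ⟨⟨k, l, c⟩, h'⟩ := δ
  change i < j at h
  change k < l at h'
  cases b <;> cases c <;>
    simp only [rootVector, mul_sub, sub_mul, single_mul_single_ite, ite_mul, zero_mul,
      Sum.inl.injEq, Sum.inr.injEq, reduceCtorEq, if_false, sub_zero, zero_sub, neg_mul, sub_self] <;>
    split_ifs <;> first | omega | simp_all

/-- The bracket of two root vectors is a multiple of the root vector of the sum, if the sum is a
root, and zero otherwise. -/
theorem rootVector_bracket (β δ : PosRoot) :
    rootVector F β * rootVector F δ = rootVector F δ * rootVector F β ∨
    ∃ γ, IsSum β δ γ ∧ ∃ u : F, rootVector F β * rootVector F δ =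
      rootVector F δ * rootVector F β + u • rootVector F γ := by
  have mm : ∀ (i j k l : Fin 6) (h : i < j) (h' : k < l), j = k →
      ∃ γ, IsSum (minusRoot i j h) (minusRoot k l h') γ ∧
        rootVector F (minusRoot i j h) * rootVector F (minusRoot k l h') =
        rootVector F (minusRoot k l h') * rootVector F (minusRoot i j h) + rootVector F γ := by
    rintro i j k l h h' rfl
    refine ⟨minusRoot i l (h.trans h'), ?_, ?_⟩
    · simp [IsSum, vec_minusRoot]
    · have := h.ne; have := h'.ne; have := (h.trans h').ne
      simp only [rootVector_minusRoot, mul_sub, sub_mul, single_mul_single_ite,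
        Sum.inl.injEq, Sum.inr.injEq, reduceCtorEq, if_false]
      simp_all [eq_comm, sub_eq_add_neg]
  have mp : ∀ (i j k l : Fin 6) (h : i < j) (h' : k < l),
      rootVector F (minusRoot i j h) * rootVector F (plusRoot k l h') =
        rootVector F (plusRoot k l h') * rootVector F (minusRoot i j h) ∨
      ∃ γ, IsSum (minusRoot i j h) (plusRoot k l h') γ ∧
        ∃ u : F, rootVector F (minusRoot i j h) * rootVector F (plusRoot k l h') =
        rootVector F (plusRoot k l h') * rootVector F (minusRoot i j h) + u • rootVector F γ := by
    intro i j k l h h'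
    have hi := h.ne
    have hk := h'.ne
    by_cases hjk : j = k
    · subst hjk
      have := (h.trans h').ne
      refine Or.inr ⟨plusRoot i l (h.trans h'), ?_, 1, ?_⟩
      · simp [IsSum, vec_minusRoot, vec_plusRoot]
        abel
      · simp [rootVector_minusRoot, rootVector_plusRoot, mul_sub, sub_mul, hk, hk.symm]
    by_cases hjl : j = l
    · subst hjl
      rcases lt_trichotomy i k with hik | rfl | hik
      · refine Or.inr ⟨plusRoot i k hik, ?_, -1, ?_⟩
        · simp [IsSum, vec_minusRoot, vec_plusRoot]
        · simp [rootVector_minusRoot, rootVector_plusRoot, mul_sub, sub_mul, hk, hk.symm]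
          abel
      · left
        simp [rootVector_minusRoot, rootVector_plusRoot, mul_sub, sub_mul, hk, hk.symm]
      · refine Or.inr ⟨plusRoot k i hik, ?_, 1, ?_⟩
        · simp [IsSum, vec_minusRoot, vec_plusRoot]
          abel
        · simp [rootVector_minusRoot, rootVector_plusRoot, mul_sub, sub_mul, hk, hk.symm]
          abel
    left
    simp [rootVector_minusRoot, rootVector_plusRoot, mul_sub, sub_mul,
      hjk, hjl, Ne.symm hjk, Ne.symm hjl]
  obtain ⟨⟨i, j, b⟩, h⟩ := β
  obtain ⟨⟨k, l, c⟩, h'⟩ := δ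
  change i < j at h
  change k < l at h'
  cases b <;> cases c
  · change rootVector F (minusRoot i j h) * rootVector F (minusRoot k l h') =
        rootVector F (minusRoot k l h') * rootVector F (minusRoot i j h) ∨
      ∃ γ, IsSum (minusRoot i j h) (minusRoot k l h') γ ∧
        ∃ u : F, rootVector F (minusRoot i j h) * rootVector F (minusRoot k l h') =
        rootVector F (minusRoot k l h') * rootVector F (minusRoot i j h) + u • rootVector F γ
    by_cases hjk : j = k
    · obtain ⟨γ, h1, h2⟩ := mm i j k l h h' hjk
      exact Or.inr ⟨γ, h1, 1, by simpa using h2⟩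
    by_cases hil : l = i
    · obtain ⟨γ, h1, h2⟩ := mm k l i j h' h hil
      refine Or.inr ⟨γ, by rw [IsSum, add_comm]; exact h1, -1, by rw [h2]; simp⟩
    left
    simp [rootVector_minusRoot, mul_sub, sub_mul, hjk, hil, Ne.symm hjk,
      Ne.symm hil]
  · exact mp i j k l h h'
  · rcases mp k l i j h' h with h1 | ⟨γ, h1, u, h2⟩
    · exact Or.inl h1.symm
    · right
      refine ⟨γ, by rw [IsSum, add_comm]; exact h1, -u, ?_⟩
      change rootVector F (plusRoot i j h) * rootVector F (minusRoot k l h') =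
        rootVector F (minusRoot k l h') * rootVector F (plusRoot i j h) + (-u) • rootVector F γ
      rw [h2]; simp
  · left
    simp [rootVector, mul_sub, sub_mul]

theorem rootElt_conj (β δ : PosRoot) (s t : F) :
    rootElt β s * rootElt δ t * (rootElt β s)⁻¹ = rootElt δ t ∨
    ∃ γ, IsSum β δ γ ∧ ∃ u : F,
      rootElt β s * rootElt δ t * (rootElt β s)⁻¹ = rootElt γ u * rootElt δ t := by
  have hs := rootVector_sq (F := F) β
  have hsw := rootVector_sandwich (F := F) β δ
  have hsw' := rootVector_sandwich (F := F) δ β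
  rcases rootVector_bracket (F := F) β δ with h | ⟨γ, hγ, u, h⟩
  · left
    rw [mul_inv_eq_iff_eq_mul]
    apply Units.ext
    simp only [Units.val_mul, rootElt]
    simp only [mul_add, add_mul, mul_one, one_mul, smul_mul_smul_comm, h, mul_comm s t]
    abel
  · right
    refine ⟨γ, hγ, s * t * u, ?_⟩
    -- the root vector of `γ` multiplies to zero with those of `β` and `δ`
    have h1 : (u • rootVector F γ) * rootVector F β = -(rootVector F δ * rootVector F β *
        rootVector F β) + rootVector F β * rootVector F δ * rootVector F β := by
      rw [h]; noncomm_ring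
    have h2 : (u • rootVector F γ) * rootVector F δ = rootVector F β * (rootVector F δ *
        rootVector F δ) - rootVector F δ * rootVector F β * rootVector F δ := by
      rw [← mul_assoc, h]; noncomm_ring
    rw [mul_assoc, hs, hsw, mul_zero, neg_zero, add_zero] at h1
    rw [rootVector_sq, hsw', mul_zero, sub_zero] at h2
    rw [mul_inv_eq_iff_eq_mul]
    apply Units.ext
    simp only [Units.val_mul, rootElt]
    have e1 : ((s * t * u) • rootVector F γ) * (t • rootVector F δ) = 0 := by
      rw [mul_smul, smul_mul_smul_comm, h2, smul_zero]
    have e2 : ((s * t * u) • rootVector F γ) * (s • rootVector F β) = 0 := by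
      rw [mul_smul, smul_mul_smul_comm, h1, smul_zero]
    have e3 : (s • rootVector F β) * (t • rootVector F δ) =
        (t • rootVector F δ) * (s • rootVector F β) + (s * t * u) • rootVector F γ := by
      rw [smul_mul_smul_comm, h, smul_mul_smul_comm, smul_add, smul_smul, mul_comm t s]
    simp only [mul_add, add_mul, one_mul, mul_one, e1, e2, e3, zero_mul]
    abel

/-- A quattern `𝒮 = 𝒫 ∖ 𝒦`: a closed set `𝒫` of positive roots (a pattern) together with a
closed subset `𝒦` which is normal in `𝒫`. -/
structure Quattern where
  /-- The pattern `𝒫`. -/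
  P : Finset PosRoot
  /-- The normal subset `𝒦`. -/
  K : Finset PosRoot
  subset : K ⊆ P
  closed : ∀ α ∈ P, ∀ β ∈ P, ∀ γ, IsSum α β γ → γ ∈ P
  normal : ∀ β ∈ P, ∀ δ ∈ K, ∀ γ, IsSum β δ γ → γ ∈ K

namespace Quattern

/-- The underlying set of roots `𝒮 = 𝒫 ∖ 𝒦`. -/
def S (Q : Quattern) : Finset PosRoot := Q.P \ Q.K

instance normal_rootProduct (Q : Quattern) :
    ((rootProduct F Q.K).subgroupOf (rootProduct F Q.P)).Normal := by
  have key : ∀ β ∈ Q.P, ∀ s : F, ∀ k ∈ rootProduct F Q.K,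
      rootElt β s * k * (rootElt β s)⁻¹ ∈ rootProduct F Q.K := by
    intro β hβ s k hk
    induction hk using Subgroup.closure_induction with
    | mem g hg =>
      obtain ⟨δ, hδ, t, rfl⟩ := hg
      rcases rootElt_conj β δ s t with h | ⟨γ, hγ, u, h⟩
      · rw [h]; exact rootElt_mem hδ t
      · rw [h]
        exact mul_mem (rootElt_mem (Q.normal β hβ δ hδ γ hγ) u) (rootElt_mem hδ t)
    | one => simp
    | mul a b _ _ ha hb => simpa [mul_assoc] using mul_mem ha hb
    | inv a _ ha => simpa [mul_assoc] using inv_mem ha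
  apply Subgroup.normal_subgroupOf_of_le_normalizer
  rw [rootProduct, Subgroup.closure_le]
  rintro g ⟨β, hβ, s, rfl⟩
  rw [SetLike.mem_coe, Subgroup.mem_normalizer_iff]
  refine fun k => ⟨key β hβ s k, fun hk => ?_⟩
  have h := key β hβ (-s) _ hk
  rw [← rootElt_inv] at h
  simpa [mul_assoc] using h

variable (F) in
/-- The quattern group `X_𝒮 = X_𝒫 / X_𝒦`. -/
abbrev QGroup (Q : Quattern) : Type _ :=
  ↥(rootProduct F Q.P) ⧸ (rootProduct F Q.K).subgroupOf (rootProduct F Q.P)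

/-- The image in `X_𝒮` of the root element `x_α(t)`, for `α ∈ 𝒫` (and `1` for other roots). -/
def x (Q : Quattern) (α : PosRoot) (t : F) : Q.QGroup F :=
  if h : α ∈ Q.P then QuotientGroup.mk ⟨rootElt α t, rootElt_mem h t⟩ else 1

/-- The set `𝒵(𝒮)` of central roots of `𝒮`. -/
def centralRoots (Q : Quattern) : Finset PosRoot :=
  Q.S.filter fun γ => ∀ α ∈ Q.S, ∀ δ ∈ Q.S, ¬ IsSum γ α δ

end Quattern

end Roots

/-! ### Characters of finite groups -/

section Characters

variable {G : Type*} [Group G]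

variable (G) in
/-- `Irr(G)`: the set of (ordinary) irreducible characters of the group `G`, as functions. -/
def Irr : Set (G → ℂ) :=
  {χ | ∃ (V : Type) (_ : AddCommGroup V) (_ : Module ℂ V) (_ : FiniteDimensional ℂ V)
    (ρ : Representation ℂ G V), ρ.IsIrreducible ∧ ρ.character = χ}

/-- The kernel of a character. -/
def charKer (χ : G → ℂ) : Set G := {g | χ g = χ 1}

/-- The character of `G` induced from the linear character `ψ` of the subgroup `H`:
`g ↦ |H|⁻¹ ∑ ψ(y⁻¹ g y)`, the sum being over those `y ∈ G` with `y⁻¹ g y ∈ H`. -/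
noncomputable def ind {H : Subgroup G} (ψ : H →* ℂˣ) (g : G) : ℂ :=
  (Nat.card H : ℂ)⁻¹ * ∑ᶠ (y : G) (h : y⁻¹ * g * y ∈ H), ((ψ ⟨y⁻¹ * g * y, h⟩ : ℂˣ) : ℂ)

/-- The element `g` lies in `H`, and the linear character `ψ` of `H` takes the value `z` at `g`. -/
def Takes {H : Subgroup G} (ψ : H →* ℂˣ) (g : G) (z : ℂ) : Prop :=
  ∃ h : g ∈ H, ((ψ ⟨g, h⟩ : ℂˣ) : ℂ) = z

/-- The relation `R l χ` (read: `χ` has label `l`) attaches to every label exactly one function,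
and distinct labels have distinct functions. -/
def IsLabelling {L : Type*} (R : L → (G → ℂ) → Prop) : Prop :=
  (∀ l, ∃! χ, R l χ) ∧ ∀ l l' χ, R l χ → R l' χ → l = l'

end Characters

/-- The additive character `φ(t) = exp(2πi Tr(t)/p)` of `F`, where `Tr` is the trace of `F` over
the field with `p` elements. -/
noncomputable def phi (p : ℕ) [Fact p.Prime] {F : Type*} [Field F] [Algebra (ZMod p) F] (t : F) :
    ℂ :=
  ZMod.stdAddChar (Algebra.trace (ZMod p) F t)

/-- `Irr(X_𝒮)_𝒵`: the irreducible characters of `X_𝒮` whose kernel contains none of the root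
subgroups `X_α`, `α ∈ 𝒵`. -/
def IrrSupport (F : Type*) [Field F] (Q : Quattern) (Z : Finset PosRoot) : Set (Q.QGroup F → ℂ) :=
  {χ | χ ∈ Irr (Q.QGroup F) ∧ ∀ α ∈ Z, ¬ Set.range (fun t : F => Q.x α t) ⊆ charKer χ}

/-! ### The `[4, 18, 18]`-core of `UD₆(q)` -/

namespace Core

/-- The set `𝒮` of the core. -/
def S : Finset PosRoot :=
  {root 1, root 2, root 4, root 5, root 6, root 7, root 10, root 11, root 12, root 14, root 15,
    root 16, root 17, root 18, root 19, root 21, root 22, root 28}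

/-- The set `𝒵` of the core. -/
def Z : Finset PosRoot := {root 16, root 21, root 22, root 28}

/-- The set `𝒜` of the core, recording the roots `β` removed by the reduction algorithm. -/
def A : Finset PosRoot := {root 3, root 8, root 9, root 13}

/-- The roots whose root subgroups are factored out: those of `ℒ = {α₂₀, α₂₃, α₂₄, α₂₆}`, and
`α₂₅, α₂₇, α₂₉, α₃₀`, which are not below any of the roots `α₂₁, α₂₂, α₂₈`. -/
def K : Finset PosRoot :=
  {root 20, root 23, root 24, root 25, root 26, root 27, root 29, root 30}

/-- The roots `ℐ` whose root subgroups generate a transversal of `X_{𝒮 ∖ ℐ}` in `X_𝒮`. -/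
def I : Finset PosRoot := {root 1, root 5, root 6, root 12, root 14, root 15}

/-- The roots of `𝒮`, outside `𝒵`, which are joined to a root of `ℐ` by a sum in `𝒵`; the group
`X_𝒥` is a direct factor of the abelian group `X_{𝒮 ∖ ℐ}`. -/
def J : Finset PosRoot := {root 7, root 10, root 11, root 17, root 18, root 19}

/-- The quattern of the core: `𝒮 = 𝒫 ∖ 𝒦`, where `𝒫` consists of all positive roots outside
`𝒜`. -/
def Q : Quattern where
  P := S ∪ K
  K := K
  subset := Finset.subset_union_right
  closed := by decide +kernel
  normal := by decide +kernel

theorem Q_P : Q.P = Finset.univ \ A := by decide +kernel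

theorem Q_S : Q.S = S := by decide +kernel

/-- The form of the core: `|𝒵| = 4`, `|𝒮| = 18`, there are `18` unordered pairs of elements of `𝒮`
whose sum is in `𝒮` (so `36` ordered ones), and `𝒵` is the set of all central roots of `𝒮`. -/
theorem form : Z.card = 4 ∧ S.card = 18 ∧
    ((S ×ˢ S ×ˢ S).filter fun t => IsSum t.1 t.2.1 t.2.2).card = 2 * 18 ∧ Q.centralRoots = Z := by
  decide +kernel

section Labels

variable {F : Type*} [Field F]

/-- The group `X_𝒮` of the core. -/
abbrev X (F : Type*) [Field F] : Type _ := Q.QGroup F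

/-- The image `x_n(t)` in `X_𝒮` of the root element of `α_n`. -/
abbrev x (n : ℕ) (t : F) : X F := Q.x (root n) t

variable (F) in
/-- The values `(a₁₆, a₂₁, a₂₂, a₂₈)`, all nonzero, parametrizing the linear characters of
`X_𝒵` which are nontrivial on each root subgroup. -/
structure CentralLabel where
  /-- The parameter for `X₁₆`. -/
  a16 : Fˣ
  /-- The parameter for `X₂₁`. -/
  a21 : Fˣ
  /-- The parameter for `X₂₂`. -/
  a22 : Fˣ
  /-- The parameter for `X₂₈`. -/
  a28 : Fˣ

/-- The linear character `ψ` maps `x_n(t)` to `φ(a_n t)` for all `n ∈ {16, 21, 22, 28}`. -/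
def IsCentral (p : ℕ) [Fact p.Prime] [Algebra (ZMod p) F] (a : CentralLabel F)
    {H : Subgroup (X F)} (ψ : H →* ℂˣ) : Prop :=
  ∀ t : F, Takes ψ (x 16 t) (phi p (a.a16 * t)) ∧ Takes ψ (x 21 t) (phi p (a.a21 * t)) ∧
    Takes ψ (x 22 t) (phi p (a.a22 * t)) ∧ Takes ψ (x 28 t) (phi p (a.a28 * t))

variable (F) in
/-- The subgroup `X_{𝒮 ∖ ℐ}` of `X_𝒮`, generated by the root subgroups for `𝒮 ∖ ℐ`. -/
def base : Subgroup (X F) :=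
  Subgroup.closure {g | ∃ α ∈ S \ I, ∃ t : F, g = Q.x α t}

/-! #### Odd characteristic -/

/-- `χ` is the character `χ_{b₂, b₄}^{a₁₆, a₂₁, a₂₂, a₂₈}`: it is induced from the linear character
of `X_{𝒮 ∖ ℐ}` which maps `x_n(t)` to `φ(a_n t)` for `α_n ∈ 𝒵`, to `1` for `α_n ∈ 𝒥`, and to
`φ(b_n t)` for `n = 2, 4`. -/
def OddLabel (p : ℕ) [Fact p.Prime] [Algebra (ZMod p) F] (l : CentralLabel F × F × F)
    (χ : X F → ℂ) : Prop :=
  ∃ ψ : base F →* ℂˣ, IsCentral p l.1 ψ ∧ (∀ β ∈ J, ∀ t : F, Takes ψ (Q.x β t) 1) ∧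
    (∀ t : F, Takes ψ (x 2 t) (phi p (l.2.1 * t))) ∧
    (∀ t : F, Takes ψ (x 4 t) (phi p (l.2.2 * t))) ∧ χ = ind ψ

/-! #### Characteristic two -/

/-- `x_{1,14,15}(t) = x₁(a₂₈ t) x₁₄(a₂₂ t) x₁₅(a₂₁ t)`. -/
def x1_14_15 (a : CentralLabel F) (t : F) : X F :=
  x 1 (a.a28 * t) * x 14 (a.a22 * t) * x 15 (a.a21 * t)

/-- `x_{5,6,12}(t) = x₅(a₂₂ t) x₆(a₂₁ t) x₁₂(a₁₆ t)`. -/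
def x5_6_12 (a : CentralLabel F) (t : F) : X F :=
  x 5 (a.a22 * t) * x 6 (a.a21 * t) * x 12 (a.a16 * t)

/-- `x_{7,18,19}(t) = x₇(a₂₈ t) x₁₈(a₂₂ t) x₁₉(a₂₁ t)`. -/
def x7_18_19 (a : CentralLabel F) (t : F) : X F :=
  x 7 (a.a28 * t) * x 18 (a.a22 * t) * x 19 (a.a21 * t)

/-- `x_{10,11,17}(t) = x₁₀(a₂₂ t) x₁₁(a₂₁ t) x₁₇(a₁₆ t)`. -/
def x10_11_17 (a : CentralLabel F) (t : F) : X F :=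
  x 10 (a.a22 * t) * x 11 (a.a21 * t) * x 17 (a.a16 * t)

/-- The product `a₂₁ a₂₂ a₂₈`. -/
def CentralLabel.u (a : CentralLabel F) : F := a.a21 * a.a22 * a.a28

/-- The product `a₁₆ a₂₁ a₂₂`. -/
def CentralLabel.v (a : CentralLabel F) : F := a.a16 * a.a21 * a.a22

/-- The subgroup of `X_𝒮` generated by `X_{𝒮 ∖ ℐ}` and the elements
`x_{1,14,15}(c / (a₂₁ a₂₂ a₂₈))` and `x_{5,6,12}(c' / (a₁₆ a₂₁ a₂₂))`. (The first of these elements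
is `1` if `c = 0`, and the second if `c' = 0`.) -/
def evenBase (a : CentralLabel F) (c c' : F) : Subgroup (X F) :=
  base F ⊔ Subgroup.closure {x1_14_15 a (c / a.u), x5_6_12 a (c' / a.v)}

/-- The linear character `ψ` of the subgroup above maps
* `x_n(t)` to `φ(a_n t)` for `α_n ∈ 𝒵`,
* `x_{7,18,19}(t)` to `φ(c t)` and `x_{10,11,17}(t)` to `φ(c' t)`,
* `x_n(t)` to `1` for `n = 11, 17, 18, 19`; the product of these four root subgroups is a complement
  in `X_𝒥` of the group of all `x_{7,18,19}(t) x_{10,11,17}(t')`. -/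
def EvenChar (p : ℕ) [Fact p.Prime] [Algebra (ZMod p) F] (a : CentralLabel F) (c c' : F)
    (ψ : evenBase a c c' →* ℂˣ) : Prop :=
  IsCentral p a ψ ∧ ∀ t : F, Takes ψ (x7_18_19 a t) (phi p (c * t)) ∧
    Takes ψ (x10_11_17 a t) (phi p (c' * t)) ∧ Takes ψ (x 11 t) 1 ∧ Takes ψ (x 17 t) 1 ∧
    Takes ψ (x 18 t) 1 ∧ Takes ψ (x 19 t) 1

/-- The sign `(-1)^d`, for `d` an integer modulo `2`. -/
def sign (d : ZMod 2) : ℂ := (-1) ^ d.val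

/-- `χ` is the character `χ^{a₁₆, a₂₁, a₂₂, a₂₈}`. -/
def EvenLabel1 (p : ℕ) [Fact p.Prime] [Algebra (ZMod p) F] (a : CentralLabel F)
    (χ : X F → ℂ) : Prop :=
  ∃ ψ : evenBase a 0 0 →* ℂˣ, EvenChar p a 0 0 ψ ∧ χ = ind ψ

/-- `χ` is the character `χ_{d_{1,14,15}, d_2}^{a_{7,18,19}, a₁₆, a₂₁, a₂₂, a₂₈}`, for the label
`(a, a_{7,18,19}, d_{1,14,15}, d_2)`: the two signs are the values of the inducing linear character
at `x_{1,14,15}(a_{7,18,19} / (a₂₁ a₂₂ a₂₈))` and at `x₂(a₂₁ a₂₂ a₂₈ / a_{7,18,19}²)`. -/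
def EvenLabel2 (p : ℕ) [Fact p.Prime] [Algebra (ZMod p) F]
    (l : CentralLabel F × Fˣ × ZMod 2 × ZMod 2) (χ : X F → ℂ) : Prop :=
  match l with
  | (a, c, d1, d2) => ∃ ψ : evenBase a c 0 →* ℂˣ, EvenChar p a c 0 ψ ∧
      Takes ψ (x1_14_15 a (c / a.u)) (sign d1) ∧ Takes ψ (x 2 (a.u / (c : F) ^ 2)) (sign d2) ∧
      χ = ind ψ

/-- `χ` is the character `χ_{d_4, d_{5,6,12}}^{a_{10,11,17}, a₁₆, a₂₁, a₂₂, a₂₈}`, for the label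
`(a, a_{10,11,17}, d_4, d_{5,6,12})`: the two signs are the values of the inducing linear character
at `x₄(a₁₆ a₂₁ a₂₂ / a_{10,11,17}²)` and at `x_{5,6,12}(a_{10,11,17} / (a₁₆ a₂₁ a₂₂))`. -/
def EvenLabel3 (p : ℕ) [Fact p.Prime] [Algebra (ZMod p) F]
    (l : CentralLabel F × Fˣ × ZMod 2 × ZMod 2) (χ : X F → ℂ) : Prop :=
  match l with
  | (a, c', d4, d5) => ∃ ψ : evenBase a 0 c' →* ℂˣ, EvenChar p a 0 c' ψ ∧
      Takes ψ (x 4 (a.v / (c' : F) ^ 2)) (sign d4) ∧ Takes ψ (x5_6_12 a (c' / a.v)) (sign d5) ∧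
      χ = ind ψ

/-- `χ` is the character
`χ_{d_{1,14,15}, d_2, d_4, d_{5,6,12}}^{a_{7,18,19}, a_{10,11,17}, a₁₆, a₂₁, a₂₂, a₂₈}`, for the label
`(a, a_{7,18,19}, a_{10,11,17}, d_{1,14,15}, d_2, d_4, d_{5,6,12})`. -/
def EvenLabel4 (p : ℕ) [Fact p.Prime] [Algebra (ZMod p) F]
    (l : CentralLabel F × Fˣ × Fˣ × ZMod 2 × ZMod 2 × ZMod 2 × ZMod 2) (χ : X F → ℂ) : Prop :=
  match l with
  | (a, c, c', d1, d2, d4, d5) => ∃ ψ : evenBase a (c : F) (c' : F) →* ℂˣ, EvenChar p a c c' ψ ∧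
      Takes ψ (x1_14_15 a (c / a.u)) (sign d1) ∧ Takes ψ (x 2 (a.u / (c : F) ^ 2)) (sign d2) ∧
      Takes ψ (x 4 (a.v / (c' : F) ^ 2)) (sign d4) ∧ Takes ψ (x5_6_12 a (c' / a.v)) (sign d5) ∧
      χ = ind ψ

/-- The set of all characters `χ_{b₂, b₄}^{a₁₆, a₂₁, a₂₂, a₂₈}` (used for `p ≠ 2`). -/
def oddFamily (F : Type*) [Field F] (p : ℕ) [Fact p.Prime] [Algebra (ZMod p) F] :
    Set (X F → ℂ) := {χ | ∃ l, OddLabel p l χ}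

/-- The first family for `p = 2`: all characters
`χ^{a₁₆, a₂₁, a₂₂, a₂₈}`. -/
def evenFamily1 (F : Type*) [Field F] (p : ℕ) [Fact p.Prime] [Algebra (ZMod p) F] :
    Set (X F → ℂ) := {χ | ∃ l, EvenLabel1 p l χ}

/-- The second family for `p = 2`: all characters
`χ_{d_{1,14,15}, d_2}^{a_{7,18,19}, a₁₆, a₂₁, a₂₂, a₂₈}`. -/
def evenFamily2 (F : Type*) [Field F] (p : ℕ) [Fact p.Prime] [Algebra (ZMod p) F] :
    Set (X F → ℂ) := {χ | ∃ l, EvenLabel2 p l χ}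

/-- The third family for `p = 2`: all characters
`χ_{d_4, d_{5,6,12}}^{a_{10,11,17}, a₁₆, a₂₁, a₂₂, a₂₈}`. -/
def evenFamily3 (F : Type*) [Field F] (p : ℕ) [Fact p.Prime] [Algebra (ZMod p) F] :
    Set (X F → ℂ) := {χ | ∃ l, EvenLabel3 p l χ}

/-- The fourth family for `p = 2`: all characters
`χ_{d_{1,14,15}, d_2, d_4, d_{5,6,12}}^{a_{7,18,19}, a_{10,11,17}, a₁₆, a₂₁, a₂₂, a₂₈}`. -/
def evenFamily4 (F : Type*) [Field F] (p : ℕ) [Fact p.Prime] [Algebra (ZMod p) F] :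
    Set (X F → ℂ) := {χ | ∃ l, EvenLabel4 p l χ}

end Labels

end Core

end UD6

/-! The group is a semidirect product. The twelve roots of `S \ I` span an abelian normal subgroup N
= `base F`, and the six roots of `I` span an abelian complement. A linear character of N amounts to
twelve parameters in F, one for each root, and the complement acts on them by explicit polynomial
formulas (`Par.act`). On the stabilizer of a parameter f the pairing with f is additive
(`Par.pair_mul`). Hence the character extends to its stabilizer, and commutators of the stabilizer
lie in its kernel. Clifford theory then gives three facts: every irreducible character is induced
from a linear character of such a stabilizer (`exists_eq_ind_of_mem_Irr`), all these induced
characters are irreducible (`ind_mem_Irr`), and equal ones come from conjugate restrictions to N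
(`exists_conjRes_eq_of_ind_eq`).

What remains is to find orbits and stabilizers when the four central parameters are nonzero. The
action splits into two blocks of the same shape: (s1, s14, s15) translates (f7, f18, f19) by a
linear map of determinant 2 a21 a22 a28, and (s12, s5, s6) translates (f17, f10, f11) by one of
determinant 2 a16 a21 a22.

For p odd both maps are invertible. The six parameters can be made zero in exactly one way, the
stabilizer is N, and f2, f4 label the orbits.

For p = 2 both maps have rank two. In the first block the cokernel leaves an invariant c, and the
kernel is the line of elements x_{1,14,15}(r), which changes f2 by rc + r²u. If c = 0 this is a
bijection of F, so f2 can be normalised and the block adds nothing to the stabilizer. If c ≠ 0 the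
changes form the index two subgroup of those δ with φ(δu/c²) = 1 (Artin–Schreier,
`exists_sq_add_self`), and r = c/u fixes f. So there are two classes of f2 (the sign d2) and two
extensions to the larger stabilizer (the sign d1), and the degree is halved. The second block
behaves in the same way and independently, with c', v and the signs d4, d5; this gives the four
families. -/

namespace UD6

/-! ### Linear characters of subgroups, their conjugates and induction -/

section LinearCharacters

variable {G : Type*} [Group G]

open Classical in
/-- The extension by zero of a linear character of a subgroup. -/
noncomputable def zeroExt {T : Subgroup G} (ψ : T →* ℂˣ) (g : G) : ℂ :=
  if h : g ∈ T then ((ψ ⟨g, h⟩ : ℂˣ) : ℂ) else 0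

theorem zeroExt_of_mem {T : Subgroup G} (ψ : T →* ℂˣ) {g : G} (h : g ∈ T) :
    zeroExt ψ g = ((ψ ⟨g, h⟩ : ℂˣ) : ℂ) := dif_pos h

theorem zeroExt_of_notMem {T : Subgroup G} (ψ : T →* ℂˣ) {g : G} (h : g ∉ T) :
    zeroExt ψ g = 0 := dif_neg h

theorem zeroExt_mul {T : Subgroup G} (ψ : T →* ℂˣ) {g h : G} (hg : g ∈ T) (hh : h ∈ T) :
    zeroExt ψ (g * h) = zeroExt ψ g * zeroExt ψ h := by
  rw [zeroExt_of_mem ψ hg, zeroExt_of_mem ψ hh, zeroExt_of_mem ψ (mul_mem hg hh)]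
  rw [← Units.val_mul, ← map_mul]
  rfl

theorem zeroExt_one {T : Subgroup G} (ψ : T →* ℂˣ) : zeroExt ψ 1 = 1 := by
  rw [zeroExt_of_mem ψ (one_mem T)]
  exact congrArg Units.val (map_one ψ)

theorem takes_iff {T : Subgroup G} (ψ : T →* ℂˣ) (g : G) (z : ℂ) :
    Takes ψ g z ↔ g ∈ T ∧ zeroExt ψ g = z := by
  constructor
  · rintro ⟨h, rfl⟩; exact ⟨h, zeroExt_of_mem ψ h⟩
  · rintro ⟨h, rfl⟩; exact ⟨h, (zeroExt_of_mem ψ h).symm⟩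

theorem zeroExt_conj {T : Subgroup G} (ψ : T →* ℂˣ) {g y : G} (hy : y ∈ T) :
    zeroExt ψ (y⁻¹ * g * y) = zeroExt ψ g := by
  by_cases hg : g ∈ T
  · rw [zeroExt_mul ψ (mul_mem (inv_mem hy) hg) hy, zeroExt_mul ψ (inv_mem hy) hg, mul_right_comm,
      ← zeroExt_mul ψ (inv_mem hy) hy, inv_mul_cancel, zeroExt_one, one_mul]
  · rw [zeroExt_of_notMem ψ hg, zeroExt_of_notMem]
    intro h
    apply hg
    have := mul_mem (mul_mem hy h) (inv_mem hy)
    simpa [mul_assoc] using this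

/-- Extending by zero removes the membership condition from the sum, so that the summation variable
can be changed freely. -/
theorem ind_eq_sum [Fintype G] {T : Subgroup G} (ψ : T →* ℂˣ) (g : G) :
    ind ψ g = (Nat.card T : ℂ)⁻¹ * ∑ y : G, zeroExt ψ (y⁻¹ * g * y) := by
  classical
  rw [ind, finsum_eq_sum_of_fintype]
  congr 1
  refine Finset.sum_congr rfl fun y _ => ?_
  by_cases h : y⁻¹ * g * y ∈ T
  · rw [zeroExt_of_mem ψ h, finsum_eq_dif, dif_pos h]
  · rw [zeroExt_of_notMem ψ h, finsum_eq_dif, dif_neg h]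

theorem ind_one [Finite G] {T : Subgroup G} (ψ : T →* ℂˣ) : ind ψ 1 = T.index := by
  cases nonempty_fintype G
  rw [ind_eq_sum]
  simp only [mul_one, inv_mul_cancel, zeroExt_one, Finset.sum_const, Finset.card_univ,
    nsmul_eq_mul]
  rw [← Nat.card_eq_fintype_card, ← T.card_mul_index, Nat.cast_mul, ← mul_assoc,
    inv_mul_cancel₀ (Nat.cast_ne_zero.mpr Nat.card_pos.ne'), one_mul]

/-- The linear character `n ↦ ψ(y⁻¹ n y)` of a normal subgroup `N` of the domain of `ψ`. -/
def conjRes {N T : Subgroup G} [hN : N.Normal] (h : N ≤ T) (ψ : T →* ℂˣ) (y : G) : N →* ℂˣ where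
  toFun n := ψ ⟨y⁻¹ * n * y, h (by simpa using hN.conj_mem n n.2 y⁻¹)⟩
  map_one' := by
    rw [← map_one ψ]
    congr 1
    ext
    simp
  map_mul' a b := by
    rw [← map_mul]
    congr 1
    ext
    simp [mul_assoc]

theorem coe_conjRes {N T : Subgroup G} [hN : N.Normal] (h : N ≤ T) (ψ : T →* ℂˣ) (y : G) (n : N) :
    ((conjRes h ψ y n : ℂˣ) : ℂ) = zeroExt ψ (y⁻¹ * n * y) := (zeroExt_of_mem ψ _).symm

theorem conjRes_eq_iff {N T T' : Subgroup G} [hN : N.Normal] (h : N ≤ T) (h' : N ≤ T')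
    (ψ : T →* ℂˣ) (ψ' : T' →* ℂˣ) (y y' : G) :
    conjRes h ψ y = conjRes h' ψ' y' ↔
      ∀ n ∈ N, zeroExt ψ (y⁻¹ * n * y) = zeroExt ψ' (y'⁻¹ * n * y') := by
  constructor
  · intro e n hn
    rw [← coe_conjRes h ψ y ⟨n, hn⟩, e, coe_conjRes]
  · intro e
    ext n
    rw [coe_conjRes, coe_conjRes, e n n.2]

/-- Orthogonality of linear characters: the quotient of two distinct ones is nontrivial, so its
values sum to zero. -/
theorem sum_mul_inv_eq [Finite G] {N : Subgroup G} [Fintype N] (μ ν : N →* ℂˣ) [Decidable (μ = ν)] :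
    ∑ n : N, ((μ n : ℂˣ) : ℂ) * ((ν n : ℂˣ) : ℂ)⁻¹ = if μ = ν then (Nat.card N : ℂ) else 0 := by
  split_ifs with h
  · subst h
    simp [Nat.card_eq_fintype_card]
  · have := sum_hom_units_eq_zero ((Units.coeHom ℂ).comp (μ * ν⁻¹)) (by
      intro e
      apply h
      ext n
      have := DFunLike.congr_fun e n
      simp only [MonoidHom.comp_apply, MonoidHom.mul_apply, MonoidHom.inv_apply,
        Units.coeHom_apply, MonoidHom.one_apply, Units.val_mul, Units.val_inv_eq_inv_val] at this
      exact (mul_inv_eq_one₀ (Units.ne_zero _)).mp this)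
    simpa using this

/-- Up to the factor |N| this is the multiplicity of ν in the restriction of the induced character:
it counts the y for which the y-conjugate of ψ restricts to ν. -/
theorem sum_ind_mul_inv [Fintype G] {N T : Subgroup G} [N.Normal] [Fintype N] (h : N ≤ T)
    (ψ : T →* ℂˣ) (ν : N →* ℂˣ) [∀ y, Decidable (conjRes h ψ y = ν)] :
    ∑ n : N, ind ψ n * ((ν n : ℂˣ) : ℂ)⁻¹ =
      (Nat.card T : ℂ)⁻¹ * ((Finset.univ.filter fun y => conjRes h ψ y = ν).card * Nat.card N) := by
  simp only [ind_eq_sum, mul_assoc, Finset.sum_mul]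
  rw [← Finset.mul_sum, Finset.sum_comm]
  congr 1
  rw [Finset.card_filter, Nat.cast_sum, Finset.sum_mul]
  refine Finset.sum_congr rfl fun y _ => ?_
  have := sum_mul_inv_eq (conjRes h ψ y) ν
  simp only [coe_conjRes, mul_assoc] at this
  rw [this]
  split_ifs <;> simp

/-- Linear characters inducing the same character have conjugate restrictions to every normal
subgroup. -/
theorem exists_conjRes_eq_of_ind_eq [Finite G] {N T T' : Subgroup G} [N.Normal] (h : N ≤ T)
    (h' : N ≤ T') (ψ : T →* ℂˣ) (ψ' : T' →* ℂˣ) (e : ind ψ = ind ψ') :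
    ∃ y, conjRes h ψ y = conjRes h' ψ' 1 := by
  classical
  cases nonempty_fintype G
  by_contra! hne
  -- The multiplicity of ψ'|N is computed twice. Through ψ no y contributes; through ψ' at least y =
  -- 1 does.
  have h1 := sum_ind_mul_inv h ψ (conjRes h' ψ' 1)
  have h2 := sum_ind_mul_inv h' ψ' (conjRes h' ψ' 1)
  rw [e, h2, Finset.filter_false_of_mem fun y _ => hne y] at h1
  simp only [Finset.card_empty, Nat.cast_zero, zero_mul, mul_zero, mul_eq_zero, inv_eq_zero,
    Nat.cast_eq_zero, Nat.card_pos.ne', or_false, false_or, Finset.card_eq_zero] at h1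
  have : (1 : G) ∈ Finset.univ.filter fun y => conjRes h' ψ' y = conjRes h' ψ' 1 := by simp
  rw [h1] at this
  exact Finset.notMem_empty _ this

theorem zeroExt_conjRes_self {T : Subgroup G} [hT : T.Normal] (ψ : T →* ℂˣ) (y g : G) :
    zeroExt (conjRes le_rfl ψ y) g = zeroExt ψ (y⁻¹ * g * y) := by
  by_cases h : g ∈ T
  · rw [zeroExt_of_mem _ h, coe_conjRes]
  · rw [zeroExt_of_notMem _ h, zeroExt_of_notMem]
    intro h'
    apply h
    have := hT.conj_mem _ h' y
    simpa [mul_assoc] using this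

/-- Translation of the summation variable by y. This allows parameters to be moved to a normal form
without changing the induced character. -/
theorem ind_conjRes [Finite G] {T : Subgroup G} [T.Normal] (ψ : T →* ℂˣ) (y : G) :
    ind (conjRes le_rfl ψ y) = ind ψ := by
  cases nonempty_fintype G
  funext g
  rw [ind_eq_sum, ind_eq_sum]
  congr 1
  simp only [zeroExt_conjRes_self]
  rw [← Equiv.sum_comp (Equiv.mulRight y) fun z => zeroExt ψ (z⁻¹ * g * z)]
  simp [mul_assoc]

end LinearCharacters

/-! ### Clifford theory over an abelian normal subgroup -/

section Irreducible

variable {G : Type*} [Group G] {W : Type*} [AddCommGroup W] [Module ℂ W]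

theorem isIrreducible_iff (ρ : Representation ℂ G W) :
    ρ.IsIrreducible ↔ Nontrivial W ∧
      ∀ U : Submodule ℂ W, (∀ g, ∀ v ∈ U, ρ g v ∈ U) → U = ⊥ ∨ U = ⊤ := by
  constructor
  · intro h
    refine ⟨?_, fun U hU => ?_⟩
    · by_contra hn
      rw [not_nontrivial_iff_subsingleton] at hn
      obtain ⟨a, b, hab⟩ := h.exists_pair_ne
      exact hab (SetLike.ext fun v => by
        rw [Subsingleton.elim v 0]
        exact iff_of_true a.toSubmodule.zero_mem b.toSubmodule.zero_mem)
    · rcases h.eq_bot_or_eq_top ⟨U, hU⟩ with h1 | h1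
      · exact Or.inl (congrArg Subrepresentation.toSubmodule h1)
      · exact Or.inr (congrArg Subrepresentation.toSubmodule h1)
  · rintro ⟨hn, h⟩
    refine { exists_pair_ne := ⟨⊥, ⊤, fun e => ?_⟩, eq_bot_or_eq_top := fun a => ?_ }
    · exact bot_ne_top (α := Submodule ℂ W) (congrArg Subrepresentation.toSubmodule e)
    · rcases h a.toSubmodule (fun g v hv => a.apply_mem_toSubmodule g hv) with h1 | h1
      · exact Or.inl (Subrepresentation.toSubmodule_injective h1)
      · exact Or.inr (Subrepresentation.toSubmodule_injective h1)

/-- `Irr` requires a space in the lowest universe, so ρ is transported to the coordinate space ℂⁿ by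
a basis. -/
theorem character_mem_Irr [FiniteDimensional ℂ W] (ρ : Representation ℂ G W)
    (h : ρ.IsIrreducible) : ρ.character ∈ Irr G := by
  let e : W ≃ₗ[ℂ] (Fin (Module.finrank ℂ W) → ℂ) := (Module.finBasis ℂ W).equivFun
  let σ : Representation ℂ G (Fin (Module.finrank ℂ W) → ℂ) :=
    { toFun := fun g => e.conj (ρ g)
      map_one' := by rw [map_one]; exact LinearEquiv.conj_id e
      map_mul' := fun a b => by rw [map_mul]; exact LinearEquiv.conj_comp e _ _ }
  refine ⟨_, _, _, inferInstance, σ, ?_, ?_⟩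
  · rw [isIrreducible_iff] at h ⊢
    obtain ⟨hn, hs⟩ := h
    refine ⟨e.symm.toEquiv.nontrivial, fun U hU => ?_⟩
    rcases hs (U.comap e.toLinearMap) (fun g v hv => by
      have := hU g (e v) hv
      simpa [σ, LinearEquiv.conj_apply] using this) with h1 | h1
    · left
      rw [eq_bot_iff]
      intro u hu
      have : e.symm u ∈ U.comap e.toLinearMap := by simpa using hu
      rw [h1, Submodule.mem_bot] at this
      simpa using this
    · right
      rw [eq_top_iff]
      intro u _
      have : e.symm u ∈ U.comap e.toLinearMap := by rw [h1]; trivial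
      simpa using this
  · funext g
    exact LinearMap.trace_conj' (ρ g) e

/-- Commuting operators have a common eigenvector. -/
theorem exists_common_eigenvector [FiniteDimensional ℂ W] (ρ : Representation ℂ G W)
    (T : Subgroup G) (U : Submodule ℂ W) (hU : U ≠ ⊥) (hstab : ∀ t ∈ T, ∀ u ∈ U, ρ t u ∈ U)
    (hcomm : ∀ t ∈ T, ∀ t' ∈ T, ∀ u ∈ U, ρ t (ρ t' u) = ρ t' (ρ t u)) :
    ∃ w ∈ U, w ≠ 0 ∧ ∃ ψ : T →* ℂˣ, ∀ t : T, ρ t w = ((ψ t : ℂˣ) : ℂ) • w := by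
  -- On a minimal nonzero stable subspace M each operator of T is a scalar: its eigenspace in M is
  -- again stable, because the operators commute, hence it is all of M. Any nonzero vector of M then
  -- serves.
  obtain ⟨M, ⟨hM0, hMU, hMs⟩, hMmin⟩ := wellFounded_lt.has_min
    {M : Submodule ℂ W | M ≠ ⊥ ∧ M ≤ U ∧ ∀ t ∈ T, ∀ u ∈ M, ρ t u ∈ M} ⟨U, hU, le_rfl, hstab⟩
  have key : ∀ t : T, ∃ μ : ℂ, ∀ u ∈ M, ρ t u = μ • u := by
    intro t
    have : Nontrivial M := Submodule.nontrivial_iff_ne_bot.mpr hM0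
    obtain ⟨μ, hμ⟩ := Module.End.exists_eigenvalue ((ρ t).restrict (hMs t t.2))
    obtain ⟨v, hv⟩ := hμ.exists_hasEigenvector
    refine ⟨μ, ?_⟩
    let M' : Submodule ℂ W := M ⊓ LinearMap.ker (ρ t - μ • LinearMap.id)
    have hmem : ∀ x, x ∈ M' ↔ x ∈ M ∧ ρ t x = μ • x := fun x => by
      simp [M', sub_eq_zero]
    have hM' : ¬ M' < M := hMmin M' ⟨?_, inf_le_left.trans hMU, ?_⟩
    · have := eq_of_le_of_not_lt (inf_le_left : M' ≤ M) hM'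
      intro u hu
      rw [← this] at hu
      exact ((hmem u).mp hu).2
    · intro e
      have : (v : W) ∈ M' := (hmem _).mpr ⟨v.2, by
        have := hv.apply_eq_smul
        exact congrArg Subtype.val this⟩
      rw [e, Submodule.mem_bot] at this
      exact hv.2 (Subtype.ext this)
    · intro t' ht' u hu
      obtain ⟨h1, h2⟩ := (hmem u).mp hu
      refine (hmem _).mpr ⟨hMs t' ht' u h1, ?_⟩
      rw [hcomm t t.2 t' ht' u (hMU h1), h2, map_smul]
  obtain ⟨w, hwM, hw0⟩ := Submodule.exists_mem_ne_zero_of_ne_bot hM0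
  choose μ hμ using key
  have hinj : Function.Injective fun z : ℂ => z • w := smul_left_injective ℂ hw0
  let f : T →* ℂ :=
    { toFun := μ
      map_one' := hinj (by
        change μ 1 • w = (1 : ℂ) • w
        rw [← hμ 1 w hwM]; simp)
      map_mul' := fun a b => hinj (by
        change μ (a * b) • w = (μ a * μ b) • w
        rw [← hμ _ w hwM, Subgroup.coe_mul, map_mul, Module.End.mul_apply, hμ b w hwM, map_smul,
          hμ a w hwM, smul_smul, mul_comm]) }
  exact ⟨w, hMU hwM, hw0, f.toHomUnits, fun t => hμ t w hwM⟩

variable [Finite G] {N T : Subgroup G} [N.Normal]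

/-- In the basis of coset translates of w every group element acts by a monomial matrix. A diagonal
entry is nonzero only when the coset is fixed, and is then a value of ψ. -/
theorem trace_basis_monomial [FiniteDimensional ℂ W] (ρ : Representation ℂ G W) (ψ : T →* ℂˣ)
    (b : Module.Basis (G ⧸ T) ℂ W) {w : W} (hw : ∀ t : T, ρ t w = ((ψ t : ℂˣ) : ℂ) • w)
    (hb : ∀ q, b q = ρ q.out w) : ρ.character = ind ψ := by
  classical
  cases nonempty_fintype G
  cases nonempty_fintype T
  funext g
  have hdiag : ∀ q : G ⧸ T, b.repr (ρ g (b q)) q = zeroExt ψ (q.out⁻¹ * g * q.out) := by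
    intro q
    set q' : G ⧸ T := (QuotientGroup.mk (g * q.out) : G ⧸ T) with hq'
    have hmem : q'.out⁻¹ * (g * q.out) ∈ T := by
      rw [← QuotientGroup.eq, QuotientGroup.out_eq']
    have h1 : ρ g (b q) = ((ψ ⟨_, hmem⟩ : ℂˣ) : ℂ) • b q' := by
      rw [hb, hb, ← map_smul, ← hw ⟨_, hmem⟩]
      simp only [← Module.End.mul_apply, ← map_mul]
      simp
    rw [h1, map_smul, Module.Basis.repr_self, Finsupp.smul_single, smul_eq_mul, mul_one,
      Finsupp.single_apply]
    by_cases hqq : q' = q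
    · rw [if_pos hqq]
      rw [← zeroExt_of_mem ψ hmem, hqq, mul_assoc]
    · rw [if_neg hqq, zeroExt_of_notMem]
      intro h
      apply hqq
      rw [mul_assoc, ← QuotientGroup.eq, QuotientGroup.out_eq'] at h
      exact h.symm
  have : ρ.character g = ∑ q : G ⧸ T, zeroExt ψ (q.out⁻¹ * g * q.out) := by
    rw [Representation.character, LinearMap.trace_eq_matrix_trace ℂ b, Matrix.trace]
    refine Finset.sum_congr rfl fun q _ => ?_
    rw [Matrix.diag_apply, LinearMap.toMatrix_apply, hdiag]
  rw [this, ind_eq_sum]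
  -- The sum defining `ind` runs over G instead of cosets. Its terms are constant on cosets, so each
  -- is counted |T| times, which the prefactor cancels.
  let e : (G ⧸ T) × T ≃ G :=
    { toFun := fun x => x.1.out * x.2
      invFun := fun y => (y, ⟨(QuotientGroup.mk y : G ⧸ T).out⁻¹ * y, by
        rw [← QuotientGroup.eq, QuotientGroup.out_eq']⟩)
      left_inv := fun x => by
        have : (QuotientGroup.mk (x.1.out * x.2) : G ⧸ T) = x.1 := by
          rw [QuotientGroup.mk_mul_of_mem _ x.2.2, QuotientGroup.out_eq']
        ext
        · exact this
        · simp [this]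
      right_inv := fun y => by simp }
  rw [← Equiv.sum_comp e, Fintype.sum_prod_type]
  have hsum : ∀ q : G ⧸ T, ∑ t : T, zeroExt ψ ((e (q, t))⁻¹ * g * e (q, t)) =
      Nat.card T * zeroExt ψ (q.out⁻¹ * g * q.out) := by
    intro q
    rw [Nat.card_eq_fintype_card, ← nsmul_eq_mul, ← Finset.card_univ, ← Finset.sum_const]
    refine Finset.sum_congr rfl fun t _ => ?_
    rw [← zeroExt_conj ψ (g := q.out⁻¹ * g * q.out) t.2]
    congr 1
    simp [e, mul_assoc]
  rw [Finset.sum_congr rfl fun q _ => hsum q, ← Finset.mul_sum, ← mul_assoc,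
    inv_mul_cancel₀ (Nat.cast_ne_zero.mpr Nat.card_pos.ne'), one_mul]

/-- A linear character is inertial with respect to `N` if its domain contains the stabilizer of its
restriction to `N`. -/
def IsInertial (h : N ≤ T) (ψ : T →* ℂˣ) : Prop :=
  ∀ y, conjRes h ψ y = conjRes h ψ 1 → y ∈ T

/-- The projection of `w` to the eigenspace for a conjugate of the restriction of `ψ`. -/
theorem sum_conjRes_inv_smul [Fintype N] (h : N ≤ T) (ψ : T →* ℂˣ) (hψ : IsInertial h ψ)
    (ρ : Representation ℂ G W) {w : W} (hw : ∀ t : T, ρ t w = ((ψ t : ℂˣ) : ℂ) • w)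
    (q q' : G ⧸ T) [Decidable (q' = q)] :
    ∑ n : N, (((conjRes h ψ q.out n : ℂˣ) : ℂ))⁻¹ • ρ n (ρ q'.out w) =
      if q' = q then (Nat.card N : ℂ) • ρ q.out w else 0 := by
  classical
  have h1 : ∀ n : N, ρ n (ρ q'.out w) = ((conjRes h ψ q'.out n : ℂˣ) : ℂ) • ρ q'.out w := by
    intro n
    rw [← map_smul]
    have : ρ ↑n (ρ q'.out w) = ρ q'.out (ρ (q'.out⁻¹ * n * q'.out) w) := by
      simp only [← Module.End.mul_apply, ← map_mul]
      congr 2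
      group
    rw [this]
    congr 1
    exact hw ⟨q'.out⁻¹ * n * q'.out, h (by
      simpa using (inferInstance : N.Normal).conj_mem n n.2 q'.out⁻¹)⟩
  simp only [h1, smul_smul, mul_comm _ ((conjRes h ψ q'.out _ : ℂˣ) : ℂ)]
  rw [← Finset.sum_smul, sum_mul_inv_eq]
  by_cases hq : q' = q
  · subst hq; simp
  · rw [if_neg hq, if_neg, zero_smul]
    intro e
    apply hq
    rw [← QuotientGroup.out_eq' q', ← QuotientGroup.out_eq' q, eq_comm, QuotientGroup.eq]
    apply hψ
    rw [conjRes_eq_iff] at e ⊢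
    -- Two representatives giving the same conjugate of ψ differ by an element stabilizing ψ|N, as
    -- evaluation at the conjugate of n by `q.out` shows.
    intro n hn
    have := e (q.out * n * q.out⁻¹) ((inferInstance : N.Normal).conj_mem n hn q.out)
    simpa [mul_assoc] using this

/-- An irreducible representation with an eigenvector for an inertial linear character is induced
from it. -/
theorem character_eq_ind [FiniteDimensional ℂ W] (h : N ≤ T) (ψ : T →* ℂˣ)
    (hψ : IsInertial h ψ) (ρ : Representation ℂ G W) (hρ : ρ.IsIrreducible) {w : W} (hw0 : w ≠ 0)
    (hw : ∀ t : T, ρ t w = ((ψ t : ℂˣ) : ℂ) • w) : ρ.character = ind ψ := by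
  classical
  cases nonempty_fintype G
  cases nonempty_fintype N
  cases nonempty_fintype T
  have hinj : ∀ g : G, ∀ v : W, ρ g v = 0 → v = 0 := fun g v hv => by
    have := congrArg (ρ g⁻¹) hv
    rwa [map_zero, ← Module.End.mul_apply, ← map_mul, inv_mul_cancel, map_one,
      Module.End.one_apply] at this
  -- The translates of w lie in eigenspaces of N for distinct characters, hence are independent.
  -- Their span is G-stable, hence everything.
  let f : G ⧸ T → W := fun q => ρ q.out w
  have hli : LinearIndependent ℂ f := by
    rw [Fintype.linearIndependent_iff]
    intro c hc q
    have h1 : ∑ n : N, (((conjRes h ψ q.out n : ℂˣ) : ℂ))⁻¹ • ρ n (∑ i, c i • f i) = 0 := by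
      simp [hc]
    simp only [map_sum, map_smul, Finset.smul_sum, smul_comm _ (c _)] at h1
    rw [Finset.sum_comm] at h1
    simp only [← Finset.smul_sum, f, sum_conjRes_inv_smul h ψ hψ ρ hw] at h1
    simp only [smul_ite, smul_zero, Finset.sum_ite_eq', Finset.mem_univ, if_true, smul_smul] at h1
    rw [smul_eq_zero, mul_eq_zero] at h1
    rcases h1 with (h1 | h1) | h1
    · exact h1
    · exact absurd h1 (Nat.cast_ne_zero.mpr Nat.card_pos.ne')
    · exact absurd (hinj _ _ h1) hw0
  have hspan : ⊤ ≤ Submodule.span ℂ (Set.range f) := by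
    rcases ((isIrreducible_iff ρ).mp hρ).2 (Submodule.span ℂ (Set.range f)) (fun g v hv => by
      induction hv using Submodule.span_induction with
      | mem x hx =>
        obtain ⟨q, rfl⟩ := hx
        have hmem : (QuotientGroup.mk (g * q.out) : G ⧸ T).out⁻¹ * (g * q.out) ∈ T := by
          rw [← QuotientGroup.eq, QuotientGroup.out_eq']
        have : ρ g (f q) =
            ((ψ ⟨_, hmem⟩ : ℂˣ) : ℂ) • f (QuotientGroup.mk (g * q.out) : G ⧸ T) := by
          simp only [f]
          rw [← map_smul, ← hw ⟨_, hmem⟩]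
          simp only [← Module.End.mul_apply, ← map_mul]
          simp
        rw [this]
        exact Submodule.smul_mem _ _ (Submodule.subset_span ⟨_, rfl⟩)
      | zero => simp
      | add x y _ _ hx hy => rw [map_add]; exact add_mem hx hy
      | smul c x _ hx => rw [map_smul]; exact Submodule.smul_mem _ _ hx) with h1 | h1
    · have : f (1 : G) ∈ Submodule.span ℂ (Set.range f) := Submodule.subset_span ⟨_, rfl⟩
      rw [h1, Submodule.mem_bot] at this
      exact absurd (hinj _ _ this) hw0
    · rw [h1]
  exact trace_basis_monomial ρ ψ (Module.Basis.mk hli hspan) hw fun q => by simp [f]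

/-- Some irreducible representation has an eigenvector for a given linear character of a
subgroup. -/
theorem exists_irreducible_eigenvector.{u} {G : Type u} [Group G] [Finite G] {T : Subgroup G}
    (ψ : T →* ℂˣ) :
    ∃ (W : Type u) (_ : AddCommGroup W) (_ : Module ℂ W) (_ : FiniteDimensional ℂ W)
      (ρ : Representation ℂ G W), ρ.IsIrreducible ∧
      ∃ w, w ≠ 0 ∧ ∀ t : T, ρ t w = ((ψ t : ℂˣ) : ℂ) • w := by
  cases nonempty_fintype G
  let reg : Representation ℂ G (G → ℂ) :=
    { toFun := fun g => LinearMap.funLeft ℂ ℂ fun x => g⁻¹ * x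
      map_one' := by ext; simp
      map_mul' := fun a b => by ext; simp [LinearMap.funLeft_apply, mul_assoc] }
  have hreg : ∀ g f x, reg g f x = f (g⁻¹ * x) := fun _ _ _ => rfl
  -- The inverse in the argument makes f an eigenvector of T for ψ itself under left translation.
  let f : G → ℂ := fun x => zeroExt ψ x⁻¹
  have hf : ∀ t : T, reg t f = ((ψ t : ℂˣ) : ℂ) • f := by
    intro t
    funext x
    rw [hreg, Pi.smul_apply, smul_eq_mul, ← zeroExt_of_mem ψ t.2]
    simp only [f]
    rw [mul_inv_rev, inv_inv]
    by_cases hx : x⁻¹ ∈ T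
    · rw [zeroExt_mul ψ hx t.2, mul_comm]
    · rw [zeroExt_of_notMem ψ hx, zeroExt_of_notMem ψ, mul_zero]
      intro h
      exact hx (by simpa [mul_assoc] using mul_mem h (inv_mem t.2))
  have hf0 : f ≠ 0 := fun e => by
    have := congrFun e 1
    simp [f, zeroExt_one] at this
  -- M is minimal among the invariant subspaces containing a nonzero eigenvector for ψ, rather than
  -- among all invariant subspaces; irreducibility has to be deduced.
  obtain ⟨M, ⟨w, hwM, hw0, hw, hMs⟩, hMmin⟩ := wellFounded_lt.has_min
    {M : Submodule ℂ (G → ℂ) | ∃ w ∈ M, w ≠ 0 ∧ (∀ t : T, reg t w = ((ψ t : ℂˣ) : ℂ) • w) ∧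
      ∀ g, ∀ v ∈ M, reg g v ∈ M} ⟨⊤, f, trivial, hf0, hf, fun _ _ _ => trivial⟩
  let S : Subrepresentation reg := ⟨M, hMs⟩
  refine ⟨M, inferInstance, inferInstance, inferInstance, S.toRepresentation, ?_, ⟨w, hwM⟩,
    fun e => hw0 (congrArg Subtype.val e), fun t => Subtype.ext (hw t)⟩
  refine (isIrreducible_iff _).mpr ⟨⟨⟨w, hwM⟩, 0, fun e => hw0 (congrArg Subtype.val e)⟩,
    fun U hU => ?_⟩
  have hUs : ∀ g, ∀ v ∈ U.map M.subtype, reg g v ∈ U.map M.subtype := by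
    rintro g _ ⟨v, hv, rfl⟩
    exact ⟨_, hU g v hv, rfl⟩
  have hUM : U.map M.subtype ≤ M := Submodule.map_subtype_le M U
  -- By Maschke, w = u + r along U and an invariant complement R. If u = 0, then M ∩ R contains w,
  -- so M lies in R and U = 0. Otherwise u is itself an eigenvector for ψ, and minimality gives U =
  -- M.
  obtain ⟨R, hR⟩ := exists_isCompl (⟨U.map M.subtype, hUs⟩ : Subrepresentation reg)
  have hdisj : ∀ x, x ∈ U.map M.subtype → x ∈ R.toSubmodule → x = 0 := fun x h1 h2 => by
    have : U.map M.subtype ⊓ R.toSubmodule = ⊥ :=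
      congrArg Subrepresentation.toSubmodule hR.inf_eq_bot
    have h3 : x ∈ U.map M.subtype ⊓ R.toSubmodule := ⟨h1, h2⟩
    rwa [this, Submodule.mem_bot] at h3
  have htop : w ∈ U.map M.subtype ⊔ R.toSubmodule := by
    have : U.map M.subtype ⊔ R.toSubmodule = ⊤ :=
      congrArg Subrepresentation.toSubmodule hR.sup_eq_top
    rw [this]; trivial
  obtain ⟨u, hu, r, hr, hur⟩ := Submodule.mem_sup.mp htop
  by_cases hu0 : u = 0
  · left
    rw [hu0, zero_add] at hur
    have := eq_of_le_of_not_lt (inf_le_left : M ⊓ R.toSubmodule ≤ M)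
      (hMmin _ ⟨w, ⟨hwM, hur ▸ hr⟩, hw0, hw, fun g v hv =>
        ⟨hMs g v hv.1, R.apply_mem_toSubmodule g hv.2⟩⟩)
    rw [eq_bot_iff]
    intro x hx
    have hxU : (x : G → ℂ) ∈ U.map M.subtype := ⟨x, hx, rfl⟩
    have hxR : (x : G → ℂ) ∈ M ⊓ R.toSubmodule := this.symm.le x.2
    exact Subtype.ext (hdisj _ hxU hxR.2)
  · right
    have hue : ∀ t : T, reg t u = ((ψ t : ℂˣ) : ℂ) • u := by
      intro t
      have h1 := hw t
      rw [← hur, map_add, smul_add] at h1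
      rw [← sub_eq_zero]
      apply hdisj
      · exact sub_mem (hUs _ _ hu) (Submodule.smul_mem _ _ hu)
      · have : reg t u - ((ψ t : ℂˣ) : ℂ) • u = ((ψ t : ℂˣ) : ℂ) • r - reg t r := by
          rw [sub_eq_sub_iff_add_eq_add, h1, add_comm]
        rw [this]
        exact sub_mem (Submodule.smul_mem _ _ hr) (R.apply_mem_toSubmodule _ hr)
    have := eq_of_le_of_not_lt hUM (hMmin _ ⟨u, hu, hu0, hue, hUs⟩)
    rw [eq_top_iff]
    intro x _
    have hx : (x : G → ℂ) ∈ U.map M.subtype := this.symm.le x.2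
    obtain ⟨y, hy, hyx⟩ := hx
    rwa [← Subtype.ext hyx]

/-- No induced module is constructed: some irreducible constituent of the regular representation has
an eigenvector for ψ, and its character is forced to be `ind ψ`. -/
theorem ind_mem_Irr (h : N ≤ T) (ψ : T →* ℂˣ) (hψ : IsInertial h ψ) : ind ψ ∈ Irr G := by
  obtain ⟨W, _, _, _, ρ, hρ, w, hw0, hw⟩ := exists_irreducible_eigenvector ψ
  rw [← character_eq_ind h ψ hψ ρ hρ hw0 hw]
  exact character_mem_Irr ρ hρ

/-- Irreducible characters are induced from linear characters of stabilizers, if all linear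
characters of the abelian normal subgroup `N` have abelian stabilizers modulo their kernels. -/
theorem exists_eq_ind_of_mem_Irr (hab : ∀ a ∈ N, ∀ b ∈ N, a * b = b * a)
    (T : (N →* ℂˣ) → Subgroup G) (hNT : ∀ μ, N ≤ T μ)
    (hT : ∀ μ : N →* ℂˣ, ∀ y, y ∈ T μ ↔ ∀ n ∈ N, zeroExt μ (y⁻¹ * n * y) = zeroExt μ n)
    (hcomm : ∀ μ : N →* ℂˣ, ∀ t ∈ T μ, ∀ t' ∈ T μ, ∃ n : N, t * t' = t' * t * n ∧ μ n = 1)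
    {χ : G → ℂ} (hχ : χ ∈ Irr G) :
    ∃ (μ : N →* ℂˣ) (ψ : T μ →* ℂˣ), (∀ n ∈ N, zeroExt ψ n = zeroExt μ n) ∧
      IsInertial (hNT μ) ψ ∧ χ = ind ψ := by
  obtain ⟨W, _, _, _, ρ, hρ, rfl⟩ := hχ
  have hnt := ((isIrreducible_iff ρ).mp hρ).1
  obtain ⟨w₀, -, hw₀, μ, hμ⟩ := exists_common_eigenvector ρ N ⊤ top_ne_bot
    (fun _ _ _ _ => trivial) (fun a ha b hb u _ => by
      rw [← Module.End.mul_apply, ← map_mul, hab a ha b hb, map_mul, Module.End.mul_apply])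
  -- U is the eigenspace of N for μ. The stabilizer of μ preserves it and acts on it by commuting
  -- operators, since commutators act through μ and are trivial. A common eigenvector in U yields
  -- the extension ψ of μ.
  let U : Submodule ℂ W :=
    { carrier := {u | ∀ n : N, ρ n u = ((μ n : ℂˣ) : ℂ) • u}
      add_mem' := fun {a b} ha hb n => by
        rw [map_add, ha n, hb n, smul_add]
      zero_mem' := fun n => by simp
      smul_mem' := fun c a ha n => by rw [map_smul, ha n, smul_comm] }
  have hU : ∀ u ∈ U, ∀ n : N, ρ n u = ((μ n : ℂˣ) : ℂ) • u := fun u hu => hu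
  obtain ⟨w, hwU, hw0, ψ, hψ⟩ := exists_common_eigenvector ρ (T μ) U
    (fun e => hw₀ ((Submodule.mem_bot ℂ).mp (e ▸ (hμ : w₀ ∈ U))))
    (fun t ht u hu n => by
      have hn : t⁻¹ * n * t ∈ N := by
        simpa using (inferInstance : N.Normal).conj_mem n n.2 t⁻¹
      have h1 : ρ n (ρ t u) = ρ t (ρ (t⁻¹ * n * t) u) := by
        simp only [← Module.End.mul_apply, ← map_mul]
        congr 2
        group
      have h2 := (hT μ t).mp ht n n.2
      rw [zeroExt_of_mem μ hn, zeroExt_of_mem μ n.2] at h2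
      rw [h1, hU u hu ⟨_, hn⟩, map_smul, h2])
    (fun t ht t' ht' u hu => by
      obtain ⟨n, hn, hn1⟩ := hcomm μ t ht t' ht'
      simp only [← Module.End.mul_apply, ← map_mul]
      rw [hn, map_mul, Module.End.mul_apply, hU u hu n, hn1, Units.val_one, one_smul])
  have hres : ∀ n ∈ N, zeroExt ψ n = zeroExt μ n := by
    intro n hn
    have h1 := hψ ⟨n, hNT μ hn⟩
    have h2 := hU w hwU ⟨n, hn⟩
    rw [zeroExt_of_mem μ hn, zeroExt_of_mem ψ (hNT μ hn)]
    exact smul_left_injective ℂ hw0 (h1.symm.trans h2)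
  have hin : IsInertial (hNT μ) ψ := by
    intro y hy
    rw [conjRes_eq_iff] at hy
    rw [hT]
    intro n hn
    have := hy n hn
    rw [hres _ (by simpa using (inferInstance : N.Normal).conj_mem n hn y⁻¹)] at this
    rw [this]
    simp [hres n hn]
  exact ⟨μ, ψ, hres, hin, character_eq_ind (hNT μ) ψ hin ρ hρ hw0 hψ⟩

end Irreducible

/-! ### Commutators of root elements with explicit signs -/

section RootElements

variable {F : Type*} [Field F]

/-- `rootVector_bracket` leaves the structure constant unspecified. The group law in coordinates
needs its sign, which this lemma and the next three determine for each shape of pair of roots. -/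
theorem rootVector_bracket_minus_minus (i j l : Fin 6) (h : i < j) (h' : j < l) :
    rootVector F (minusRoot i j h) * rootVector F (minusRoot j l h') =
      rootVector F (minusRoot j l h') * rootVector F (minusRoot i j h) +
        (1 : F) • rootVector F (minusRoot i l (h.trans h')) := by
  have := h.ne
  have := h'.ne
  have := (h.trans h').ne
  simp only [rootVector_minusRoot, mul_sub, sub_mul, single_mul_single_ite,
    Sum.inl.injEq, Sum.inr.injEq, reduceCtorEq, if_false]
  simp_all [eq_comm, sub_eq_add_neg]

theorem rootVector_bracket_minus_plus (i j l : Fin 6) (h : i < j) (h' : j < l) :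
    rootVector F (minusRoot i j h) * rootVector F (plusRoot j l h') =
      rootVector F (plusRoot j l h') * rootVector F (minusRoot i j h) +
        (1 : F) • rootVector F (plusRoot i l (h.trans h')) := by
  have := h.ne
  have hk := h'.ne
  have := (h.trans h').ne
  simp [rootVector_minusRoot, rootVector_plusRoot, mul_sub, sub_mul, hk, hk.symm]

theorem rootVector_bracket_minus_plus_of_lt (i j k : Fin 6) (h : i < j) (h' : k < j) (hik : i < k) :
    rootVector F (minusRoot i j h) * rootVector F (plusRoot k j h') =
      rootVector F (plusRoot k j h') * rootVector F (minusRoot i j h) +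
        (-1 : F) • rootVector F (plusRoot i k hik) := by
  have hk := h'.ne
  simp [rootVector_minusRoot, rootVector_plusRoot, mul_sub, sub_mul, hk, hk.symm]
  abel

theorem rootVector_bracket_minus_plus_of_gt (i j k : Fin 6) (h : i < j) (h' : k < j) (hki : k < i) :
    rootVector F (minusRoot i j h) * rootVector F (plusRoot k j h') =
      rootVector F (plusRoot k j h') * rootVector F (minusRoot i j h) +
        (1 : F) • rootVector F (plusRoot k i hki) := by
  have hk := h'.ne
  simp [rootVector_minusRoot, rootVector_plusRoot, mul_sub, sub_mul, hk, hk.symm]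
  abel

theorem rootElt_add (α : PosRoot) (s t : F) : rootElt α (s + t) = rootElt α s * rootElt α t := by
  apply Units.ext
  simp only [Units.val_mul, rootElt, mul_add, add_mul, smul_mul_smul_comm, rootVector_sq, smul_zero,
    mul_one, one_mul, add_smul]
  abel

/-- Squares and sandwiches of root vectors vanish, hence u N_γ annihilates N_β and N_δ on its right.
No higher term survives in the conjugate. -/
theorem rootElt_conj_of_bracket {β δ γ : PosRoot} {u : F} (s t : F)
    (h : rootVector F β * rootVector F δ =
      rootVector F δ * rootVector F β + u • rootVector F γ) :
    rootElt β s * rootElt δ t * (rootElt β s)⁻¹ = rootElt γ (u * s * t) * rootElt δ t := by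
  have hs := rootVector_sq (F := F) β
  have hsw := rootVector_sandwich (F := F) β δ
  have hsw' := rootVector_sandwich (F := F) δ β
  have h1 : (u • rootVector F γ) * rootVector F β = -(rootVector F δ * rootVector F β *
      rootVector F β) + rootVector F β * rootVector F δ * rootVector F β := by
    rw [h]; noncomm_ring
  have h2 : (u • rootVector F γ) * rootVector F δ = rootVector F β * (rootVector F δ *
      rootVector F δ) - rootVector F δ * rootVector F β * rootVector F δ := by
    rw [← mul_assoc, h]; noncomm_ring
  rw [mul_assoc, hs, hsw, mul_zero, neg_zero, add_zero] at h1
  rw [rootVector_sq, hsw', mul_zero, sub_zero] at h2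
  rw [mul_inv_eq_iff_eq_mul]
  apply Units.ext
  have hu : u * s * t = s * t * u := by ring
  simp only [Units.val_mul, rootElt, hu]
  have e1 : ((s * t * u) • rootVector F γ) * (t • rootVector F δ) = 0 := by
    rw [mul_smul, smul_mul_smul_comm, h2, smul_zero]
  have e2 : ((s * t * u) • rootVector F γ) * (s • rootVector F β) = 0 := by
    rw [mul_smul, smul_mul_smul_comm, h1, smul_zero]
  have e3 : (s • rootVector F β) * (t • rootVector F δ) =
      (t • rootVector F δ) * (s • rootVector F β) + (s * t * u) • rootVector F γ := by
    rw [smul_mul_smul_comm, h, smul_mul_smul_comm, smul_add, smul_smul, mul_comm t s]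
  simp only [mul_add, add_mul, one_mul, mul_one, e1, e2, e3, zero_mul]
  abel

namespace Quattern

variable (Q : Quattern)

theorem x_of_mem {α : PosRoot} (h : α ∈ Q.P) (t : F) :
    Q.x α t = QuotientGroup.mk ⟨rootElt α t, rootElt_mem h t⟩ := dif_pos h

theorem x_add (α : PosRoot) (s t : F) : Q.x α (s + t) = Q.x α s * Q.x α t := by
  by_cases h : α ∈ Q.P
  · rw [x_of_mem Q h, x_of_mem Q h, x_of_mem Q h, ← QuotientGroup.mk_mul]
    congr 1
    exact Subtype.ext (rootElt_add α s t)
  · simp [x, h]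

theorem x_zero (α : PosRoot) : Q.x α (0 : F) = 1 := by
  have := Q.x_add α (0 : F) 0
  rw [add_zero] at this
  exact left_eq_mul.mp this

theorem x_eq_one {α : PosRoot} (h : α ∈ Q.K) (t : F) : Q.x α t = 1 := by
  rw [x_of_mem Q (Q.subset h), QuotientGroup.eq_one_iff, Subgroup.mem_subgroupOf]
  exact rootElt_mem h t

theorem x_comm {α β : PosRoot} (h : ∀ γ, IsSum α β γ → γ ∈ Q.K) (s t : F) :
    Q.x α s * Q.x β t = Q.x β t * Q.x α s := by
  by_cases hα : α ∈ Q.P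
  · by_cases hβ : β ∈ Q.P
    · rw [← mul_inv_eq_iff_eq_mul]
      rcases rootElt_conj α β s t with h1 | ⟨γ, hγ, u, h1⟩
      · rw [x_of_mem Q hα, x_of_mem Q hβ, ← QuotientGroup.mk_mul, ← QuotientGroup.mk_inv,
          ← QuotientGroup.mk_mul]
        congr 1
        exact Subtype.ext h1
      · have h2 := Q.x_eq_one (h γ hγ) u
        have hγP := Q.subset (h γ hγ)
        rw [x_of_mem Q hα, x_of_mem Q hβ, ← QuotientGroup.mk_mul, ← QuotientGroup.mk_inv,
          ← QuotientGroup.mk_mul]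
        refine Eq.trans ?_ (one_mul _)
        rw [← h2, x_of_mem Q hγP, ← QuotientGroup.mk_mul]
        congr 1
        exact Subtype.ext h1
    · simp [x, hβ]
  · simp [x, hα]

theorem x_conj {β δ γ : PosRoot} (hβ : β ∈ Q.P) (hδ : δ ∈ Q.P) (hγ : γ ∈ Q.P) {u : F}
    (h : rootVector F β * rootVector F δ =
      rootVector F δ * rootVector F β + u • rootVector F γ) (s t : F) :
    Q.x β s * Q.x δ t * (Q.x β s)⁻¹ = Q.x γ (u * s * t) * Q.x δ t := by
  rw [x_of_mem Q hβ, x_of_mem Q hδ, x_of_mem Q hγ, ← QuotientGroup.mk_mul, ← QuotientGroup.mk_inv,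
    ← QuotientGroup.mk_mul, ← QuotientGroup.mk_mul]
  congr 1
  exact Subtype.ext (rootElt_conj_of_bracket s t h)

theorem x_conj' {β δ γ : PosRoot} (hβ : β ∈ Q.P) (hδ : δ ∈ Q.P) (hγ : γ ∈ Q.P) {u : F}
    (h : rootVector F δ * rootVector F β =
      rootVector F β * rootVector F δ + u • rootVector F γ) (s t : F) :
    Q.x β s * Q.x δ t * (Q.x β s)⁻¹ = Q.x γ (-u * s * t) * Q.x δ t :=
  x_conj Q hβ hδ hγ (by rw [h]; simp) s t

theorem x_conj_self_of_sum_mem {β δ : PosRoot} (h : ∀ γ, IsSum β δ γ → γ ∈ Q.K) (s t : F) :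
    Q.x β s * Q.x δ t * (Q.x β s)⁻¹ = Q.x δ t := by
  rw [Q.x_comm h, mul_inv_cancel_right]

end Quattern

end RootElements

/-! ### Coordinates on the core group -/

namespace Core

variable {F : Type*} [Field F]

/-- This finite check and the next make the normal part and the complement abelian modulo X_𝒦. -/
theorem sum_mem_K_of_mem_S_sdiff_I : ∀ α ∈ S \ I, ∀ β ∈ S \ I, ∀ γ, IsSum α β γ → γ ∈ K := by
  decide +kernel

theorem sum_mem_K_of_mem_I : ∀ α ∈ I, ∀ β ∈ I, ∀ γ, IsSum α β γ → γ ∈ K := by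
  decide +kernel

instance : IsMulCommutative (base F) := by
  refine ⟨⟨?_⟩⟩
  have : ∀ a ∈ base F, ∀ b ∈ base F, a * b = b * a := by
    intro a ha b hb
    refine Subgroup.closure_induction₂ (p := fun a b _ _ => a * b = b * a) ?_ ?_ ?_ ?_ ?_ ?_ ?_ ha
      hb
    · rintro _ _ ⟨α, hα, s, rfl⟩ ⟨β, hβ, t, rfl⟩
      exact Q.x_comm (sum_mem_K_of_mem_S_sdiff_I α hα β hβ) s t
    · simp
    · simp
    · intro x y z _ _ _ h1 h2
      exact (Commute.mul_left h1 h2 : Commute (x * y) z)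
    · intro y z x _ _ _ h1 h2
      exact (Commute.mul_right h1 h2 : Commute x (y * z))
    · intro x y _ _ h
      exact (Commute.inv_left h : Commute x⁻¹ y)
    · intro x y _ _ h
      exact (Commute.inv_right h : Commute x y⁻¹)
  rintro ⟨a, ha⟩ ⟨b, hb⟩
  exact Subtype.ext (this a ha b hb)

/-- The root subgroups of the abelian subgroup, written additively. -/
def xBase (n : ℕ) (h : root n ∈ S \ I := by decide) : F →+ Additive (base F) where
  toFun t := Additive.ofMul ⟨x n t, Subgroup.subset_closure ⟨root n, h, t, rfl⟩⟩
  map_zero' := congrArg Additive.ofMul (Subtype.ext (Q.x_zero (root n)))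
  map_add' s t := congrArg Additive.ofMul (Subtype.ext (Q.x_add (root n) s t))

/-- Coordinates of an element of `X_𝒮`: those of the abelian normal subgroup `X_{𝒮 ∖ ℐ}` and those
of
its complement generated by the root subgroups of `ℐ`. -/
@[ext]
structure Coord (F : Type*) where
  /-- The coordinate for `X_2`. -/
  t2 : F
  /-- The coordinate for `X_4`. -/
  t4 : F
  /-- The coordinate for `X_7`. -/
  t7 : F
  /-- The coordinate for `X_10`. -/
  t10 : F
  /-- The coordinate for `X_11`. -/
  t11 : F
  /-- The coordinate for `X_17`. -/
  t17 : F
  /-- The coordinate for `X_18`. -/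
  t18 : F
  /-- The coordinate for `X_19`. -/
  t19 : F
  /-- The coordinate for `X_16`. -/
  t16 : F
  /-- The coordinate for `X_21`. -/
  t21 : F
  /-- The coordinate for `X_22`. -/
  t22 : F
  /-- The coordinate for `X_28`. -/
  t28 : F
  /-- The coordinate for `X_1`. -/
  s1 : F
  /-- The coordinate for `X_5`. -/
  s5 : F
  /-- The coordinate for `X_6`. -/
  s6 : F
  /-- The coordinate for `X_12`. -/
  s12 : F
  /-- The coordinate for `X_14`. -/
  s14 : F
  /-- The coordinate for `X_15`. -/
  s15 : F

namespace Coord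

/-- The multiplication of `X_𝒮` in coordinates. -/
instance : Mul (Coord F) where
  mul g h :=
    { t2 := g.t2 + h.t2
      t4 := g.t4 + h.t4
      t7 := g.t7 + (h.t7 + g.s1 * h.t2)
      t10 := g.t10 + (h.t10 - g.s5 * h.t4)
      t11 := g.t11 + (h.t11 - g.s6 * h.t4)
      t17 := g.t17 + (h.t17 + g.s12 * h.t4)
      t18 := g.t18 + (h.t18 - g.s14 * h.t2)
      t19 := g.t19 + (h.t19 - g.s15 * h.t2)
      t16 := g.t16 + (h.t16 + g.s5 * h.t11 + g.s6 * h.t10 - g.s5 * g.s6 * h.t4)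
      t21 := g.t21 + (h.t21 + g.s1 * h.t18 - g.s14 * h.t7 - g.s1 * g.s14 * h.t2
        - g.s5 * h.t17 + g.s12 * h.t10 - g.s5 * g.s12 * h.t4)
      t22 := g.t22 + (h.t22 + g.s1 * h.t19 - g.s15 * h.t7 - g.s1 * g.s15 * h.t2
        - g.s6 * h.t17 + g.s12 * h.t11 - g.s6 * g.s12 * h.t4)
      t28 := g.t28 + (h.t28 + g.s14 * h.t19 + g.s15 * h.t18 - g.s14 * g.s15 * h.t2)
      s1 := g.s1 + h.s1
      s5 := g.s5 + h.s5
      s6 := g.s6 + h.s6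
      s12 := g.s12 + h.s12
      s14 := g.s14 + h.s14
      s15 := g.s15 + h.s15 }

instance : One (Coord F) where
  one := ⟨0, 0, 0, 0, 0, 0, 0, 0, 0, 0, 0, 0, 0, 0, 0, 0, 0, 0⟩

instance : Inv (Coord F) where
  inv g :=
    { t2 := -g.t2
      t4 := -g.t4
      t7 := -(g.t7 - g.s1 * g.t2)
      t10 := -(g.t10 + g.s5 * g.t4)
      t11 := -(g.t11 + g.s6 * g.t4)
      t17 := -(g.t17 - g.s12 * g.t4)
      t18 := -(g.t18 + g.s14 * g.t2)
      t19 := -(g.t19 + g.s15 * g.t2)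
      t16 := -(g.t16 - g.s5 * g.t11 - g.s6 * g.t10 - g.s5 * g.s6 * g.t4)
      t21 := -(g.t21 - g.s1 * g.t18 + g.s14 * g.t7 - g.s1 * g.s14 * g.t2
        + g.s5 * g.t17 - g.s12 * g.t10 - g.s5 * g.s12 * g.t4)
      t22 := -(g.t22 - g.s1 * g.t19 + g.s15 * g.t7 - g.s1 * g.s15 * g.t2
        + g.s6 * g.t17 - g.s12 * g.t11 - g.s6 * g.s12 * g.t4)
      t28 := -(g.t28 - g.s14 * g.t19 - g.s15 * g.t18 - g.s14 * g.s15 * g.t2)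
      s1 := -g.s1
      s5 := -g.s5
      s6 := -g.s6
      s12 := -g.s12
      s14 := -g.s14
      s15 := -g.s15 }

@[simp] theorem mul_t2 (g h : Coord F) : (g * h).t2 = g.t2 + h.t2 := rfl
@[simp] theorem mul_t4 (g h : Coord F) : (g * h).t4 = g.t4 + h.t4 := rfl
@[simp] theorem mul_t7 (g h : Coord F) : (g * h).t7 = g.t7 + (h.t7 + g.s1 * h.t2) := rfl
@[simp] theorem mul_t10 (g h : Coord F) : (g * h).t10 = g.t10 + (h.t10 - g.s5 * h.t4) := rfl
@[simp] theorem mul_t11 (g h : Coord F) : (g * h).t11 = g.t11 + (h.t11 - g.s6 * h.t4) := rfl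
@[simp] theorem mul_t17 (g h : Coord F) : (g * h).t17 = g.t17 + (h.t17 + g.s12 * h.t4) := rfl
@[simp] theorem mul_t18 (g h : Coord F) : (g * h).t18 = g.t18 + (h.t18 - g.s14 * h.t2) := rfl
@[simp] theorem mul_t19 (g h : Coord F) : (g * h).t19 = g.t19 + (h.t19 - g.s15 * h.t2) := rfl
@[simp] theorem mul_t16 (g h : Coord F) : (g * h).t16 = g.t16 +
    (h.t16 + g.s5 * h.t11 + g.s6 * h.t10 - g.s5 * g.s6 * h.t4) := rfl
@[simp] theorem mul_t21 (g h : Coord F) : (g * h).t21 = g.t21 +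
    (h.t21 + g.s1 * h.t18 - g.s14 * h.t7 - g.s1 * g.s14 * h.t2
      - g.s5 * h.t17 + g.s12 * h.t10 - g.s5 * g.s12 * h.t4) := rfl
@[simp] theorem mul_t22 (g h : Coord F) : (g * h).t22 = g.t22 +
    (h.t22 + g.s1 * h.t19 - g.s15 * h.t7 - g.s1 * g.s15 * h.t2
      - g.s6 * h.t17 + g.s12 * h.t11 - g.s6 * g.s12 * h.t4) := rfl
@[simp] theorem mul_t28 (g h : Coord F) : (g * h).t28 = g.t28 +
    (h.t28 + g.s14 * h.t19 + g.s15 * h.t18 - g.s14 * g.s15 * h.t2) := rfl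
@[simp] theorem mul_s1 (g h : Coord F) : (g * h).s1 = g.s1 + h.s1 := rfl
@[simp] theorem mul_s5 (g h : Coord F) : (g * h).s5 = g.s5 + h.s5 := rfl
@[simp] theorem mul_s6 (g h : Coord F) : (g * h).s6 = g.s6 + h.s6 := rfl
@[simp] theorem mul_s12 (g h : Coord F) : (g * h).s12 = g.s12 + h.s12 := rfl
@[simp] theorem mul_s14 (g h : Coord F) : (g * h).s14 = g.s14 + h.s14 := rfl
@[simp] theorem mul_s15 (g h : Coord F) : (g * h).s15 = g.s15 + h.s15 := rfl
@[simp] theorem one_t2 : (1 : Coord F).t2 = 0 := rfl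
@[simp] theorem one_t4 : (1 : Coord F).t4 = 0 := rfl
@[simp] theorem one_t7 : (1 : Coord F).t7 = 0 := rfl
@[simp] theorem one_t10 : (1 : Coord F).t10 = 0 := rfl
@[simp] theorem one_t11 : (1 : Coord F).t11 = 0 := rfl
@[simp] theorem one_t17 : (1 : Coord F).t17 = 0 := rfl
@[simp] theorem one_t18 : (1 : Coord F).t18 = 0 := rfl
@[simp] theorem one_t19 : (1 : Coord F).t19 = 0 := rfl
@[simp] theorem one_t16 : (1 : Coord F).t16 = 0 := rfl
@[simp] theorem one_t21 : (1 : Coord F).t21 = 0 := rfl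
@[simp] theorem one_t22 : (1 : Coord F).t22 = 0 := rfl
@[simp] theorem one_t28 : (1 : Coord F).t28 = 0 := rfl
@[simp] theorem one_s1 : (1 : Coord F).s1 = 0 := rfl
@[simp] theorem one_s5 : (1 : Coord F).s5 = 0 := rfl
@[simp] theorem one_s6 : (1 : Coord F).s6 = 0 := rfl
@[simp] theorem one_s12 : (1 : Coord F).s12 = 0 := rfl
@[simp] theorem one_s14 : (1 : Coord F).s14 = 0 := rfl
@[simp] theorem one_s15 : (1 : Coord F).s15 = 0 := rfl

@[simp] theorem inv_t2 (g : Coord F) : g⁻¹.t2 = -g.t2 := rfl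
@[simp] theorem inv_t4 (g : Coord F) : g⁻¹.t4 = -g.t4 := rfl
@[simp] theorem inv_t7 (g : Coord F) : g⁻¹.t7 = -(g.t7 - g.s1 * g.t2) := rfl
@[simp] theorem inv_t10 (g : Coord F) : g⁻¹.t10 = -(g.t10 + g.s5 * g.t4) := rfl
@[simp] theorem inv_t11 (g : Coord F) : g⁻¹.t11 = -(g.t11 + g.s6 * g.t4) := rfl
@[simp] theorem inv_t17 (g : Coord F) : g⁻¹.t17 = -(g.t17 - g.s12 * g.t4) := rfl
@[simp] theorem inv_t18 (g : Coord F) : g⁻¹.t18 = -(g.t18 + g.s14 * g.t2) := rfl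
@[simp] theorem inv_t19 (g : Coord F) : g⁻¹.t19 = -(g.t19 + g.s15 * g.t2) := rfl
@[simp] theorem inv_t16 (g : Coord F) : g⁻¹.t16 =
    -(g.t16 - g.s5 * g.t11 - g.s6 * g.t10 - g.s5 * g.s6 * g.t4) := rfl
@[simp] theorem inv_t21 (g : Coord F) : g⁻¹.t21 =
    -(g.t21 - g.s1 * g.t18 + g.s14 * g.t7 - g.s1 * g.s14 * g.t2 + g.s5 * g.t17 - g.s12 * g.t10 -
      g.s5 * g.s12 * g.t4) := rfl
@[simp] theorem inv_t22 (g : Coord F) : g⁻¹.t22 =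
    -(g.t22 - g.s1 * g.t19 + g.s15 * g.t7 - g.s1 * g.s15 * g.t2 + g.s6 * g.t17 - g.s12 * g.t11 -
      g.s6 * g.s12 * g.t4) := rfl
@[simp] theorem inv_t28 (g : Coord F) : g⁻¹.t28 =
    -(g.t28 - g.s14 * g.t19 - g.s15 * g.t18 - g.s14 * g.s15 * g.t2) := rfl
@[simp] theorem inv_s1 (g : Coord F) : g⁻¹.s1 = -g.s1 := rfl
@[simp] theorem inv_s5 (g : Coord F) : g⁻¹.s5 = -g.s5 := rfl
@[simp] theorem inv_s6 (g : Coord F) : g⁻¹.s6 = -g.s6 := rfl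
@[simp] theorem inv_s12 (g : Coord F) : g⁻¹.s12 = -g.s12 := rfl
@[simp] theorem inv_s14 (g : Coord F) : g⁻¹.s14 = -g.s14 := rfl
@[simp] theorem inv_s15 (g : Coord F) : g⁻¹.s15 = -g.s15 := rfl

instance : Group (Coord F) :=
  Group.ofLeftAxioms (fun a b c => by ext <;> simp <;> ring) (fun a => by ext <;> simp)
    (fun a => by ext <;> simp <;> ring)

end Coord

/-! ### The eighteen nontrivial commutator relations and the resulting group law -/

theorem x_conj_of_sum_mem_K (i j : ℕ) (h : ∀ γ, IsSum (root i) (root j) γ → γ ∈ Q.K) (s t : F) :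
    x i s * x j t * (x i s)⁻¹ = x j t :=
  Q.x_conj_self_of_sum_mem h s t

theorem x1_conj_x2 (s t : F) :
    x 1 s * x 2 t * (x 1 s)⁻¹ = x 7 ((s * t)) * x 2 t := by
  refine (Q.x_conj (β := root 1) (δ := root 2) (γ := root 7) (by decide)
    (by decide) (by decide) (rootVector_bracket_minus_minus 0 1 2 (by decide) (by decide)) s
      t).trans ?_
  simp only [one_mul]

theorem x1_conj_x18 (s t : F) :
    x 1 s * x 18 t * (x 1 s)⁻¹ = x 21 ((s * t)) * x 18 t := by
  refine (Q.x_conj (β := root 1) (δ := root 18) (γ := root 21) (by decide)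
    (by decide) (by decide) (rootVector_bracket_minus_minus 0 1 5 (by decide) (by decide)) s
      t).trans ?_
  simp only [one_mul]

theorem x1_conj_x19 (s t : F) :
    x 1 s * x 19 t * (x 1 s)⁻¹ = x 22 ((s * t)) * x 19 t := by
  refine (Q.x_conj (β := root 1) (δ := root 19) (γ := root 22) (by decide)
    (by decide) (by decide) (rootVector_bracket_minus_plus 0 1 5 (by decide) (by decide)) s t).trans
      ?_
  simp only [one_mul]

theorem x5_conj_x4 (s t : F) :
    x 5 s * x 4 t * (x 5 s)⁻¹ = x 10 (-(s * t)) * x 4 t := by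
  refine (Q.x_conj' (β := root 5) (δ := root 4) (γ := root 10) (by decide)
    (by decide) (by decide) (rootVector_bracket_minus_minus 3 4 5 (by decide) (by decide)) s
      t).trans ?_
  simp only [neg_mul, one_mul]

theorem x5_conj_x11 (s t : F) :
    x 5 s * x 11 t * (x 5 s)⁻¹ = x 16 ((s * t)) * x 11 t := by
  refine (Q.x_conj (β := root 5) (δ := root 11) (γ := root 16) (by decide)
    (by decide) (by decide) (rootVector_bracket_minus_plus_of_gt 4 5 3 (by decide) (by decide)
    (by decide)) s t).trans ?_
  simp only [one_mul]

theorem x5_conj_x17 (s t : F) :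
    x 5 s * x 17 t * (x 5 s)⁻¹ = x 21 (-(s * t)) * x 17 t := by
  refine (Q.x_conj' (β := root 5) (δ := root 17) (γ := root 21) (by decide)
    (by decide) (by decide) (rootVector_bracket_minus_minus 0 4 5 (by decide) (by decide)) s
      t).trans ?_
  simp only [neg_mul, one_mul]

theorem x6_conj_x4 (s t : F) :
    x 6 s * x 4 t * (x 6 s)⁻¹ = x 11 (-(s * t)) * x 4 t := by
  refine (Q.x_conj' (β := root 6) (δ := root 4) (γ := root 11) (by decide)
    (by decide) (by decide) (rootVector_bracket_minus_plus 3 4 5 (by decide) (by decide)) s t).trans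
      ?_
  simp only [neg_mul, one_mul]

theorem x6_conj_x10 (s t : F) :
    x 6 s * x 10 t * (x 6 s)⁻¹ = x 16 ((s * t)) * x 10 t := by
  refine (Q.x_conj' (β := root 6) (δ := root 10) (γ := root 16) (by decide)
    (by decide) (by decide) (rootVector_bracket_minus_plus_of_lt 3 5 4 (by decide) (by decide)
    (by decide)) s t).trans ?_
  -- The coefficient -1 of the bracket cancels the sign from taking it in the opposite order.
  simp only [neg_neg, one_mul]

theorem x6_conj_x17 (s t : F) :
    x 6 s * x 17 t * (x 6 s)⁻¹ = x 22 (-(s * t)) * x 17 t := by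
  refine (Q.x_conj' (β := root 6) (δ := root 17) (γ := root 22) (by decide)
    (by decide) (by decide) (rootVector_bracket_minus_plus 0 4 5 (by decide) (by decide)) s t).trans
      ?_
  simp only [neg_mul, one_mul]

theorem x12_conj_x4 (s t : F) :
    x 12 s * x 4 t * (x 12 s)⁻¹ = x 17 ((s * t)) * x 4 t := by
  refine (Q.x_conj (β := root 12) (δ := root 4) (γ := root 17) (by decide)
    (by decide) (by decide) (rootVector_bracket_minus_minus 0 3 4 (by decide) (by decide)) s
      t).trans ?_
  simp only [one_mul]

theorem x12_conj_x10 (s t : F) :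
    x 12 s * x 10 t * (x 12 s)⁻¹ = x 21 ((s * t)) * x 10 t := by
  refine (Q.x_conj (β := root 12) (δ := root 10) (γ := root 21) (by decide)
    (by decide) (by decide) (rootVector_bracket_minus_minus 0 3 5 (by decide) (by decide)) s
      t).trans ?_
  simp only [one_mul]

theorem x12_conj_x11 (s t : F) :
    x 12 s * x 11 t * (x 12 s)⁻¹ = x 22 ((s * t)) * x 11 t := by
  refine (Q.x_conj (β := root 12) (δ := root 11) (γ := root 22) (by decide)
    (by decide) (by decide) (rootVector_bracket_minus_plus 0 3 5 (by decide) (by decide)) s t).trans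
      ?_
  simp only [one_mul]

theorem x14_conj_x2 (s t : F) :
    x 14 s * x 2 t * (x 14 s)⁻¹ = x 18 (-(s * t)) * x 2 t := by
  refine (Q.x_conj' (β := root 14) (δ := root 2) (γ := root 18) (by decide)
    (by decide) (by decide) (rootVector_bracket_minus_minus 1 2 5 (by decide) (by decide)) s
      t).trans ?_
  simp only [neg_mul, one_mul]

theorem x14_conj_x7 (s t : F) :
    x 14 s * x 7 t * (x 14 s)⁻¹ = x 21 (-(s * t)) * x 7 t := by
  refine (Q.x_conj' (β := root 14) (δ := root 7) (γ := root 21) (by decide)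
    (by decide) (by decide) (rootVector_bracket_minus_minus 0 2 5 (by decide) (by decide)) s
      t).trans ?_
  simp only [neg_mul, one_mul]

theorem x14_conj_x19 (s t : F) :
    x 14 s * x 19 t * (x 14 s)⁻¹ = x 28 ((s * t)) * x 19 t := by
  refine (Q.x_conj (β := root 14) (δ := root 19) (γ := root 28) (by decide)
    (by decide) (by decide) (rootVector_bracket_minus_plus_of_gt 2 5 1 (by decide) (by decide)
    (by decide)) s t).trans ?_
  simp only [one_mul]

theorem x15_conj_x2 (s t : F) :
    x 15 s * x 2 t * (x 15 s)⁻¹ = x 19 (-(s * t)) * x 2 t := by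
  refine (Q.x_conj' (β := root 15) (δ := root 2) (γ := root 19) (by decide)
    (by decide) (by decide) (rootVector_bracket_minus_plus 1 2 5 (by decide) (by decide)) s t).trans
      ?_
  simp only [neg_mul, one_mul]

theorem x15_conj_x7 (s t : F) :
    x 15 s * x 7 t * (x 15 s)⁻¹ = x 22 (-(s * t)) * x 7 t := by
  refine (Q.x_conj' (β := root 15) (δ := root 7) (γ := root 22) (by decide)
    (by decide) (by decide) (rootVector_bracket_minus_plus 0 2 5 (by decide) (by decide)) s t).trans
      ?_
  simp only [neg_mul, one_mul]

theorem x15_conj_x18 (s t : F) :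
    x 15 s * x 18 t * (x 15 s)⁻¹ = x 28 ((s * t)) * x 18 t := by
  refine (Q.x_conj' (β := root 15) (δ := root 18) (γ := root 28) (by decide)
    (by decide) (by decide) (rootVector_bracket_minus_plus_of_lt 1 5 2 (by decide) (by decide)
    (by decide)) s t).trans ?_
  simp only [neg_neg, one_mul]

namespace Coord

open scoped IsMulCommutative

/-- The element of the abelian normal subgroup with the given coordinates. -/
def toBase (g : Coord F) : Additive (base F) :=
  (xBase 2) g.t2 + (xBase 4) g.t4 + (xBase 7) g.t7 + (xBase 10) g.t10 + (xBase 11) g.t11 + (xBase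
    17) g.t17 +
    (xBase 18) g.t18 + (xBase 19) g.t19 + (xBase 16) g.t16 + (xBase 21) g.t21 + (xBase 22) g.t22 +
      (xBase 28) g.t28

/-- The element of the complement with the given coordinates. -/
def toCompl (g : Coord F) : X F :=
  x 1 g.s1 * x 5 g.s5 * x 6 g.s6 * x 12 g.s12 * x 14 g.s14 * x 15 g.s15

/-- The element of `X_𝒮` with the given coordinates. -/
def toX (g : Coord F) : X F := (g.toBase.toMul : X F) * g.toCompl

theorem coe_toBase (g : Coord F) : (g.toBase.toMul : X F) =
    x 2 g.t2 * x 4 g.t4 * x 7 g.t7 * x 10 g.t10 * x 11 g.t11 * x 17 g.t17 * x 18 g.t18 * x 19 g.t19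
      * x 16 g.t16 * x 21 g.t21 * x 22 g.t22 * x 28 g.t28 := rfl

/-- Conjugation is an automorphism, so its effect on each root factor suffices. The images stay in
the abelian group `base F`, where they are collected additively. The five analogues below follow the
same pattern. -/
theorem x1_conj_toBase (s : F) (g : Coord F) :
    x 1 s * (g.toBase.toMul : X F) * (x 1 s)⁻¹ =
      (({ g with t7 := g.t7 + s * g.t2, t21 := g.t21 + s * g.t18, t22 := g.t22 + s * g.t19 } :
        Coord F).toBase.toMul : X F) := by
  have h2 : ∀ t : F, MulAut.conj (x 1 s) (((xBase 2) t).toMul : X F) =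
      ((xBase 7) ((s * t)) + (xBase 2) t).toMul := fun t => x1_conj_x2 s t
  have h4 : ∀ t : F, MulAut.conj (x 1 s) (((xBase 4) t).toMul : X F) =
      ((xBase 4) t).toMul := fun t => x_conj_of_sum_mem_K 1 4 (by decide +kernel) s t
  have h7 : ∀ t : F, MulAut.conj (x 1 s) (((xBase 7) t).toMul : X F) =
      ((xBase 7) t).toMul := fun t => x_conj_of_sum_mem_K 1 7 (by decide +kernel) s t
  have h10 : ∀ t : F, MulAut.conj (x 1 s) (((xBase 10) t).toMul : X F) =
      ((xBase 10) t).toMul := fun t => x_conj_of_sum_mem_K 1 10 (by decide +kernel) s t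
  have h11 : ∀ t : F, MulAut.conj (x 1 s) (((xBase 11) t).toMul : X F) =
      ((xBase 11) t).toMul := fun t => x_conj_of_sum_mem_K 1 11 (by decide +kernel) s t
  have h17 : ∀ t : F, MulAut.conj (x 1 s) (((xBase 17) t).toMul : X F) =
      ((xBase 17) t).toMul := fun t => x_conj_of_sum_mem_K 1 17 (by decide +kernel) s t
  have h18 : ∀ t : F, MulAut.conj (x 1 s) (((xBase 18) t).toMul : X F) =
      ((xBase 21) ((s * t)) + (xBase 18) t).toMul := fun t => x1_conj_x18 s t
  have h19 : ∀ t : F, MulAut.conj (x 1 s) (((xBase 19) t).toMul : X F) =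
      ((xBase 22) ((s * t)) + (xBase 19) t).toMul := fun t => x1_conj_x19 s t
  have h16 : ∀ t : F, MulAut.conj (x 1 s) (((xBase 16) t).toMul : X F) =
      ((xBase 16) t).toMul := fun t => x_conj_of_sum_mem_K 1 16 (by decide +kernel) s t
  have h21 : ∀ t : F, MulAut.conj (x 1 s) (((xBase 21) t).toMul : X F) =
      ((xBase 21) t).toMul := fun t => x_conj_of_sum_mem_K 1 21 (by decide +kernel) s t
  have h22 : ∀ t : F, MulAut.conj (x 1 s) (((xBase 22) t).toMul : X F) =
      ((xBase 22) t).toMul := fun t => x_conj_of_sum_mem_K 1 22 (by decide +kernel) s t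
  have h28 : ∀ t : F, MulAut.conj (x 1 s) (((xBase 28) t).toMul : X F) =
      ((xBase 28) t).toMul := fun t => x_conj_of_sum_mem_K 1 28 (by decide +kernel) s t
  rw [← MulAut.conj_apply]
  simp only [toBase, toMul_add, Subgroup.coe_mul, map_mul, h2, h4, h7, h10, h11, h17, h18, h19, h16,
    h21, h22, h28]
  simp only [← Subgroup.coe_mul, ← toMul_add]
  refine congrArg (fun z : Additive (base F) => ((z.toMul : base F) : X F)) ?_
  simp only [map_add]
  abel

theorem x5_conj_toBase (s : F) (g : Coord F) :
    x 5 s * (g.toBase.toMul : X F) * (x 5 s)⁻¹ =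
      (({ g with t10 := g.t10 - s * g.t4, t16 := g.t16 + s * g.t11, t21 := g.t21 - s * g.t17 } :
        Coord F).toBase.toMul : X F) := by
  have h2 : ∀ t : F, MulAut.conj (x 5 s) (((xBase 2) t).toMul : X F) =
      ((xBase 2) t).toMul := fun t => x_conj_of_sum_mem_K 5 2 (by decide +kernel) s t
  have h4 : ∀ t : F, MulAut.conj (x 5 s) (((xBase 4) t).toMul : X F) =
      ((xBase 10) (-(s * t)) + (xBase 4) t).toMul := fun t => x5_conj_x4 s t
  have h7 : ∀ t : F, MulAut.conj (x 5 s) (((xBase 7) t).toMul : X F) =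
      ((xBase 7) t).toMul := fun t => x_conj_of_sum_mem_K 5 7 (by decide +kernel) s t
  have h10 : ∀ t : F, MulAut.conj (x 5 s) (((xBase 10) t).toMul : X F) =
      ((xBase 10) t).toMul := fun t => x_conj_of_sum_mem_K 5 10 (by decide +kernel) s t
  have h11 : ∀ t : F, MulAut.conj (x 5 s) (((xBase 11) t).toMul : X F) =
      ((xBase 16) ((s * t)) + (xBase 11) t).toMul := fun t => x5_conj_x11 s t
  have h17 : ∀ t : F, MulAut.conj (x 5 s) (((xBase 17) t).toMul : X F) =
      ((xBase 21) (-(s * t)) + (xBase 17) t).toMul := fun t => x5_conj_x17 s t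
  have h18 : ∀ t : F, MulAut.conj (x 5 s) (((xBase 18) t).toMul : X F) =
      ((xBase 18) t).toMul := fun t => x_conj_of_sum_mem_K 5 18 (by decide +kernel) s t
  have h19 : ∀ t : F, MulAut.conj (x 5 s) (((xBase 19) t).toMul : X F) =
      ((xBase 19) t).toMul := fun t => x_conj_of_sum_mem_K 5 19 (by decide +kernel) s t
  have h16 : ∀ t : F, MulAut.conj (x 5 s) (((xBase 16) t).toMul : X F) =
      ((xBase 16) t).toMul := fun t => x_conj_of_sum_mem_K 5 16 (by decide +kernel) s t
  have h21 : ∀ t : F, MulAut.conj (x 5 s) (((xBase 21) t).toMul : X F) =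
      ((xBase 21) t).toMul := fun t => x_conj_of_sum_mem_K 5 21 (by decide +kernel) s t
  have h22 : ∀ t : F, MulAut.conj (x 5 s) (((xBase 22) t).toMul : X F) =
      ((xBase 22) t).toMul := fun t => x_conj_of_sum_mem_K 5 22 (by decide +kernel) s t
  have h28 : ∀ t : F, MulAut.conj (x 5 s) (((xBase 28) t).toMul : X F) =
      ((xBase 28) t).toMul := fun t => x_conj_of_sum_mem_K 5 28 (by decide +kernel) s t
  rw [← MulAut.conj_apply]
  simp only [toBase, toMul_add, Subgroup.coe_mul, map_mul, h2, h4, h7, h10, h11, h17, h18, h19, h16,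
    h21, h22, h28]
  simp only [← Subgroup.coe_mul, ← toMul_add]
  refine congrArg (fun z : Additive (base F) => ((z.toMul : base F) : X F)) ?_
  simp only [map_add, map_sub, map_neg]
  abel

theorem x6_conj_toBase (s : F) (g : Coord F) :
    x 6 s * (g.toBase.toMul : X F) * (x 6 s)⁻¹ =
      (({ g with t11 := g.t11 - s * g.t4, t16 := g.t16 + s * g.t10, t22 := g.t22 - s * g.t17 } :
        Coord F).toBase.toMul : X F) := by
  have h2 : ∀ t : F, MulAut.conj (x 6 s) (((xBase 2) t).toMul : X F) =
      ((xBase 2) t).toMul := fun t => x_conj_of_sum_mem_K 6 2 (by decide +kernel) s t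
  have h4 : ∀ t : F, MulAut.conj (x 6 s) (((xBase 4) t).toMul : X F) =
      ((xBase 11) (-(s * t)) + (xBase 4) t).toMul := fun t => x6_conj_x4 s t
  have h7 : ∀ t : F, MulAut.conj (x 6 s) (((xBase 7) t).toMul : X F) =
      ((xBase 7) t).toMul := fun t => x_conj_of_sum_mem_K 6 7 (by decide +kernel) s t
  have h10 : ∀ t : F, MulAut.conj (x 6 s) (((xBase 10) t).toMul : X F) =
      ((xBase 16) ((s * t)) + (xBase 10) t).toMul := fun t => x6_conj_x10 s t
  have h11 : ∀ t : F, MulAut.conj (x 6 s) (((xBase 11) t).toMul : X F) =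
      ((xBase 11) t).toMul := fun t => x_conj_of_sum_mem_K 6 11 (by decide +kernel) s t
  have h17 : ∀ t : F, MulAut.conj (x 6 s) (((xBase 17) t).toMul : X F) =
      ((xBase 22) (-(s * t)) + (xBase 17) t).toMul := fun t => x6_conj_x17 s t
  have h18 : ∀ t : F, MulAut.conj (x 6 s) (((xBase 18) t).toMul : X F) =
      ((xBase 18) t).toMul := fun t => x_conj_of_sum_mem_K 6 18 (by decide +kernel) s t
  have h19 : ∀ t : F, MulAut.conj (x 6 s) (((xBase 19) t).toMul : X F) =
      ((xBase 19) t).toMul := fun t => x_conj_of_sum_mem_K 6 19 (by decide +kernel) s t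
  have h16 : ∀ t : F, MulAut.conj (x 6 s) (((xBase 16) t).toMul : X F) =
      ((xBase 16) t).toMul := fun t => x_conj_of_sum_mem_K 6 16 (by decide +kernel) s t
  have h21 : ∀ t : F, MulAut.conj (x 6 s) (((xBase 21) t).toMul : X F) =
      ((xBase 21) t).toMul := fun t => x_conj_of_sum_mem_K 6 21 (by decide +kernel) s t
  have h22 : ∀ t : F, MulAut.conj (x 6 s) (((xBase 22) t).toMul : X F) =
      ((xBase 22) t).toMul := fun t => x_conj_of_sum_mem_K 6 22 (by decide +kernel) s t
  have h28 : ∀ t : F, MulAut.conj (x 6 s) (((xBase 28) t).toMul : X F) =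
      ((xBase 28) t).toMul := fun t => x_conj_of_sum_mem_K 6 28 (by decide +kernel) s t
  rw [← MulAut.conj_apply]
  simp only [toBase, toMul_add, Subgroup.coe_mul, map_mul, h2, h4, h7, h10, h11, h17, h18, h19, h16,
    h21, h22, h28]
  simp only [← Subgroup.coe_mul, ← toMul_add]
  refine congrArg (fun z : Additive (base F) => ((z.toMul : base F) : X F)) ?_
  simp only [map_add, map_sub, map_neg]
  abel

theorem x12_conj_toBase (s : F) (g : Coord F) :
    x 12 s * (g.toBase.toMul : X F) * (x 12 s)⁻¹ =
      (({ g with t17 := g.t17 + s * g.t4, t21 := g.t21 + s * g.t10, t22 := g.t22 + s * g.t11 } :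
        Coord F).toBase.toMul : X F) := by
  have h2 : ∀ t : F, MulAut.conj (x 12 s) (((xBase 2) t).toMul : X F) =
      ((xBase 2) t).toMul := fun t => x_conj_of_sum_mem_K 12 2 (by decide +kernel) s t
  have h4 : ∀ t : F, MulAut.conj (x 12 s) (((xBase 4) t).toMul : X F) =
      ((xBase 17) ((s * t)) + (xBase 4) t).toMul := fun t => x12_conj_x4 s t
  have h7 : ∀ t : F, MulAut.conj (x 12 s) (((xBase 7) t).toMul : X F) =
      ((xBase 7) t).toMul := fun t => x_conj_of_sum_mem_K 12 7 (by decide +kernel) s t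
  have h10 : ∀ t : F, MulAut.conj (x 12 s) (((xBase 10) t).toMul : X F) =
      ((xBase 21) ((s * t)) + (xBase 10) t).toMul := fun t => x12_conj_x10 s t
  have h11 : ∀ t : F, MulAut.conj (x 12 s) (((xBase 11) t).toMul : X F) =
      ((xBase 22) ((s * t)) + (xBase 11) t).toMul := fun t => x12_conj_x11 s t
  have h17 : ∀ t : F, MulAut.conj (x 12 s) (((xBase 17) t).toMul : X F) =
      ((xBase 17) t).toMul := fun t => x_conj_of_sum_mem_K 12 17 (by decide +kernel) s t
  have h18 : ∀ t : F, MulAut.conj (x 12 s) (((xBase 18) t).toMul : X F) =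
      ((xBase 18) t).toMul := fun t => x_conj_of_sum_mem_K 12 18 (by decide +kernel) s t
  have h19 : ∀ t : F, MulAut.conj (x 12 s) (((xBase 19) t).toMul : X F) =
      ((xBase 19) t).toMul := fun t => x_conj_of_sum_mem_K 12 19 (by decide +kernel) s t
  have h16 : ∀ t : F, MulAut.conj (x 12 s) (((xBase 16) t).toMul : X F) =
      ((xBase 16) t).toMul := fun t => x_conj_of_sum_mem_K 12 16 (by decide +kernel) s t
  have h21 : ∀ t : F, MulAut.conj (x 12 s) (((xBase 21) t).toMul : X F) =
      ((xBase 21) t).toMul := fun t => x_conj_of_sum_mem_K 12 21 (by decide +kernel) s t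
  have h22 : ∀ t : F, MulAut.conj (x 12 s) (((xBase 22) t).toMul : X F) =
      ((xBase 22) t).toMul := fun t => x_conj_of_sum_mem_K 12 22 (by decide +kernel) s t
  have h28 : ∀ t : F, MulAut.conj (x 12 s) (((xBase 28) t).toMul : X F) =
      ((xBase 28) t).toMul := fun t => x_conj_of_sum_mem_K 12 28 (by decide +kernel) s t
  rw [← MulAut.conj_apply]
  simp only [toBase, toMul_add, Subgroup.coe_mul, map_mul, h2, h4, h7, h10, h11, h17, h18, h19, h16,
    h21, h22, h28]
  simp only [← Subgroup.coe_mul, ← toMul_add]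
  refine congrArg (fun z : Additive (base F) => ((z.toMul : base F) : X F)) ?_
  simp only [map_add]
  abel

theorem x14_conj_toBase (s : F) (g : Coord F) :
    x 14 s * (g.toBase.toMul : X F) * (x 14 s)⁻¹ =
      (({ g with t18 := g.t18 - s * g.t2, t21 := g.t21 - s * g.t7, t28 := g.t28 + s * g.t19 } :
        Coord F).toBase.toMul : X F) := by
  have h2 : ∀ t : F, MulAut.conj (x 14 s) (((xBase 2) t).toMul : X F) =
      ((xBase 18) (-(s * t)) + (xBase 2) t).toMul := fun t => x14_conj_x2 s t
  have h4 : ∀ t : F, MulAut.conj (x 14 s) (((xBase 4) t).toMul : X F) =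
      ((xBase 4) t).toMul := fun t => x_conj_of_sum_mem_K 14 4 (by decide +kernel) s t
  have h7 : ∀ t : F, MulAut.conj (x 14 s) (((xBase 7) t).toMul : X F) =
      ((xBase 21) (-(s * t)) + (xBase 7) t).toMul := fun t => x14_conj_x7 s t
  have h10 : ∀ t : F, MulAut.conj (x 14 s) (((xBase 10) t).toMul : X F) =
      ((xBase 10) t).toMul := fun t => x_conj_of_sum_mem_K 14 10 (by decide +kernel) s t
  have h11 : ∀ t : F, MulAut.conj (x 14 s) (((xBase 11) t).toMul : X F) =
      ((xBase 11) t).toMul := fun t => x_conj_of_sum_mem_K 14 11 (by decide +kernel) s t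
  have h17 : ∀ t : F, MulAut.conj (x 14 s) (((xBase 17) t).toMul : X F) =
      ((xBase 17) t).toMul := fun t => x_conj_of_sum_mem_K 14 17 (by decide +kernel) s t
  have h18 : ∀ t : F, MulAut.conj (x 14 s) (((xBase 18) t).toMul : X F) =
      ((xBase 18) t).toMul := fun t => x_conj_of_sum_mem_K 14 18 (by decide +kernel) s t
  have h19 : ∀ t : F, MulAut.conj (x 14 s) (((xBase 19) t).toMul : X F) =
      ((xBase 28) ((s * t)) + (xBase 19) t).toMul := fun t => x14_conj_x19 s t
  have h16 : ∀ t : F, MulAut.conj (x 14 s) (((xBase 16) t).toMul : X F) =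
      ((xBase 16) t).toMul := fun t => x_conj_of_sum_mem_K 14 16 (by decide +kernel) s t
  have h21 : ∀ t : F, MulAut.conj (x 14 s) (((xBase 21) t).toMul : X F) =
      ((xBase 21) t).toMul := fun t => x_conj_of_sum_mem_K 14 21 (by decide +kernel) s t
  have h22 : ∀ t : F, MulAut.conj (x 14 s) (((xBase 22) t).toMul : X F) =
      ((xBase 22) t).toMul := fun t => x_conj_of_sum_mem_K 14 22 (by decide +kernel) s t
  have h28 : ∀ t : F, MulAut.conj (x 14 s) (((xBase 28) t).toMul : X F) =
      ((xBase 28) t).toMul := fun t => x_conj_of_sum_mem_K 14 28 (by decide +kernel) s t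
  rw [← MulAut.conj_apply]
  simp only [toBase, toMul_add, Subgroup.coe_mul, map_mul, h2, h4, h7, h10, h11, h17, h18, h19, h16,
    h21, h22, h28]
  simp only [← Subgroup.coe_mul, ← toMul_add]
  refine congrArg (fun z : Additive (base F) => ((z.toMul : base F) : X F)) ?_
  simp only [map_add, map_sub, map_neg]
  abel

theorem x15_conj_toBase (s : F) (g : Coord F) :
    x 15 s * (g.toBase.toMul : X F) * (x 15 s)⁻¹ =
      (({ g with t19 := g.t19 - s * g.t2, t22 := g.t22 - s * g.t7, t28 := g.t28 + s * g.t18 } :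
        Coord F).toBase.toMul : X F) := by
  have h2 : ∀ t : F, MulAut.conj (x 15 s) (((xBase 2) t).toMul : X F) =
      ((xBase 19) (-(s * t)) + (xBase 2) t).toMul := fun t => x15_conj_x2 s t
  have h4 : ∀ t : F, MulAut.conj (x 15 s) (((xBase 4) t).toMul : X F) =
      ((xBase 4) t).toMul := fun t => x_conj_of_sum_mem_K 15 4 (by decide +kernel) s t
  have h7 : ∀ t : F, MulAut.conj (x 15 s) (((xBase 7) t).toMul : X F) =
      ((xBase 22) (-(s * t)) + (xBase 7) t).toMul := fun t => x15_conj_x7 s t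
  have h10 : ∀ t : F, MulAut.conj (x 15 s) (((xBase 10) t).toMul : X F) =
      ((xBase 10) t).toMul := fun t => x_conj_of_sum_mem_K 15 10 (by decide +kernel) s t
  have h11 : ∀ t : F, MulAut.conj (x 15 s) (((xBase 11) t).toMul : X F) =
      ((xBase 11) t).toMul := fun t => x_conj_of_sum_mem_K 15 11 (by decide +kernel) s t
  have h17 : ∀ t : F, MulAut.conj (x 15 s) (((xBase 17) t).toMul : X F) =
      ((xBase 17) t).toMul := fun t => x_conj_of_sum_mem_K 15 17 (by decide +kernel) s t
  have h18 : ∀ t : F, MulAut.conj (x 15 s) (((xBase 18) t).toMul : X F) =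
      ((xBase 28) ((s * t)) + (xBase 18) t).toMul := fun t => x15_conj_x18 s t
  have h19 : ∀ t : F, MulAut.conj (x 15 s) (((xBase 19) t).toMul : X F) =
      ((xBase 19) t).toMul := fun t => x_conj_of_sum_mem_K 15 19 (by decide +kernel) s t
  have h16 : ∀ t : F, MulAut.conj (x 15 s) (((xBase 16) t).toMul : X F) =
      ((xBase 16) t).toMul := fun t => x_conj_of_sum_mem_K 15 16 (by decide +kernel) s t
  have h21 : ∀ t : F, MulAut.conj (x 15 s) (((xBase 21) t).toMul : X F) =
      ((xBase 21) t).toMul := fun t => x_conj_of_sum_mem_K 15 21 (by decide +kernel) s t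
  have h22 : ∀ t : F, MulAut.conj (x 15 s) (((xBase 22) t).toMul : X F) =
      ((xBase 22) t).toMul := fun t => x_conj_of_sum_mem_K 15 22 (by decide +kernel) s t
  have h28 : ∀ t : F, MulAut.conj (x 15 s) (((xBase 28) t).toMul : X F) =
      ((xBase 28) t).toMul := fun t => x_conj_of_sum_mem_K 15 28 (by decide +kernel) s t
  rw [← MulAut.conj_apply]
  simp only [toBase, toMul_add, Subgroup.coe_mul, map_mul, h2, h4, h7, h10, h11, h17, h18, h19, h16,
    h21, h22, h28]
  simp only [← Subgroup.coe_mul, ← toMul_add]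
  refine congrArg (fun z : Additive (base F) => ((z.toMul : base F) : X F)) ?_
  simp only [map_add, map_sub, map_neg]
  abel

end Coord

open scoped IsMulCommutative

theorem x_comm_of_mem_I (i j : ℕ) (hi : root i ∈ I) (hj : root j ∈ I) (s t : F) :
    Commute (x i s) (x j t) :=
  Q.x_comm (sum_mem_K_of_mem_I _ hi _ hj) s t

namespace Coord

theorem toBase_add (g h : Coord F) : g.toBase + h.toBase =
    toBase { g with
      t2 := g.t2 + h.t2, t4 := g.t4 + h.t4, t7 := g.t7 + h.t7, t10 := g.t10 + h.t10,
      t11 := g.t11 + h.t11, t17 := g.t17 + h.t17, t18 := g.t18 + h.t18, t19 := g.t19 + h.t19,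
      t16 := g.t16 + h.t16, t21 := g.t21 + h.t21, t22 := g.t22 + h.t22, t28 := g.t28 + h.t28 } := by
  simp only [toBase, map_add]
  abel

/-- Conjugation of an element of the abelian normal subgroup by an element of the complement. -/
def conjBase (g h : Coord F) : Coord F :=
  { h with
    t7 := h.t7 + g.s1 * h.t2
    t10 := h.t10 - g.s5 * h.t4
    t11 := h.t11 - g.s6 * h.t4
    t17 := h.t17 + g.s12 * h.t4
    t18 := h.t18 - g.s14 * h.t2
    t19 := h.t19 - g.s15 * h.t2
    t16 := h.t16 + g.s5 * h.t11 + g.s6 * h.t10 - g.s5 * g.s6 * h.t4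
    t21 := h.t21 + g.s1 * h.t18 - g.s14 * h.t7 - g.s1 * g.s14 * h.t2
      - g.s5 * h.t17 + g.s12 * h.t10 - g.s5 * g.s12 * h.t4
    t22 := h.t22 + g.s1 * h.t19 - g.s15 * h.t7 - g.s1 * g.s15 * h.t2
      - g.s6 * h.t17 + g.s12 * h.t11 - g.s6 * g.s12 * h.t4
    t28 := h.t28 + g.s14 * h.t19 + g.s15 * h.t18 - g.s14 * g.s15 * h.t2 }

/-- The six conjugations are composed, that by x₁₅ acting first. The quadratic terms come from x₂
and x₄, which reach the centre only after two steps. -/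
theorem toCompl_conj_toBase (g h : Coord F) :
    g.toCompl * (h.toBase.toMul : X F) * g.toCompl⁻¹ = ((conjBase g h).toBase.toMul : X F) := by
  rw [← MulAut.conj_apply]
  simp only [toCompl, map_mul, MulAut.mul_apply]
  simp only [MulAut.conj_apply, x15_conj_toBase, x14_conj_toBase, x12_conj_toBase, x6_conj_toBase,
    x5_conj_toBase, x1_conj_toBase]
  refine congrArg (fun z : Coord F => ((z.toBase.toMul : base F) : X F)) ?_
  ext <;> simp [conjBase] <;> ring

theorem toCompl_mul (g h : Coord F) : (g * h).toCompl = g.toCompl * h.toCompl := by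
  have c := fun i j (hi : root i ∈ I) (hj : root j ∈ I) (s t : F) => x_comm_of_mem_I i j hi hj s t
  simp only [toCompl, mul_s1, mul_s5, mul_s6, mul_s12, mul_s14, mul_s15, Q.x_add]
  rw [Commute.mul_mul_mul_comm (b := x 15 g.s15)
    (((((c 15 1 (by decide) (by decide) _ _).mul_right (c 15 5 (by decide) (by decide) _
      _)).mul_right (c 15 6 (by decide) (by decide) _ _)).mul_right (c 15 12 (by decide) (by decide)
        _ _)).mul_right (c 15 14 (by decide) (by decide) _ _))]
  rw [Commute.mul_mul_mul_comm (b := x 14 g.s14)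
    ((((c 14 1 (by decide) (by decide) _ _).mul_right (c 14 5 (by decide) (by decide) _
      _)).mul_right (c 14 6 (by decide) (by decide) _ _)).mul_right (c 14 12 (by decide) (by decide)
        _ _))]
  rw [Commute.mul_mul_mul_comm (b := x 12 g.s12)
    (((c 12 1 (by decide) (by decide) _ _).mul_right (c 12 5 (by decide) (by decide) _ _)).mul_right
      (c 12 6 (by decide) (by decide) _ _))]
  rw [Commute.mul_mul_mul_comm (b := x 6 g.s6)
    ((c 6 1 (by decide) (by decide) _ _).mul_right (c 6 5 (by decide) (by decide) _ _))]
  rw [Commute.mul_mul_mul_comm (b := x 5 g.s5)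
    (c 5 1 (by decide) (by decide) _ _)]

/-- The coordinates describe the multiplication of `X_𝒮`. -/
def toXHom : Coord F →* X F where
  toFun := toX
  map_one' := by
    have := mul_one (1 : Coord F)
    simp [toX, coe_toBase, toCompl, Q.x_zero]
  map_mul' g h := by
    have h1 : (g * h).toBase = g.toBase + (conjBase g h).toBase := by
      rw [toBase_add]
      simp [toBase, conjBase]
    have h2 := toCompl_conj_toBase g h
    rw [toX, h1, toMul_add, Subgroup.coe_mul, ← h2, toCompl_mul, toX, toX]
    group

theorem toXHom_apply (g : Coord F) : toXHom g =
    x 2 g.t2 * x 4 g.t4 * x 7 g.t7 * x 10 g.t10 * x 11 g.t11 * x 17 g.t17 * x 18 g.t18 *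
    x 19 g.t19 * x 16 g.t16 * x 21 g.t21 * x 22 g.t22 * x 28 g.t28 *
    (x 1 g.s1 * x 5 g.s5 * x 6 g.s6 * x 12 g.s12 * x 14 g.s14 * x 15 g.s15) := rfl

theorem toXHom_t2 (t : F) : toXHom { (1 : Coord F) with t2 := t } = x 2 t := by
  simp [toXHom_apply, Q.x_zero]

theorem toXHom_t4 (t : F) : toXHom { (1 : Coord F) with t4 := t } = x 4 t := by
  simp [toXHom_apply, Q.x_zero]

theorem toXHom_t7 (t : F) : toXHom { (1 : Coord F) with t7 := t } = x 7 t := by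
  simp [toXHom_apply, Q.x_zero]

theorem toXHom_t10 (t : F) : toXHom { (1 : Coord F) with t10 := t } = x 10 t := by
  simp [toXHom_apply, Q.x_zero]

theorem toXHom_t11 (t : F) : toXHom { (1 : Coord F) with t11 := t } = x 11 t := by
  simp [toXHom_apply, Q.x_zero]

theorem toXHom_t17 (t : F) : toXHom { (1 : Coord F) with t17 := t } = x 17 t := by
  simp [toXHom_apply, Q.x_zero]

theorem toXHom_t18 (t : F) : toXHom { (1 : Coord F) with t18 := t } = x 18 t := by
  simp [toXHom_apply, Q.x_zero]

theorem toXHom_t19 (t : F) : toXHom { (1 : Coord F) with t19 := t } = x 19 t := by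
  simp [toXHom_apply, Q.x_zero]

theorem toXHom_t16 (t : F) : toXHom { (1 : Coord F) with t16 := t } = x 16 t := by
  simp [toXHom_apply, Q.x_zero]

theorem toXHom_t21 (t : F) : toXHom { (1 : Coord F) with t21 := t } = x 21 t := by
  simp [toXHom_apply, Q.x_zero]

theorem toXHom_t22 (t : F) : toXHom { (1 : Coord F) with t22 := t } = x 22 t := by
  simp [toXHom_apply, Q.x_zero]

theorem toXHom_t28 (t : F) : toXHom { (1 : Coord F) with t28 := t } = x 28 t := by
  simp [toXHom_apply, Q.x_zero]

theorem toXHom_s1 (t : F) : toXHom { (1 : Coord F) with s1 := t } = x 1 t := by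
  simp [toXHom_apply, Q.x_zero]

theorem toXHom_s5 (t : F) : toXHom { (1 : Coord F) with s5 := t } = x 5 t := by
  simp [toXHom_apply, Q.x_zero]

theorem toXHom_s6 (t : F) : toXHom { (1 : Coord F) with s6 := t } = x 6 t := by
  simp [toXHom_apply, Q.x_zero]

theorem toXHom_s12 (t : F) : toXHom { (1 : Coord F) with s12 := t } = x 12 t := by
  simp [toXHom_apply, Q.x_zero]

theorem toXHom_s14 (t : F) : toXHom { (1 : Coord F) with s14 := t } = x 14 t := by
  simp [toXHom_apply, Q.x_zero]

theorem toXHom_s15 (t : F) : toXHom { (1 : Coord F) with s15 := t } = x 15 t := by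
  simp [toXHom_apply, Q.x_zero]

/-- The range contains the images of all root elements: those of `S` have explicit preimages, and
those of `K` are trivial. -/
theorem toXHom_surjective : Function.Surjective (toXHom (F := F)) := by
  rw [← MonoidHom.range_eq_top, eq_top_iff]
  have hx : ∀ α ∈ Q.P, ∀ t : F, Q.x α t ∈ (toXHom (F := F)).range := by
    intro α hα t
    rcases Finset.mem_union.mp hα with h | h
    · simp only [S, Finset.mem_insert, Finset.mem_singleton] at h
      rcases h with rfl | rfl | rfl | rfl | rfl | rfl | rfl | rfl | rfl | rfl | rfl | rfl | rfl |
        rfl | rfl | rfl | rfl | rfl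
      · exact ⟨_, toXHom_s1 t⟩
      · exact ⟨_, toXHom_t2 t⟩
      · exact ⟨_, toXHom_t4 t⟩
      · exact ⟨_, toXHom_s5 t⟩
      · exact ⟨_, toXHom_s6 t⟩
      · exact ⟨_, toXHom_t7 t⟩
      · exact ⟨_, toXHom_t10 t⟩
      · exact ⟨_, toXHom_t11 t⟩
      · exact ⟨_, toXHom_s12 t⟩
      · exact ⟨_, toXHom_s14 t⟩
      · exact ⟨_, toXHom_s15 t⟩
      · exact ⟨_, toXHom_t16 t⟩
      · exact ⟨_, toXHom_t17 t⟩
      · exact ⟨_, toXHom_t18 t⟩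
      · exact ⟨_, toXHom_t19 t⟩
      · exact ⟨_, toXHom_t21 t⟩
      · exact ⟨_, toXHom_t22 t⟩
      · exact ⟨_, toXHom_t28 t⟩
    · rw [Q.x_eq_one h]
      exact one_mem _
  rintro ⟨g, hg⟩ -
  change QuotientGroup.mk (⟨g, hg⟩ : rootProduct F Q.P) ∈ (toXHom (F := F)).range
  induction hg using Subgroup.closure_induction with
  | mem g hg =>
    obtain ⟨α, hα, t, rfl⟩ := hg
    rw [← Q.x_of_mem hα]
    exact hx α hα t
  | one => exact one_mem _
  | mul a b ha hb h1 h2 => exact mul_mem h1 h2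
  | inv a ha h1 => exact inv_mem h1

end Coord

/-- `K` consists of roots ε_i + ε_j other than α₁₆, α₂₂, α₂₈. Such elements are block unipotent,
multiply by adding their B, and have zero in the three positions belonging to these roots. -/
theorem exists_fromBlocks_of_mem_rootProduct_K {k : GL (Fin 6 ⊕ Fin 6) F}
    (hk : k ∈ rootProduct F K) : ∃ B : Matrix (Fin 6) (Fin 6) F,
      (k : Matrix (Fin 6 ⊕ Fin 6) (Fin 6 ⊕ Fin 6) F) = Matrix.fromBlocks 1 B 0 1 ∧
      B 3 4 = 0 ∧ B 0 5 = 0 ∧ B 1 2 = 0 := by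
  induction hk using Subgroup.closure_induction with
  | mem g hg =>
    obtain ⟨α, hα, t, rfl⟩ := hg
    have hplus : ∀ (i j : Fin 6) (h : i < j),
        (rootElt (plusRoot i j h) t : Matrix (Fin 6 ⊕ Fin 6) (Fin 6 ⊕ Fin 6) F) =
          Matrix.fromBlocks 1 (t • (Matrix.single i j 1 - Matrix.single j i 1)) 0 1 := by
      intro i j h
      change 1 + t • rootVector F _ = _
      rw [rootVector_plusRoot, ← Matrix.fromBlocks_one]
      ext a b
      rcases a with a | a <;> rcases b with b | b <;>
        simp [Matrix.single_apply, Matrix.one_apply]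
    simp only [K, Finset.mem_insert, Finset.mem_singleton] at hα
    rcases hα with rfl | rfl | rfl | rfl | rfl | rfl | rfl | rfl <;>
      exact ⟨_, hplus _ _ _, by simp, by simp, by simp⟩
  | one => exact ⟨0, by simp, rfl, rfl, rfl⟩
  | mul a b _ _ ha hb =>
    obtain ⟨A, hA, h1, h2, h3⟩ := ha
    obtain ⟨B, hB, h4, h5, h6⟩ := hb
    refine ⟨B + A, ?_, ?_, ?_, ?_⟩
    · rw [Units.val_mul, hA, hB, Matrix.fromBlocks_multiply]
      simp
    all_goals simp [*]
  | inv a _ ha =>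
    obtain ⟨A, hA, h1, h2, h3⟩ := ha
    refine ⟨-A, ?_, ?_, ?_, ?_⟩
    · apply Units.inv_eq_of_mul_eq_one_right
      rw [hA, Matrix.fromBlocks_multiply]
      simp
    all_goals simp [*]

/-- The entries (3,-4), (0,5), (0,-5), (1,-2) of the product are a, b, c, d, whereas elements of X_𝒦
vanish there. This is the only place where faithfulness is read off from matrices. -/
theorem central_eq_zero {a b c d : F} (h : x 16 a * x 21 b * x 22 c * x 28 d = 1) :
    a = 0 ∧ b = 0 ∧ c = 0 ∧ d = 0 := by
  rw [x, x, x, x, Q.x_of_mem (by decide), Q.x_of_mem (by decide), Q.x_of_mem (by decide),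
    Q.x_of_mem (by decide), ← QuotientGroup.mk_mul, ← QuotientGroup.mk_mul, ← QuotientGroup.mk_mul,
    QuotientGroup.eq_one_iff, Subgroup.mem_subgroupOf] at h
  obtain ⟨B, hB, h1, h2, h3⟩ := exists_fromBlocks_of_mem_rootProduct_K h
  have hM : (1 + a • rootVector F (plusRoot 3 4)) * (1 + b • rootVector F (minusRoot 0 5)) *
      (1 + c • rootVector F (plusRoot 0 5)) * (1 + d • rootVector F (plusRoot 1 2)) =
      Matrix.fromBlocks 1 B 0 1 := hB
  simp only [rootVector_plusRoot, rootVector_minusRoot, mul_add, add_mul, mul_sub, sub_mul,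
    smul_sub, Matrix.smul_single, Matrix.single_mul_single_same, mul_one, one_mul] at hM
  have e1 := congrFun (congrFun hM (Sum.inl 3)) (Sum.inr 4)
  have e2 := congrFun (congrFun hM (Sum.inl 0)) (Sum.inl 5)
  have e3 := congrFun (congrFun hM (Sum.inl 0)) (Sum.inr 5)
  have e4 := congrFun (congrFun hM (Sum.inl 1)) (Sum.inr 2)
  simp [h1, h2, h3] at e1 e2 e3 e4
  exact ⟨e1, e2, e3, e4⟩

namespace Coord

theorem central_coords_eq_zero {a b c d : F} (h : toXHom { (1 : Coord F) with
    t16 := a, t21 := b, t22 := c, t28 := d } = 1) : a = 0 ∧ b = 0 ∧ c = 0 ∧ d = 0 := by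
  apply central_eq_zero
  rw [← h]
  simp [toXHom_apply, Q.x_zero]

-- The kernel is normal and meets the central coordinates trivially. Commutators of a kernel element
-- g with root elements stay in the kernel; after one or two steps they are central, and their
-- entries are coordinates of g.
set_option maxHeartbeats 400000 in
theorem toXHom_injective : Function.Injective (toXHom (F := F)) := by
  rw [injective_iff_map_eq_one]
  intro g hg
  have hcomm : ∀ e g z : Coord F, toXHom g = 1 → e * g * e⁻¹ * g⁻¹ = z → toXHom z = 1 := by
    rintro e g _ hg rfl
    simp [hg]
  have hcomm' : ∀ e z : Coord F, g * e * g⁻¹ * e⁻¹ = z → toXHom z = 1 := by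
    rintro e _ rfl
    simp [hg]
  -- The elements x₁₈, x₁₉, x₁₀, x₁₁ have only central commutators, so a single step reads off the
  -- coordinates of the complement.
  obtain ⟨-, hs1, -, hs15⟩ := central_coords_eq_zero (hcomm' { (1 : Coord F) with t18 := 1 }
    { (1 : Coord F) with t16 := 0, t21 := g.s1, t22 := 0, t28 := g.s15 } (by
      ext <;> simp <;> ring))
  obtain ⟨-, -, -, hs14⟩ := central_coords_eq_zero (hcomm' { (1 : Coord F) with t19 := 1 }
    { (1 : Coord F) with t16 := 0, t21 := 0, t22 := g.s1, t28 := g.s14 } (by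
      ext <;> simp <;> ring))
  obtain ⟨hs6, hs12, -, -⟩ := central_coords_eq_zero (hcomm' { (1 : Coord F) with t10 := 1 }
    { (1 : Coord F) with t16 := g.s6, t21 := g.s12, t22 := 0, t28 := 0 } (by
      ext <;> simp <;> ring))
  obtain ⟨hs5, -, -, -⟩ := central_coords_eq_zero (hcomm' { (1 : Coord F) with t11 := 1 }
    { (1 : Coord F) with t16 := g.s5, t21 := 0, t22 := g.s12, t28 := 0 } (by
      ext <;> simp <;> ring))
  -- Now g lies in the abelian part. Commutators with x₁ and x₅ still have the noncentral
  -- coordinates t2 and -t4; a second commutator, with x₁₄ or x₆, isolates them.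
  have hc1 := hcomm { (1 : Coord F) with s1 := 1 } g
    { (1 : Coord F) with t7 := g.t2, t21 := g.t18, t22 := g.t19 } hg (by
      ext <;> simp [hs1, hs5, hs6, hs12, hs14, hs15])
  have hc5 := hcomm { (1 : Coord F) with s5 := 1 } g
    { (1 : Coord F) with t10 := -g.t4, t16 := g.t11, t21 := -g.t17 } hg (by
      ext <;> simp [hs1, hs5, hs6, hs12, hs14, hs15] <;> ring)
  obtain ⟨-, ht2, -, -⟩ := central_coords_eq_zero (hcomm { (1 : Coord F) with s14 := 1 } _
    { (1 : Coord F) with t16 := 0, t21 := -g.t2, t22 := 0, t28 := 0 } hc1 (by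
      ext <;> simp <;> ring))
  obtain ⟨ht4, -, -, -⟩ := central_coords_eq_zero (hcomm { (1 : Coord F) with s6 := 1 } _
    { (1 : Coord F) with t16 := -g.t4, t21 := 0, t22 := 0, t28 := 0 } hc5 (by
      ext <;> simp))
  rw [neg_eq_zero] at ht2 ht4
  rw [ht2] at hc1
  rw [ht4, neg_zero] at hc5
  obtain ⟨-, ht18, ht19, -⟩ := central_coords_eq_zero (a := 0) (d := 0) hc1
  obtain ⟨ht11, ht17, -, -⟩ := central_coords_eq_zero (c := 0) (d := 0) hc5
  rw [neg_eq_zero] at ht17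
  obtain ⟨-, ht7, -, -⟩ := central_coords_eq_zero (hcomm { (1 : Coord F) with s14 := 1 } g
    { (1 : Coord F) with t16 := 0, t21 := -g.t7, t22 := 0, t28 := g.t19 } hg (by
      ext <;> simp [hs1, hs5, hs6, hs12, hs14, hs15, ht2] <;> ring))
  obtain ⟨ht10, -, -, -⟩ := central_coords_eq_zero (hcomm { (1 : Coord F) with s6 := 1 } g
    { (1 : Coord F) with t16 := g.t10, t21 := 0, t22 := -g.t17, t28 := 0 } hg (by
      ext <;> simp [hs1, hs5, hs6, hs12, hs14, hs15, ht4] <;> ring))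
  rw [neg_eq_zero] at ht7
  have hg' : g = { (1 : Coord F) with t16 := g.t16, t21 := g.t21, t22 := g.t22, t28 := g.t28 } := by
    ext <;> simp only [hs1, hs5, hs6, hs12, hs14, hs15, ht2, ht4, ht7, ht10, ht11, ht17, ht18, ht19]
      <;> rfl
  obtain ⟨ht16, ht21, ht22, ht28⟩ := central_coords_eq_zero (hg' ▸ hg)
  rw [hg']
  ext <;> simp only [ht16, ht21, ht22, ht28] <;> rfl

/-- The isomorphism of `X_𝒮` with its group of coordinates. -/
noncomputable def equivX : Coord F ≃* X F :=
  MulEquiv.ofBijective toXHom ⟨toXHom_injective, toXHom_surjective⟩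

end Coord

end Core

/-! ### Additive characters of the finite field -/

section Phi

variable {p : ℕ} [Fact p.Prime] {F : Type*} [Field F] [Algebra (ZMod p) F]

theorem phi_add (s t : F) : phi p (s + t) = phi p s * phi p t := by
  rw [phi, map_add, AddChar.map_add_eq_mul, phi, phi]

theorem phi_zero : phi p (0 : F) = 1 := by
  rw [phi, map_zero, AddChar.map_zero_eq_one]

theorem phi_ne_zero (t : F) : phi p t ≠ 0 := by
  intro h
  have := phi_add (p := p) t (-t)
  rw [h, zero_mul, add_neg_cancel, phi_zero] at this
  exact one_ne_zero this

theorem phi_neg (t : F) : phi p (-t) = (phi p t)⁻¹ := by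
  apply eq_inv_of_mul_eq_one_left
  rw [← phi_add, neg_add_cancel, phi_zero]

theorem phi_eq_one_iff (t : F) : phi p t = 1 ↔ Algebra.trace (ZMod p) F t = 0 := by
  rw [phi, ← AddChar.map_zero_eq_one (ZMod.stdAddChar (N := p)), ZMod.injective_stdAddChar.eq_iff]

variable (p F) in
/-- The character `φ`, as an additive character. -/
noncomputable def phiChar : AddChar F ℂ where
  toFun := phi p
  map_zero_eq_one' := phi_zero
  map_add_eq_mul' := phi_add

variable [Finite F]

theorem exists_phi_ne_one : ∃ t : F, phi p t ≠ 1 := by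
  have : FiniteDimensional (ZMod p) F := Module.Finite.of_finite
  obtain ⟨t, ht⟩ := Algebra.trace_surjective (ZMod p) F 1
  exact ⟨t, fun h => by rw [phi_eq_one_iff, ht] at h; exact one_ne_zero h⟩

theorem exists_phi_mul_ne_one {b : F} (hb : b ≠ 0) : ∃ t, phi p (b * t) ≠ 1 := by
  obtain ⟨t, ht⟩ := exists_phi_ne_one (p := p) (F := F)
  exact ⟨b⁻¹ * t, by rwa [mul_inv_cancel_left₀ hb]⟩

theorem eq_of_phi_mul_eq {b c : F} (h : ∀ t, phi p (b * t) = phi p (c * t)) : b = c := by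
  by_contra hne
  obtain ⟨t, ht⟩ := exists_phi_mul_ne_one (p := p) (sub_ne_zero.mpr hne)
  apply ht
  rw [sub_mul, sub_eq_add_neg, phi_add, phi_neg, h, mul_inv_cancel₀ (phi_ne_zero _)]

/-- Every additive character of a finite field is of the form `t ↦ φ(bt)`. -/
theorem exists_eq_phi_mul (μ : AddChar F ℂ) : ∃ b : F, ∀ t, μ t = phi p (b * t) := by
  cases nonempty_fintype F
  have hinj : Function.Injective fun b : F => AddChar.mulShift (phiChar p F) b := by
    intro b c hbc
    exact eq_of_phi_mul_eq (p := p) fun t => DFunLike.congr_fun hbc t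
  -- The shifts of φ are pairwise distinct, and a finite abelian group has as many characters as
  -- elements.
  obtain ⟨b, hb⟩ := ((Fintype.bijective_iff_injective_and_card _).mpr
    ⟨hinj, AddChar.card_eq.symm⟩).2 μ
  exact ⟨b, fun t => (DFunLike.congr_fun hb t).symm⟩

end Phi

/-! ### Characteristic two: trace, squaring and Artin–Schreier -/

section CharTwo

variable {F : Type*} [Field F] [Algebra (ZMod 2) F]

theorem two_eq_zero_of_algebra : (2 : F) = 0 := by
  have := map_ofNat (algebraMap (ZMod 2) F) 2
  rw [← this, show (OfNat.ofNat 2 : ZMod 2) = 0 from rfl, map_zero]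

theorem add_self_of_algebra (t : F) : t + t = 0 := by
  rw [← two_mul, two_eq_zero_of_algebra, zero_mul]

theorem phi_mul_self (t : F) : phi 2 t * phi 2 t = 1 := by
  rw [← phi_add, add_self_of_algebra, phi_zero]

variable [Finite F]

/-- The trace is invariant under the Frobenius automorphism. -/
theorem phi_sq (t : F) : phi 2 (t ^ 2) = phi 2 t := by
  have : CharP F 2 := charP_of_injective_algebraMap (algebraMap (ZMod 2) F).injective 2
  have h := Algebra.trace_eq_of_algEquiv (FiniteField.frobeniusAlgEquiv (ZMod 2) F 2) t
  have h2 : FiniteField.frobeniusAlgEquiv (ZMod 2) F 2 t = t ^ 2 := by simp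
  rw [phi, phi, ← h2, h]

/-- The trace is surjective onto the prime field, whose standard character is the sign when p = 2.
-/
theorem exists_phi_mul_eq_sign {w : F} (hw : w ≠ 0) (d : ZMod 2) :
    ∃ b : F, phi 2 (b * w) = Core.sign d := by
  have : FiniteDimensional (ZMod 2) F := Module.Finite.of_finite
  obtain ⟨t, ht⟩ := Algebra.trace_surjective (ZMod 2) F d
  refine ⟨t * w⁻¹, ?_⟩
  rw [inv_mul_cancel_right₀ hw, phi, ht]
  revert d
  intro d hd
  clear hd
  have h1 : (ZMod.stdAddChar (1 : ZMod 2) : ℂ) ^ 2 = 1 := by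
    rw [← AddChar.map_nsmul_eq_pow, show (2 : ℕ) • (1 : ZMod 2) = 0 from rfl,
      AddChar.map_zero_eq_one]
  fin_cases d
  · exact (AddChar.map_zero_eq_one _).trans (by simp [Core.sign, ZMod.val])
  · rcases mul_self_eq_one_iff.mp ((pow_two _).symm.trans h1) with h | h
    · exfalso
      rw [← AddChar.map_zero_eq_one (ZMod.stdAddChar (N := 2))] at h
      exact one_ne_zero (ZMod.injective_stdAddChar h)
    · exact h.trans (by simp [Core.sign, ZMod.val])

theorem sign_injective : Function.Injective Core.sign := by
  intro d d' h
  fin_cases d <;> fin_cases d' <;> first | rfl | (norm_num [Core.sign, ZMod.val] at h)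

theorem exists_eq_sign {z : ℂ} (hz : z * z = 1) : ∃ d : ZMod 2, z = Core.sign d := by
  rcases mul_self_eq_one_iff.mp hz with rfl | rfl
  · exact ⟨0, by simp [Core.sign]⟩
  · exact ⟨1, by simp [Core.sign, ZMod.val_one]⟩

/-- Additive Hilbert 90: r ↦ r² + r has kernel {0, 1}, so its image has index two. The image lies in
the kernel of the trace, also of index two, so the two agree. -/
theorem exists_sq_add_self {z : F} (hz : phi 2 z = 1) : ∃ r, r ^ 2 + r = z := by
  have : FiniteDimensional (ZMod 2) F := Module.Finite.of_finite
  let P : F →+ F :=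
    { toFun := fun r => r ^ 2 + r
      map_zero' := by simp
      map_add' := fun a b => by
        linear_combination a * b * two_eq_zero_of_algebra (F := F) }
  let T : F →+ ZMod 2 := (Algebra.trace (ZMod 2) F).toAddMonoidHom
  have hle : P.range ≤ T.ker := by
    rintro _ ⟨r, rfl⟩
    change Algebra.trace (ZMod 2) F (r ^ 2 + r) = 0
    rw [← phi_eq_one_iff, phi_add, phi_sq, phi_mul_self]
  have hT : T.ker.index = 2 := by
    rw [AddSubgroup.index_ker, AddMonoidHom.range_eq_top.mpr (Algebra.trace_surjective (ZMod 2) F),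
      AddSubgroup.card_top, Nat.card_zmod]
  have hP : Nat.card P.ker = 2 := by
    have : (P.ker : Set F) = {0, 1} := by
      ext r
      change r ^ 2 + r = 0 ↔ r = 0 ∨ r = 1
      constructor
      · intro h
        have : r * (r - 1) = 0 := by
          linear_combination h - r * two_eq_zero_of_algebra (F := F)
        rcases mul_eq_zero.mp this with h | h
        · exact Or.inl h
        · exact Or.inr (sub_eq_zero.mp h)
      · rintro (rfl | rfl)
        · simp
        · linear_combination two_eq_zero_of_algebra (F := F)
    rw [← SetLike.coe_sort_coe, Nat.card_coe_set_eq, this, Set.ncard_pair zero_ne_one]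
  have h1 := P.ker.card_mul_index
  rw [AddSubgroup.index_ker, hP] at h1
  have h2 := T.ker.card_mul_index
  rw [hT] at h2
  have h3 : P.range = T.ker := by
    refine AddSubgroup.eq_of_le_of_card_ge hle ?_
    omega
  have hz' : z ∈ T.ker := (phi_eq_one_iff z).mp hz
  rw [← h3] at hz'
  exact hz'

/-- The subgroup `{rc + r²u}` of the additive group, for `c, u ≠ 0`, is the kernel of a character.
-/
theorem exists_mul_add_sq_mul {c u δ : F} (hc : c ≠ 0) (hu : u ≠ 0)
    (h : phi 2 (δ * (u / c ^ 2)) = 1) : ∃ r, r * c + r ^ 2 * u = δ := by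
  obtain ⟨ρ, hρ⟩ := exists_sq_add_self h
  -- The substitution r = ρc/u turns rc + r²u into (c²/u)(ρ² + ρ).
  refine ⟨ρ * c / u, ?_⟩
  field_simp at hρ ⊢
  linear_combination hρ

theorem phi_mul_add_sq_mul {c u : F} (hc : c ≠ 0) (r : F) :
    phi 2 ((r * c + r ^ 2 * u) * (u / c ^ 2)) = 1 := by
  have : (r * c + r ^ 2 * u) * (u / c ^ 2) = (r * u / c) ^ 2 + r * u / c := by
    field_simp
    ring
  rw [this, phi_add, phi_sq, phi_mul_self]

/-- Squaring is bijective on a finite field of characteristic two. This is the degenerate case c = 0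
of the equation rc + r²u = δ. -/
theorem exists_sq_mul {u : F} (hu : u ≠ 0) (δ : F) : ∃ r, r ^ 2 * u = δ := by
  have : CharP F 2 := charP_of_injective_algebraMap (algebraMap (ZMod 2) F).injective 2
  have : PerfectRing F 2 := inferInstance
  obtain ⟨r, hr⟩ := (bijective_frobenius F 2).2 (δ / u)
  rw [frobenius_def] at hr
  exact ⟨r, by rw [hr, div_mul_cancel₀ _ hu]⟩

end CharTwo

/-! ### Parameters of linear characters and the action on them -/

namespace Core

/-- The parameters of a linear character of `X_{𝒮 ∖ ℐ}`. -/
@[ext]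
structure Par (F : Type*) where
  /-- The parameter for `X_2`. -/
  f2 : F
  /-- The parameter for `X_4`. -/
  f4 : F
  /-- The parameter for `X_7`. -/
  f7 : F
  /-- The parameter for `X_10`. -/
  f10 : F
  /-- The parameter for `X_11`. -/
  f11 : F
  /-- The parameter for `X_17`. -/
  f17 : F
  /-- The parameter for `X_18`. -/
  f18 : F
  /-- The parameter for `X_19`. -/
  f19 : F
  /-- The parameter for `X_16`. -/
  f16 : F
  /-- The parameter for `X_21`. -/
  f21 : F
  /-- The parameter for `X_22`. -/
  f22 : F
  /-- The parameter for `X_28`. -/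
  f28 : F

section Action

variable {F : Type*} [Field F]

namespace Par

/-- The pairing of parameters with the coordinates of the abelian normal subgroup. -/
def pair (f : Par F) (g : Coord F) : F :=
  f.f2 * g.t2 + f.f4 * g.t4 + f.f7 * g.t7 + f.f10 * g.t10 + f.f11 * g.t11 + f.f17 * g.t17 +
    f.f18 * g.t18 + f.f19 * g.t19 + f.f16 * g.t16 + f.f21 * g.t21 + f.f22 * g.t22 + f.f28 * g.t28

/-- The action of `X_𝒮` by conjugation on parameters of linear characters. -/
def act (g : Coord F) (f : Par F) : Par F :=
  { f with
    f2 := f.f2 - g.s1 * f.f7 + g.s14 * f.f18 + g.s15 * f.f19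
      - (g.s1 * g.s14 * f.f21 + g.s1 * g.s15 * f.f22 + g.s14 * g.s15 * f.f28)
    f7 := f.f7 + g.s14 * f.f21 + g.s15 * f.f22
    f18 := f.f18 - g.s1 * f.f21 - g.s15 * f.f28
    f19 := f.f19 - g.s1 * f.f22 - g.s14 * f.f28
    f4 := f.f4 - g.s12 * f.f17 + g.s5 * f.f10 + g.s6 * f.f11
      - (g.s12 * g.s5 * f.f21 + g.s12 * g.s6 * f.f22 + g.s5 * g.s6 * f.f16)
    f17 := f.f17 + g.s5 * f.f21 + g.s6 * f.f22
    f10 := f.f10 - g.s12 * f.f21 - g.s6 * f.f16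
    f11 := f.f11 - g.s12 * f.f22 - g.s5 * f.f16 }

theorem act_mul (g h : Coord F) (f : Par F) : act (g * h) f = act g (act h f) := by
  ext <;> simp [act] <;> ring

theorem act_one (f : Par F) : act 1 f = f := by
  ext <;> simp [act]

theorem act_inv_eq {g : Coord F} {f : Par F} (h : act g f = f) : act g⁻¹ f = f := by
  conv_lhs => rw [← h]
  rw [← act_mul, inv_mul_cancel, act_one]

/-- The action is dual to conjugation: `act g f` belongs to the character n ↦ ψ(g⁻¹ n g), the
convention of `conjRes`. -/
theorem pair_conjBase (f : Par F) (g h : Coord F) :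
    f.pair (Coord.conjBase g⁻¹ h) = (act g f).pair h := by
  simp [pair, act, Coord.conjBase]
  ring

/-- Here `pair` is used on the whole group, ignoring the coordinates of the complement. The identity
shows that it is additive on the stabilizer of f, which is why characters extend and why the
stabilizer is abelian modulo the kernel. -/
theorem pair_mul (f : Par F) (g h : Coord F) :
    f.pair (g * h) = f.pair g + (act g⁻¹ f).pair h := by
  simp [pair, act]
  ring

end Par

theorem x_mem_base {n : ℕ} (h : root n ∈ S \ I) (t : F) : x n t ∈ base F :=
  Subgroup.subset_closure ⟨root n, h, t, rfl⟩

theorem toBase_mem_base (g : Coord F) : ((g.toBase.toMul : base F) : X F) ∈ base F :=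
  g.toBase.toMul.2

/-- The coordinates of an element of `X_𝒮`. -/
noncomputable def co : X F ≃* Coord F := Coord.equivX.symm

theorem co_toXHom (g : Coord F) : co (Coord.toXHom g) = g := Coord.equivX.symm_apply_apply g

theorem toXHom_co (y : X F) : Coord.toXHom (co y) = y := Coord.equivX.apply_symm_apply y

/-- The homomorphism from `X_𝒮` to the complement of the abelian normal subgroup. -/
noncomputable def complHom : X F →* Multiplicative (F × F × F × F × F × F) where
  toFun y := Multiplicative.ofAdd ((co y).s1, (co y).s14, (co y).s15, (co y).s12, (co y).s5, (co
    y).s6)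
  map_one' := by rw [map_one]; rfl
  map_mul' a b := by simp only [map_mul]; rfl

theorem complHom_eq_iff (y z : X F) : complHom y = complHom z ↔
    ((co y).s1 = (co z).s1 ∧ (co y).s14 = (co z).s14 ∧ (co y).s15 = (co z).s15) ∧
    ((co y).s12 = (co z).s12 ∧ (co y).s5 = (co z).s5 ∧ (co y).s6 = (co z).s6) := by
  simp only [complHom, MonoidHom.coe_mk, OneHom.coe_mk, EmbeddingLike.apply_eq_iff_eq,
    Prod.mk.injEq, and_assoc]

theorem complHom_surjective : Function.Surjective (complHom (F := F)) := by
  intro v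
  refine ⟨Coord.toXHom { (1 : Coord F) with
    s1 := v.toAdd.1, s14 := v.toAdd.2.1,
    s15 := v.toAdd.2.2.1, s12 := v.toAdd.2.2.2.1, s5 := v.toAdd.2.2.2.2.1,
    s6 := v.toAdd.2.2.2.2.2 }, ?_⟩
  simp only [complHom, MonoidHom.coe_mk, OneHom.coe_mk, co_toXHom]
  rfl

theorem toXHom_of_compl_eq_zero (g : Coord F) (h : g.s1 = 0 ∧ g.s5 = 0 ∧ g.s6 = 0 ∧ g.s12 = 0 ∧
    g.s14 = 0 ∧ g.s15 = 0) :
    Coord.toXHom g = ((g.toBase.toMul : base F) : X F) := by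
  obtain ⟨h1, h5, h6, h12, h14, h15⟩ := h
  change _ * g.toCompl = _
  simp [Coord.toCompl, Q.x_zero, h1, h5, h6, h12, h14, h15]

theorem coe_toBase_eq_toXHom (g : Coord F) : ((g.toBase.toMul : base F) : X F) =
    Coord.toXHom { g with s1 := 0, s5 := 0, s6 := 0, s12 := 0, s14 := 0, s15 := 0 } := by
  rw [toXHom_of_compl_eq_zero _ ⟨rfl, rfl, rfl, rfl, rfl, rfl⟩]
  rfl

/-- Normality of the base, its index, and the abelian quotient all follow from this description. -/
theorem base_eq_ker : base F = complHom.ker := by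
  apply le_antisymm
  · rw [base, Subgroup.closure_le]
    rintro _ ⟨α, hα, t, rfl⟩
    have h : S \ I = {root 2, root 4, root 7, root 10, root 11, root 17, root 18, root 19, root 16,
      root 21, root 22, root 28} := by decide +kernel
    rw [h] at hα
    simp only [Finset.mem_insert, Finset.mem_singleton] at hα
    rw [SetLike.mem_coe, MonoidHom.mem_ker, ← map_one (complHom (F := F)), complHom_eq_iff]
    rcases hα with rfl | rfl | rfl | rfl | rfl | rfl | rfl | rfl | rfl | rfl | rfl | rfl
    · rw [show Q.x (root 2) t = _ from (Coord.toXHom_t2 t).symm, co_toXHom]; simp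
    · rw [show Q.x (root 4) t = _ from (Coord.toXHom_t4 t).symm, co_toXHom]; simp
    · rw [show Q.x (root 7) t = _ from (Coord.toXHom_t7 t).symm, co_toXHom]; simp
    · rw [show Q.x (root 10) t = _ from (Coord.toXHom_t10 t).symm, co_toXHom]; simp
    · rw [show Q.x (root 11) t = _ from (Coord.toXHom_t11 t).symm, co_toXHom]; simp
    · rw [show Q.x (root 17) t = _ from (Coord.toXHom_t17 t).symm, co_toXHom]; simp
    · rw [show Q.x (root 18) t = _ from (Coord.toXHom_t18 t).symm, co_toXHom]; simp
    · rw [show Q.x (root 19) t = _ from (Coord.toXHom_t19 t).symm, co_toXHom]; simp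
    · rw [show Q.x (root 16) t = _ from (Coord.toXHom_t16 t).symm, co_toXHom]; simp
    · rw [show Q.x (root 21) t = _ from (Coord.toXHom_t21 t).symm, co_toXHom]; simp
    · rw [show Q.x (root 22) t = _ from (Coord.toXHom_t22 t).symm, co_toXHom]; simp
    · rw [show Q.x (root 28) t = _ from (Coord.toXHom_t28 t).symm, co_toXHom]; simp
  · intro y hy
    rw [MonoidHom.mem_ker, ← map_one (complHom (F := F)), complHom_eq_iff] at hy
    obtain ⟨⟨h1, h14, h15⟩, h12, h5, h6⟩ := hy
    rw [← toXHom_co y, toXHom_of_compl_eq_zero]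
    · exact toBase_mem_base _
    · rw [map_one] at *
      exact ⟨h1, h5, h6, h12, h14, h15⟩

instance : (base F).Normal := by
  rw [base_eq_ker]
  exact MonoidHom.normal_ker _

theorem exists_toBase_eq {n : X F} (hn : n ∈ base F) :
    ∃ g : Coord F, ((g.toBase.toMul : base F) : X F) = n := by
  refine ⟨co n, ?_⟩
  rw [base_eq_ker, MonoidHom.mem_ker, ← map_one (complHom (F := F)), complHom_eq_iff] at hn
  obtain ⟨⟨h1, h14, h15⟩, h12, h5, h6⟩ := hn
  rw [← toXHom_of_compl_eq_zero, toXHom_co]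
  rw [map_one] at *
  exact ⟨h1, h5, h6, h12, h14, h15⟩

theorem conj_toBase (y : X F) (h : Coord F) :
    y⁻¹ * ((h.toBase.toMul : base F) : X F) * y =
      (((Coord.conjBase (co y)⁻¹ h).toBase.toMul : base F) : X F) := by
  rw [← toXHom_co y, co_toXHom, coe_toBase_eq_toXHom, coe_toBase_eq_toXHom, ← map_inv, ← map_mul,
    ← map_mul]
  congr 1
  ext <;> simp [Coord.conjBase] <;> ring

/-- The stabilizer of the linear character with parameters `f`. -/
noncomputable def stabPar (f : Par F) : Subgroup (X F) where
  carrier := {y | Par.act (co y) f = f}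
  one_mem' := by simp [Par.act_one]
  mul_mem' {a b} ha hb := by
    rw [Set.mem_ofPred_eq] at *
    rw [map_mul, Par.act_mul, hb, ha]
  inv_mem' {a} ha := by
    rw [Set.mem_ofPred_eq] at *
    rw [map_inv, Par.act_inv_eq ha]

theorem mem_stabPar {f : Par F} {y : X F} : y ∈ stabPar f ↔ Par.act (co y) f = f := Iff.rfl

theorem act_eq_of_complHom_eq {y z : X F} (h : complHom y = complHom z) (f : Par F) :
    Par.act (co y) f = Par.act (co z) f := by
  rw [complHom_eq_iff] at h
  obtain ⟨⟨h1, h2, h3⟩, h4, h5, h6⟩ := h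
  simp [Par.act, *]

theorem base_le_stabPar (f : Par F) : base F ≤ stabPar f := by
  intro y hy
  rw [base_eq_ker, MonoidHom.mem_ker, ← map_one (complHom (F := F))] at hy
  rw [mem_stabPar, act_eq_of_complHom_eq hy, map_one, Par.act_one]

/-- The action factors through the abelian quotient by `base F`, where conjugation is trivial. -/
instance (f : Par F) : (stabPar f).Normal := by
  refine ⟨fun n hn g => ?_⟩
  rw [mem_stabPar] at *
  rw [act_eq_of_complHom_eq (z := n), hn]
  rw [map_mul, map_mul, mul_comm (complHom g), map_inv, mul_inv_cancel_right]

end Action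

section HasPar

variable {F : Type*} [Field F] (p : ℕ) [Fact p.Prime] [Algebra (ZMod p) F]

/-- The restriction of the linear character `ψ` to `X_{𝒮 ∖ ℐ}` has parameters `f`. -/
def HasPar {T : Subgroup (X F)} (ψ : T →* ℂˣ) (f : Par F) : Prop :=
  ∀ g : Coord F, zeroExt ψ ((g.toBase.toMul : base F) : X F) = phi p (f.pair g)

variable {p} {T : Subgroup (X F)} {ψ : T →* ℂˣ} {f : Par F}

theorem HasPar.x2 (h : HasPar p ψ f) (t : F) : zeroExt ψ (x 2 t) = phi p (f.f2 * t) := by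
  have := h { (1 : Coord F) with t2 := t }
  rw [Coord.coe_toBase] at this
  simpa [Q.x_zero, Par.pair] using this

theorem HasPar.x4 (h : HasPar p ψ f) (t : F) : zeroExt ψ (x 4 t) = phi p (f.f4 * t) := by
  have := h { (1 : Coord F) with t4 := t }
  rw [Coord.coe_toBase] at this
  simpa [Q.x_zero, Par.pair] using this

theorem HasPar.x7 (h : HasPar p ψ f) (t : F) : zeroExt ψ (x 7 t) = phi p (f.f7 * t) := by
  have := h { (1 : Coord F) with t7 := t }
  rw [Coord.coe_toBase] at this
  simpa [Q.x_zero, Par.pair] using this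

theorem HasPar.x10 (h : HasPar p ψ f) (t : F) : zeroExt ψ (x 10 t) = phi p (f.f10 * t) := by
  have := h { (1 : Coord F) with t10 := t }
  rw [Coord.coe_toBase] at this
  simpa [Q.x_zero, Par.pair] using this

theorem HasPar.x11 (h : HasPar p ψ f) (t : F) : zeroExt ψ (x 11 t) = phi p (f.f11 * t) := by
  have := h { (1 : Coord F) with t11 := t }
  rw [Coord.coe_toBase] at this
  simpa [Q.x_zero, Par.pair] using this

theorem HasPar.x17 (h : HasPar p ψ f) (t : F) : zeroExt ψ (x 17 t) = phi p (f.f17 * t) := by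
  have := h { (1 : Coord F) with t17 := t }
  rw [Coord.coe_toBase] at this
  simpa [Q.x_zero, Par.pair] using this

theorem HasPar.x18 (h : HasPar p ψ f) (t : F) : zeroExt ψ (x 18 t) = phi p (f.f18 * t) := by
  have := h { (1 : Coord F) with t18 := t }
  rw [Coord.coe_toBase] at this
  simpa [Q.x_zero, Par.pair] using this

theorem HasPar.x19 (h : HasPar p ψ f) (t : F) : zeroExt ψ (x 19 t) = phi p (f.f19 * t) := by
  have := h { (1 : Coord F) with t19 := t }
  rw [Coord.coe_toBase] at this
  simpa [Q.x_zero, Par.pair] using this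

theorem HasPar.x16 (h : HasPar p ψ f) (t : F) : zeroExt ψ (x 16 t) = phi p (f.f16 * t) := by
  have := h { (1 : Coord F) with t16 := t }
  rw [Coord.coe_toBase] at this
  simpa [Q.x_zero, Par.pair] using this

theorem HasPar.x21 (h : HasPar p ψ f) (t : F) : zeroExt ψ (x 21 t) = phi p (f.f21 * t) := by
  have := h { (1 : Coord F) with t21 := t }
  rw [Coord.coe_toBase] at this
  simpa [Q.x_zero, Par.pair] using this

theorem HasPar.x22 (h : HasPar p ψ f) (t : F) : zeroExt ψ (x 22 t) = phi p (f.f22 * t) := by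
  have := h { (1 : Coord F) with t22 := t }
  rw [Coord.coe_toBase] at this
  simpa [Q.x_zero, Par.pair] using this

theorem HasPar.x28 (h : HasPar p ψ f) (t : F) : zeroExt ψ (x 28 t) = phi p (f.f28 * t) := by
  have := h { (1 : Coord F) with t28 := t }
  rw [Coord.coe_toBase] at this
  simpa [Q.x_zero, Par.pair] using this

open scoped IsMulCommutative in
theorem hasPar_of (hT : base F ≤ T)
    (h2 : ∀ t, zeroExt ψ (x 2 t) = phi p (f.f2 * t))
    (h4 : ∀ t, zeroExt ψ (x 4 t) = phi p (f.f4 * t))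
    (h7 : ∀ t, zeroExt ψ (x 7 t) = phi p (f.f7 * t))
    (h10 : ∀ t, zeroExt ψ (x 10 t) = phi p (f.f10 * t))
    (h11 : ∀ t, zeroExt ψ (x 11 t) = phi p (f.f11 * t))
    (h17 : ∀ t, zeroExt ψ (x 17 t) = phi p (f.f17 * t))
    (h18 : ∀ t, zeroExt ψ (x 18 t) = phi p (f.f18 * t))
    (h19 : ∀ t, zeroExt ψ (x 19 t) = phi p (f.f19 * t))
    (h16 : ∀ t, zeroExt ψ (x 16 t) = phi p (f.f16 * t))
    (h21 : ∀ t, zeroExt ψ (x 21 t) = phi p (f.f21 * t))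
    (h22 : ∀ t, zeroExt ψ (x 22 t) = phi p (f.f22 * t))
    (h28 : ∀ t, zeroExt ψ (x 28 t) = phi p (f.f28 * t)) : HasPar p ψ f := by
  have hm : ∀ g : Coord F, ∀ {a b : base F},
      zeroExt ψ ((a * b : base F) : X F) = zeroExt ψ a * zeroExt ψ b := fun _ {a b} =>
    zeroExt_mul ψ (hT a.2) (hT b.2)
  intro g
  simp only [Coord.toBase, toMul_add, hm g]
  simp only [Par.pair, phi_add]
  rw [← h2, ← h4, ← h7, ← h10, ← h11, ← h17, ← h18, ← h19, ← h16, ← h21, ← h22, ← h28]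
  rfl

variable [Finite F]

/-- Restriction to each root subgroup is an additive character of F, hence a shift of φ. -/
theorem exists_hasPar (hT : base F ≤ T) (ψ : T →* ℂˣ) : ∃ f : Par F, HasPar p ψ f := by
  have key : ∀ n : ℕ, root n ∈ S \ I → ∃ b : F, ∀ t, zeroExt ψ (x n t) = phi p (b * t) := by
    intro n hn
    exact exists_eq_phi_mul
      { toFun := fun t => zeroExt ψ (x n t)
        map_zero_eq_one' := by rw [x, Q.x_zero, zeroExt_one]
        map_add_eq_mul' := fun s t => by
          rw [x, Q.x_add, zeroExt_mul ψ (hT (x_mem_base hn s)) (hT (x_mem_base hn t))] }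
  obtain ⟨b2, h2⟩ := key 2 (by decide)
  obtain ⟨b4, h4⟩ := key 4 (by decide)
  obtain ⟨b7, h7⟩ := key 7 (by decide)
  obtain ⟨b10, h10⟩ := key 10 (by decide)
  obtain ⟨b11, h11⟩ := key 11 (by decide)
  obtain ⟨b17, h17⟩ := key 17 (by decide)
  obtain ⟨b18, h18⟩ := key 18 (by decide)
  obtain ⟨b19, h19⟩ := key 19 (by decide)
  obtain ⟨b16, h16⟩ := key 16 (by decide)
  obtain ⟨b21, h21⟩ := key 21 (by decide)
  obtain ⟨b22, h22⟩ := key 22 (by decide)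
  obtain ⟨b28, h28⟩ := key 28 (by decide)
  exact ⟨⟨b2, b4, b7, b10, b11, b17, b18, b19, b16, b21, b22, b28⟩,
    hasPar_of hT h2 h4 h7 h10 h11 h17 h18 h19 h16 h21 h22 h28⟩

theorem pair_injective {f f' : Par F} (h : ∀ g, phi p (f.pair g) = phi p (f'.pair g)) : f = f' := by
  have h2 := eq_of_phi_mul_eq (p := p) fun t => by
    simpa [Par.pair] using h { (1 : Coord F) with t2 := t }
  have h4 := eq_of_phi_mul_eq (p := p) fun t => by
    simpa [Par.pair] using h { (1 : Coord F) with t4 := t }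
  have h7 := eq_of_phi_mul_eq (p := p) fun t => by
    simpa [Par.pair] using h { (1 : Coord F) with t7 := t }
  have h10 := eq_of_phi_mul_eq (p := p) fun t => by
    simpa [Par.pair] using h { (1 : Coord F) with t10 := t }
  have h11 := eq_of_phi_mul_eq (p := p) fun t => by
    simpa [Par.pair] using h { (1 : Coord F) with t11 := t }
  have h17 := eq_of_phi_mul_eq (p := p) fun t => by
    simpa [Par.pair] using h { (1 : Coord F) with t17 := t }
  have h18 := eq_of_phi_mul_eq (p := p) fun t => by
    simpa [Par.pair] using h { (1 : Coord F) with t18 := t }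
  have h19 := eq_of_phi_mul_eq (p := p) fun t => by
    simpa [Par.pair] using h { (1 : Coord F) with t19 := t }
  have h16 := eq_of_phi_mul_eq (p := p) fun t => by
    simpa [Par.pair] using h { (1 : Coord F) with t16 := t }
  have h21 := eq_of_phi_mul_eq (p := p) fun t => by
    simpa [Par.pair] using h { (1 : Coord F) with t21 := t }
  have h22 := eq_of_phi_mul_eq (p := p) fun t => by
    simpa [Par.pair] using h { (1 : Coord F) with t22 := t }
  have h28 := eq_of_phi_mul_eq (p := p) fun t => by
    simpa [Par.pair] using h { (1 : Coord F) with t28 := t }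
  exact Par.ext h2 h4 h7 h10 h11 h17 h18 h19 h16 h21 h22 h28

end HasPar

end Core

theorem ind_eq_index_mul {G : Type*} [Group G] [Finite G] {T : Subgroup G} (ψ : T →* ℂˣ) {z : G}
    {c : ℂ} (h : ∀ y, zeroExt ψ (y⁻¹ * z * y) = c) : ind ψ z = T.index * c := by
  cases nonempty_fintype G
  rw [← ind_one ψ, ind_eq_sum, ind_eq_sum]
  simp only [h]
  simp only [mul_one, inv_mul_cancel, zeroExt_one, Finset.sum_const, nsmul_eq_mul, mul_assoc]

namespace Core

/-! ### Irreducible characters of the core in terms of parameters -/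

section Classification

variable {F : Type*} [Field F] {p : ℕ} [Fact p.Prime] [Algebra (ZMod p) F]

theorem HasPar.conj {T : Subgroup (X F)} {ψ : T →* ℂˣ} {f : Par F} (h : HasPar p ψ f) (y : X F)
    (g : Coord F) : zeroExt ψ (y⁻¹ * ((g.toBase.toMul : base F) : X F) * y) =
      phi p ((Par.act (co y) f).pair g) := by
  rw [conj_toBase, h, Par.pair_conjBase]

theorem HasPar.conjRes {T : Subgroup (X F)} [T.Normal] {ψ : T →* ℂˣ} {f : Par F}
    (h : HasPar p ψ f) (y : X F) :
    HasPar p (UD6.conjRes le_rfl ψ y) (Par.act (co y) f) := fun g => by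
  rw [zeroExt_conjRes_self, h.conj]

/-- A linear character of a stabilizer can be chosen with prescribed parameters, and extends by any
character of the complement. -/
theorem exists_char_stabPar {T : Subgroup (X F)} {f : Par F} (hT : T = stabPar f) (κ κ' : F) :
    ∃ ψ : T →* ℂˣ, ∀ g, Coord.toXHom g ∈ T →
      zeroExt ψ (Coord.toXHom g) = phi p (f.pair g + (κ * g.s1 + κ' * g.s12)) := by
  subst hT
  -- The first summand is multiplicative by additivity of the pairing on the stabilizer. The twist
  -- by κ and κ' comes from the complement; s1 and s12 are enough to detect both extra generators in
  -- characteristic two.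
  let ψ : stabPar f →* ℂˣ :=
    { toFun := fun y => Units.mk0 (phi p (f.pair (co y) + (κ * (co y).s1 + κ' * (co y).s12)))
        (phi_ne_zero _)
      map_one' := by
        ext
        rw [Units.val_mk0, Units.val_one, ← phi_zero (p := p) (F := F)]
        congr 1
        simp [Par.pair]
      map_mul' := fun a b => by
        ext
        rw [Units.val_mul, Units.val_mk0, Units.val_mk0, Units.val_mk0, ← phi_add]
        congr 1
        rw [Subgroup.coe_mul, map_mul, Par.pair_mul, Par.act_inv_eq a.2, Coord.mul_s1,
          Coord.mul_s12]
        ring }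
  refine ⟨ψ, fun g hg => ?_⟩
  rw [zeroExt_of_mem _ hg]
  change phi p _ = _
  rw [co_toXHom]

theorem hasPar_of_eq {T : Subgroup (X F)} {f : Par F} {ψ : T →* ℂˣ} (hT : base F ≤ T) {κ κ' : F}
    (h : ∀ g, Coord.toXHom g ∈ T →
      zeroExt ψ (Coord.toXHom g) = phi p (f.pair g + (κ * g.s1 + κ' * g.s12))) :
    HasPar p ψ f := fun g => by
  have hg := hT (toBase_mem_base g)
  rw [coe_toBase_eq_toXHom] at hg ⊢
  rw [h _ hg]
  congr 1
  simp [Par.pair]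

/-- The stabilizer contains `base F`, so its index can be computed in the quotient F⁶, where its
image is the set of vectors fixing f. -/
theorem index_stabPar_mul (f : Par F) : (stabPar f).index * Nat.card { v : F × F × F × F × F × F //
    Par.act { (1 : Coord F) with
      s1 := v.1, s14 := v.2.1, s15 := v.2.2.1, s12 := v.2.2.2.1, s5 := v.2.2.2.2.1,
      s6 := v.2.2.2.2.2 } f = f } = Nat.card F ^ 6 := by
  have h1 : (stabPar f).index = ((stabPar f).map complHom).index := by
    rw [← Subgroup.index_comap_of_surjective _ (complHom_surjective (F := F)),
      Subgroup.comap_map_eq_self]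
    rw [← base_eq_ker]
    exact base_le_stabPar f
  have h2 := ((stabPar f).map complHom).card_mul_index
  rw [← h1, mul_comm] at h2
  have h3 : Nat.card (Multiplicative (F × F × F × F × F × F)) = Nat.card F ^ 6 := by
    rw [Nat.card_congr (Multiplicative.toAdd (α := F × F × F × F × F × F))]
    simp only [Nat.card_prod]
    ring
  rw [← h3, ← h2]
  congr 1
  refine Nat.card_congr (Equiv.subtypeEquiv Multiplicative.ofAdd fun v => ?_)
  constructor
  · intro hv
    refine ⟨_, show Coord.toXHom _ ∈ stabPar f by rw [mem_stabPar, co_toXHom]; exact hv, ?_⟩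
    simp only [complHom, MonoidHom.coe_mk, OneHom.coe_mk, co_toXHom]
  · rintro ⟨y, hy, hyv⟩
    rw [SetLike.mem_coe, mem_stabPar] at hy
    conv_rhs => rw [← hy]
    rw [← co_toXHom { (1 : Coord F) with
      s1 := v.1, s14 := v.2.1, s15 := v.2.2.1, s12 := v.2.2.2.1, s5 := v.2.2.2.2.1,
      s6 := v.2.2.2.2.2 }]
    apply act_eq_of_complHom_eq
    rw [hyv]
    simp only [complHom, MonoidHom.coe_mk, OneHom.coe_mk, co_toXHom]

/-- The pairing with f is an additive map from the stabilizer to F, so it vanishes on commutators.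
-/
theorem exists_comm_of_mem_stabPar {μ : base F →* ℂˣ} {f : Par F} (h : HasPar p μ f) {t t' : X F}
    (ht : t ∈ stabPar f) (ht' : t' ∈ stabPar f) : ∃ n : base F, t * t' = t' * t * n ∧ μ n = 1 := by
  have hn : (t' * t)⁻¹ * (t * t') ∈ base F := by
    rw [base_eq_ker, MonoidHom.mem_ker, map_mul, map_inv, map_mul, map_mul, mul_comm (complHom t),
      inv_mul_cancel]
  refine ⟨⟨_, hn⟩, (mul_inv_cancel_left _ _).symm, ?_⟩
  obtain ⟨c, hc⟩ := exists_toBase_eq hn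
  have hs : t * t' = t' * t * ((c.toBase.toMul : base F) : X F) := by
    rw [hc, mul_inv_cancel_left]
  rw [coe_toBase_eq_toXHom] at hs
  have hs2 := congrArg (fun y => f.pair (co y)) hs
  simp only [map_mul, co_toXHom, Par.pair_mul] at hs2
  rw [mem_stabPar] at ht ht'
  have h3 : Par.act (co t' * co t)⁻¹ f = f := Par.act_inv_eq (by rw [Par.act_mul, ht, ht'])
  rw [h3, Par.act_inv_eq ht, Par.act_inv_eq ht', add_comm (f.pair (co t')), left_eq_add] at hs2
  have h4 := h c
  rw [zeroExt_of_mem _ (toBase_mem_base c)] at h4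
  have h5 : f.pair c = 0 := hs2
  rw [h5, phi_zero, Units.val_eq_one] at h4
  rw [← h4]
  congr 1
  exact Subtype.ext hc.symm

variable [Finite F]

theorem conjRes_eq_iff_act_eq {T T' : Subgroup (X F)} (hT : base F ≤ T) (hT' : base F ≤ T')
    {ψ : T →* ℂˣ} {ψ' : T' →* ℂˣ} {f f' : Par F} (h : HasPar p ψ f) (h' : HasPar p ψ' f')
    (y y' : X F) : UD6.conjRes hT ψ y = UD6.conjRes hT' ψ' y' ↔
      Par.act (co y) f = Par.act (co y') f' := by
  rw [conjRes_eq_iff]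
  constructor
  · intro e
    refine pair_injective (p := p) fun g => ?_
    rw [← h.conj, ← h'.conj, e _ (toBase_mem_base g)]
  · intro e n hn
    obtain ⟨g, rfl⟩ := exists_toBase_eq hn
    rw [h.conj, h'.conj, e]

theorem HasPar.isInertial {T : Subgroup (X F)} (hT : base F ≤ T) {ψ : T →* ℂˣ} {f : Par F}
    (h : HasPar p ψ f) (hf : stabPar f ≤ T) : IsInertial hT ψ := by
  intro y hy
  rw [conjRes_eq_iff_act_eq hT hT h h, map_one, Par.act_one] at hy
  exact hf hy

theorem exists_act_eq_of_ind_eq {T T' : Subgroup (X F)} (hT : base F ≤ T) (hT' : base F ≤ T')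
    {ψ : T →* ℂˣ} {ψ' : T' →* ℂˣ} {f f' : Par F} (h : HasPar p ψ f) (h' : HasPar p ψ' f')
    (e : ind ψ = ind ψ') : ∃ g, Par.act g f = f' := by
  obtain ⟨y, hy⟩ := exists_conjRes_eq_of_ind_eq hT hT' ψ ψ' e
  rw [conjRes_eq_iff_act_eq hT hT' h h', map_one, Par.act_one] at hy
  exact ⟨_, hy⟩

theorem HasPar.ind_central {T : Subgroup (X F)} {ψ : T →* ℂˣ} {f : Par F}
    (h : HasPar p ψ f) (z : Coord F) (hz : ∀ g : Coord F, (Par.act g f).pair z = f.pair z) :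
    ind ψ ((z.toBase.toMul : base F) : X F) = T.index * phi p (f.pair z) :=
  ind_eq_index_mul ψ fun y => by rw [h.conj, hz]

/-- On such a root subgroup the character is its degree times φ(bt), and φ is nontrivial on every
line. -/
theorem range_subset_charKer_iff {T : Subgroup (X F)} {ψ : T →* ℂˣ} {b : F} {α : PosRoot}
    (h : ∀ t, ind ψ (Q.x α t) = T.index * phi p (b * t)) :
    Set.range (fun t : F => Q.x α t) ⊆ charKer (ind ψ) ↔ b = 0 := by
  have hi : (T.index : ℂ) ≠ 0 := Nat.cast_ne_zero.mpr T.index_ne_zero_of_finite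
  constructor
  · intro hs
    by_contra hb
    obtain ⟨t, ht⟩ := exists_phi_mul_ne_one (p := p) hb
    have : ind ψ (Q.x α t) = ind ψ 1 := hs ⟨t, rfl⟩
    rw [h, ind_one] at this
    exact ht (mul_left_cancel₀ hi (this.trans (mul_one _).symm))
  · rintro rfl _ ⟨t, rfl⟩
    change ind ψ (Q.x α t) = ind ψ 1
    rw [h, ind_one, zero_mul, phi_zero, mul_one]

theorem HasPar.ind_x16 {T : Subgroup (X F)} {ψ : T →* ℂˣ} {f : Par F} (h : HasPar p ψ f) (t : F) :
    ind ψ (x 16 t) = T.index * phi p (f.f16 * t) := by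
  have := h.ind_central { (1 : Coord F) with t16 := t } fun g => by simp [Par.pair, Par.act]
  rw [Coord.coe_toBase] at this
  simpa [Q.x_zero, Par.pair] using this

theorem HasPar.ind_x21 {T : Subgroup (X F)} {ψ : T →* ℂˣ} {f : Par F} (h : HasPar p ψ f) (t : F) :
    ind ψ (x 21 t) = T.index * phi p (f.f21 * t) := by
  have := h.ind_central { (1 : Coord F) with t21 := t } fun g => by simp [Par.pair, Par.act]
  rw [Coord.coe_toBase] at this
  simpa [Q.x_zero, Par.pair] using this

theorem HasPar.ind_x22 {T : Subgroup (X F)} {ψ : T →* ℂˣ} {f : Par F} (h : HasPar p ψ f) (t : F) :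
    ind ψ (x 22 t) = T.index * phi p (f.f22 * t) := by
  have := h.ind_central { (1 : Coord F) with t22 := t } fun g => by simp [Par.pair, Par.act]
  rw [Coord.coe_toBase] at this
  simpa [Q.x_zero, Par.pair] using this

theorem HasPar.ind_x28 {T : Subgroup (X F)} {ψ : T →* ℂˣ} {f : Par F} (h : HasPar p ψ f) (t : F) :
    ind ψ (x 28 t) = T.index * phi p (f.f28 * t) := by
  have := h.ind_central { (1 : Coord F) with t28 := t } fun g => by simp [Par.pair, Par.act]
  rw [Coord.coe_toBase] at this
  simpa [Q.x_zero, Par.pair] using this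

/-- All parameters of central root subgroups are nonzero. -/
def Par.Nondeg (f : Par F) : Prop := f.f16 ≠ 0 ∧ f.f21 ≠ 0 ∧ f.f22 ≠ 0 ∧ f.f28 ≠ 0

theorem HasPar.central_iff {T : Subgroup (X F)} {ψ : T →* ℂˣ} {f : Par F} (h : HasPar p ψ f) :
    (∀ α ∈ Z, ¬ Set.range (fun t : F => Q.x α t) ⊆ charKer (ind ψ)) ↔ f.Nondeg := by
  simp only [Z, Finset.forall_mem_insert, Finset.mem_singleton, forall_eq, Par.Nondeg,
    range_subset_charKer_iff h.ind_x16,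
    range_subset_charKer_iff h.ind_x21,
    range_subset_charKer_iff h.ind_x22,
    range_subset_charKer_iff h.ind_x28, ne_eq]

theorem HasPar.ind_mem_IrrSupport {T : Subgroup (X F)} {ψ : T →* ℂˣ} {f : Par F}
    (h : HasPar p ψ f) (hT : T = stabPar f) (hf : f.Nondeg) : ind ψ ∈ IrrSupport F Q Z := by
  subst hT
  exact ⟨ind_mem_Irr (base_le_stabPar f) ψ (h.isInertial (base_le_stabPar f) le_rfl),
    h.central_iff.mpr hf⟩

/-- The stabilizer enters through an equality with an arbitrary T, so that T can be taken to be
`base F` or `evenBase a c c'`, the groups named in the labels. -/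
theorem exists_hasPar_of_mem_IrrSupport {χ : X F → ℂ} (hχ : χ ∈ IrrSupport F Q Z) :
    ∃ f : Par F, f.Nondeg ∧ ∀ T, T = stabPar f → ∃ ψ : T →* ℂˣ, HasPar p ψ f ∧ χ = ind ψ := by
  obtain ⟨hirr, hker⟩ := hχ
  choose par hpar using fun μ : base F →* ℂˣ => exists_hasPar (p := p) le_rfl μ
  obtain ⟨μ, ψ, h1, -, rfl⟩ := exists_eq_ind_of_mem_Irr
    (fun a ha b hb => congrArg Subtype.val (mul_comm' (⟨a, ha⟩ : base F) ⟨b, hb⟩))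
    (fun μ => stabPar (par μ)) (fun μ => base_le_stabPar _)
    (fun μ y => by
      have := conjRes_eq_iff_act_eq le_rfl le_rfl (hpar μ) (hpar μ) y 1
      rw [map_one, Par.act_one, conjRes_eq_iff] at this
      simp only [inv_one, one_mul, mul_one] at this
      exact this.symm)
    (fun μ t ht t' ht' => exists_comm_of_mem_stabPar (hpar μ) ht ht') hirr
  have hψ : HasPar p ψ (par μ) := fun g => by
    rw [h1 _ (toBase_mem_base g), hpar μ g]
  exact ⟨par μ, hψ.central_iff.mp hker, fun T hT => by subst hT; exact ⟨ψ, hψ, rfl⟩⟩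

end Classification

end Core

theorem IsLabelling.ncard_eq {G L : Type*} {R : L → (G → ℂ) → Prop} (h : IsLabelling R) :
    {χ | ∃ l, R l χ}.ncard = Nat.card L := by
  choose f hf huniq using h.1
  have hinj : Function.Injective f := fun l l' e => h.2 l l' (f l) (hf l) (e ▸ hf l')
  have : {χ | ∃ l, R l χ} = Set.range f := by
    ext χ
    exact ⟨fun ⟨l, hl⟩ => ⟨l, (huniq l χ hl).symm⟩, fun ⟨l, hl⟩ => ⟨l, hl ▸ hf l⟩⟩
  rw [this, ← Nat.card_coe_set_eq, Nat.card_range_of_injective hinj]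

namespace Core

/-! ### Normal forms of parameters; odd characteristic -/

section Labels

variable {F : Type*} [Field F]

theorem card_centralLabel [Finite F] : Nat.card (CentralLabel F) = (Nat.card F - 1) ^ 4 := by
  let e : CentralLabel F ≃ Fˣ × Fˣ × Fˣ × Fˣ :=
    { toFun := fun a => (a.a16, a.a21, a.a22, a.a28)
      invFun := fun v => ⟨v.1, v.2.1, v.2.2.1, v.2.2.2⟩
      left_inv := fun _ => rfl
      right_inv := fun _ => rfl }
  rw [Nat.card_congr e]
  simp only [Nat.card_prod, Nat.card_units]
  ring

theorem CentralLabel.ext' {a b : CentralLabel F} (h16 : (a.a16 : F) = b.a16)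
    (h21 : (a.a21 : F) = b.a21) (h22 : (a.a22 : F) = b.a22) (h28 : (a.a28 : F) = b.a28) :
    a = b := by
  obtain ⟨a16, a21, a22, a28⟩ := a
  obtain ⟨b16, b21, b22, b28⟩ := b
  have e16 : a16 = b16 := Units.ext h16
  have e21 : a21 = b21 := Units.ext h21
  have e22 : a22 = b22 := Units.ext h22
  have e28 : a28 = b28 := Units.ext h28
  rw [e16, e21, e22, e28]

/-- The central label formed by the nonzero central parameters. -/
noncomputable def Par.Nondeg.central {f : Par F} (h : f.Nondeg) : CentralLabel F :=
  ⟨Units.mk0 _ h.1, Units.mk0 _ h.2.1, Units.mk0 _ h.2.2.1, Units.mk0 _ h.2.2.2⟩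

/-- The parameters of the linear characters in the definition of `OddLabel`. -/
def oddPar (l : CentralLabel F × F × F) : Par F :=
  { f2 := l.2.1, f4 := l.2.2, f7 := 0, f10 := 0, f11 := 0, f17 := 0, f18 := 0, f19 := 0,
    f16 := l.1.a16, f21 := l.1.a21, f22 := l.1.a22, f28 := l.1.a28 }

/-- The parameters of the linear characters in the definition of `EvenChar`. -/
def evenPar (a : CentralLabel F) (c c' b2 b4 : F) : Par F :=
  { f2 := b2, f4 := b4, f7 := c / a.a28, f10 := c' / a.a22, f11 := 0, f17 := 0, f18 := 0, f19 := 0,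
    f16 := a.a16, f21 := a.a21, f22 := a.a22, f28 := a.a28 }

/-- The linear system common to both blocks, with D = a28 in the first and D = a16 in the second.
Its determinant is 2ABD, and the witnesses come from Cramer's rule. -/
theorem exists_translation_eq_zero (h2 : (2 : F) ≠ 0) {A B D : F} (hA : A ≠ 0) (hB : B ≠ 0)
    (hD : D ≠ 0) (g₁ g₂ g₃ : F) : ∃ s₁ s₂ s₃ : F,
      g₁ + s₂ * A + s₃ * B = 0 ∧ g₂ - s₁ * A - s₃ * D = 0 ∧ g₃ - s₁ * B - s₂ * D = 0 := by
  refine ⟨(B * g₂ + A * g₃ + D * g₁) / (2 * A * B), (A * g₃ - D * g₁ - B * g₂) / (2 * A * D),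
    (B * g₂ - A * g₃ - D * g₁) / (2 * B * D), ?_, ?_, ?_⟩ <;> field_simp <;> ring

theorem translation_eq_zero (h2 : (2 : F) ≠ 0) {A B D s₁ s₂ s₃ : F} (hA : A ≠ 0) (hB : B ≠ 0)
    (hD : D ≠ 0) (h₁ : s₂ * A + s₃ * B = 0) (h₂ : s₁ * A + s₃ * D = 0)
    (h₃ : s₁ * B + s₂ * D = 0) : s₁ = 0 ∧ s₂ = 0 ∧ s₃ = 0 := by
  refine ⟨?_, ?_, ?_⟩
  · have : 2 * A * B * s₁ = 0 := by linear_combination B * h₂ + A * h₃ - D * h₁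
    simpa [h2, hA, hB] using this
  · have : 2 * A * D * s₂ = 0 := by linear_combination D * h₁ + A * h₃ - B * h₂
    simpa [h2, hA, hD] using this
  · have : 2 * B * D * s₃ = 0 := by linear_combination D * h₁ + B * h₂ - A * h₃
    simpa [h2, hB, hD] using this

/-- In characteristic two the translations preserve D g₁ + B g₂ + A g₃ and are transitive on its
level sets. One may take s₃ = 0, since the kernel is spanned by (D, B, A) with A ≠ 0. -/
theorem exists_translation_eq (h2 : (2 : F) = 0) {A B D : F} (hA : A ≠ 0)
    {g₁ g₂ g₃ g₁' g₂' g₃' : F}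
    (h : D * g₁ + B * g₂ + A * g₃ = D * g₁' + B * g₂' + A * g₃') : ∃ s₁ s₂ s₃ : F,
      g₁ + s₂ * A + s₃ * B = g₁' ∧ g₂ - s₁ * A - s₃ * D = g₂' ∧ g₃ - s₁ * B - s₂ * D = g₃' := by
  refine ⟨(g₂ - g₂') / A, (g₁' - g₁) / A, 0, ?_, ?_, ?_⟩
  · field_simp; ring
  · field_simp; ring
  · field_simp
    linear_combination h + (g₂' - g₂) * B * h2

theorem translation_eq_smul (h2 : (2 : F) = 0) {A B D s₁ s₂ s₃ : F} (hA : A ≠ 0)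
    (h₁ : s₂ * A + s₃ * B = 0) (h₂ : s₁ * A + s₃ * D = 0) :
    ∃ r, s₁ = r * D ∧ s₂ = r * B ∧ s₃ = r * A := by
  refine ⟨s₃ / A, ?_, ?_, ?_⟩ <;> field_simp
  · linear_combination h₂ - s₃ * D * h2
  · linear_combination h₁ - s₃ * B * h2

theorem eq_vec_of_s_eq (f : Par F) (g : Coord F) {s1 s14 s15 s12 s5 s6 : F}
    (h1 : g.s1 = s1) (h14 : g.s14 = s14) (h15 : g.s15 = s15) (h12 : g.s12 = s12) (h5 : g.s5 = s5)
    (h6 : g.s6 = s6) : Par.act g f = Par.act { (1 : Coord F) with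
      s1 := s1, s14 := s14, s15 := s15, s12 := s12, s5 := s5, s6 := s6 } f := by
  subst h1 h14 h15 h12 h5 h6
  rfl

section Odd

theorem index_base : (base F).index = Nat.card F ^ 6 := by
  rw [base_eq_ker, Subgroup.index_ker, MonoidHom.range_eq_top.mpr complHom_surjective,
    Subgroup.card_top, Nat.card_congr (Multiplicative.toAdd (α := F × F × F × F × F × F))]
  simp only [Nat.card_prod]
  ring

/-- Only the six translated parameters of f and f' need to agree. The case f' = f computes the
stabilizer, and two normal forms f, f' give the injectivity of the labels. -/
theorem compl_eq_zero_of_act_eq (h2 : (2 : F) ≠ 0) {f f' : Par F} (hf : f.Nondeg) (g : Coord F)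
    (h7 : f'.f7 = f.f7) (h18 : f'.f18 = f.f18) (h19 : f'.f19 = f.f19) (h17 : f'.f17 = f.f17)
    (h10 : f'.f10 = f.f10) (h11 : f'.f11 = f.f11) (h : Par.act g f = f') :
    (g.s1 = 0 ∧ g.s14 = 0 ∧ g.s15 = 0) ∧ (g.s12 = 0 ∧ g.s5 = 0 ∧ g.s6 = 0) := by
  obtain ⟨h16', h21', h22', h28'⟩ := hf
  subst h
  simp only [Par.act] at h7 h18 h19 h17 h10 h11
  constructor
  · exact translation_eq_zero h2 h21' h22' h28' (by linear_combination h7)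
      (by linear_combination -h18) (by linear_combination -h19)
  · exact translation_eq_zero h2 h21' h22' h16' (by linear_combination h17)
      (by linear_combination -h10) (by linear_combination -h11)

theorem stabPar_eq_base (h2 : (2 : F) ≠ 0) {f : Par F} (hf : f.Nondeg) : stabPar f = base F := by
  refine le_antisymm (fun y hy => ?_) (base_le_stabPar f)
  have := compl_eq_zero_of_act_eq h2 hf (co y) rfl rfl rfl rfl rfl rfl hy
  rw [base_eq_ker, MonoidHom.mem_ker, ← map_one (complHom (F := F)), complHom_eq_iff, map_one]
  exact this

theorem exists_act_eq_oddPar (h2 : (2 : F) ≠ 0) {f : Par F} (hf : f.Nondeg) :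
    ∃ g l, Par.act g f = oddPar l := by
  obtain ⟨s1, s14, s15, h7, h18, h19⟩ :=
    exists_translation_eq_zero h2 hf.2.1 hf.2.2.1 hf.2.2.2 f.f7 f.f18 f.f19
  obtain ⟨s12, s5, s6, h17, h10, h11⟩ :=
    exists_translation_eq_zero h2 hf.2.1 hf.2.2.1 hf.1 f.f17 f.f10 f.f11
  let g : Coord F := { (1 : Coord F) with
    s1 := s1, s14 := s14, s15 := s15, s12 := s12, s5 := s5, s6 := s6 }
  exact ⟨g, (hf.central, (Par.act g f).f2, (Par.act g f).f4),
    Par.ext rfl rfl h7 h10 h11 h17 h18 h19 rfl rfl rfl rfl⟩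

theorem oddPar_nondeg (l : CentralLabel F × F × F) : (oddPar l).Nondeg :=
  ⟨Units.ne_zero _, Units.ne_zero _, Units.ne_zero _, Units.ne_zero _⟩

theorem oddPar_injective : Function.Injective (oddPar (F := F)) := by
  rintro ⟨a, b2, b4⟩ ⟨a', b2', b4'⟩ h
  have h2 : b2 = b2' := congrArg Par.f2 h
  have h4 : b4 = b4' := congrArg Par.f4 h
  have ha : a = a' := CentralLabel.ext' (congrArg Par.f16 h) (congrArg Par.f21 h)
    (congrArg Par.f22 h) (congrArg Par.f28 h)
  rw [h2, h4, ha]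

variable {p : ℕ} [Fact p.Prime] [Algebra (ZMod p) F]

theorem takes_x_iff {T : Subgroup (X F)} (hT : base F ≤ T) (ψ : T →* ℂˣ) {n : ℕ}
    (hn : root n ∈ S \ I) (t : F) (z : ℂ) : Takes ψ (x n t) z ↔ zeroExt ψ (x n t) = z := by
  rw [takes_iff]
  exact and_iff_right (hT (x_mem_base hn t))

theorem oddLabel_iff (l : CentralLabel F × F × F) (χ : X F → ℂ) :
    OddLabel p l χ ↔ ∃ ψ : base F →* ℂˣ, HasPar p ψ (oddPar l) ∧ χ = ind ψ := by
  refine exists_congr fun ψ => ?_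
  have tk := fun n (hn : root n ∈ S \ I) t z => takes_x_iff le_rfl ψ hn t z
  constructor
  · rintro ⟨hc, hJ, h2, h4, rfl⟩
    refine ⟨?_, rfl⟩
    have hJ' : ∀ n, root n ∈ S \ I → root n ∈ J → ∀ t, zeroExt ψ (x n t) = phi p (0 * t) := by
      intro n hn hj t
      rw [zero_mul, phi_zero]
      exact (tk n hn t 1).mp (hJ _ hj t)
    exact hasPar_of le_rfl (fun t => (tk 2 (by decide) t _).mp (h2 t))
      (fun t => (tk 4 (by decide) t _).mp (h4 t)) (hJ' 7 (by decide) (by decide))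
      (hJ' 10 (by decide) (by decide)) (hJ' 11 (by decide) (by decide))
      (hJ' 17 (by decide) (by decide)) (hJ' 18 (by decide) (by decide))
      (hJ' 19 (by decide) (by decide)) (fun t => (tk 16 (by decide) t _).mp (hc t).1)
      (fun t => (tk 21 (by decide) t _).mp (hc t).2.1)
      (fun t => (tk 22 (by decide) t _).mp (hc t).2.2.1)
      (fun t => (tk 28 (by decide) t _).mp (hc t).2.2.2)
  · rintro ⟨h, rfl⟩
    refine ⟨fun t => ⟨(tk 16 (by decide) t _).mpr (h.x16 t), (tk 21 (by decide) t _).mpr (h.x21 t),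
      (tk 22 (by decide) t _).mpr (h.x22 t), (tk 28 (by decide) t _).mpr (h.x28 t)⟩, ?_,
      fun t => (tk 2 (by decide) t _).mpr (h.x2 t), fun t => (tk 4 (by decide) t _).mpr (h.x4 t),
      rfl⟩
    have h0 : ∀ {n : ℕ} {t : F}, zeroExt ψ (x n t) = phi p (0 * t) → zeroExt ψ (x n t) = 1 :=
      fun e => by rw [e, zero_mul, phi_zero]
    intro β hβ t
    simp only [J, Finset.mem_insert, Finset.mem_singleton] at hβ
    rcases hβ with rfl | rfl | rfl | rfl | rfl | rfl
    · exact (tk 7 (by decide) t _).mpr (h0 (h.x7 t))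
    · exact (tk 10 (by decide) t _).mpr (h0 (h.x10 t))
    · exact (tk 11 (by decide) t _).mpr (h0 (h.x11 t))
    · exact (tk 17 (by decide) t _).mpr (h0 (h.x17 t))
    · exact (tk 18 (by decide) t _).mpr (h0 (h.x18 t))
    · exact (tk 19 (by decide) t _).mpr (h0 (h.x19 t))

theorem HasPar.eq_of_base {ψ ψ' : base F →* ℂˣ} {f : Par F} (h : HasPar p ψ f)
    (h' : HasPar p ψ' f) : ψ = ψ' := by
  ext n
  obtain ⟨g, hg⟩ := exists_toBase_eq n.2
  have h1 := h g
  have h2 := h' g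
  rw [hg, zeroExt_of_mem _ n.2] at h1 h2
  exact h1.trans h2.symm

variable [Finite F]

theorem isLabelling_oddLabel (h2 : (2 : F) ≠ 0) : IsLabelling (OddLabel (F := F) p) := by
  constructor
  · intro l
    obtain ⟨ψ, hψ⟩ := exists_char_stabPar (p := p) (stabPar_eq_base h2 (oddPar_nondeg l)).symm 0 0
    have hp := hasPar_of_eq le_rfl hψ
    refine ⟨ind ψ, (oddLabel_iff l _).mpr ⟨ψ, hp, rfl⟩, fun χ hχ => ?_⟩
    obtain ⟨ψ', hψ', rfl⟩ := (oddLabel_iff l χ).mp hχ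
    rw [hp.eq_of_base hψ']
  · intro l l' χ hl hl'
    obtain ⟨ψ, hψ, rfl⟩ := (oddLabel_iff l _).mp hl
    obtain ⟨ψ', hψ', e⟩ := (oddLabel_iff l' _).mp hl'
    obtain ⟨g, hg⟩ := exists_act_eq_of_ind_eq le_rfl le_rfl hψ hψ' e
    obtain ⟨⟨h1, h14, h15⟩, h12, h5, h6⟩ :=
      compl_eq_zero_of_act_eq (f' := oddPar l') h2 (oddPar_nondeg l) g rfl rfl rfl rfl rfl rfl hg
    rw [eq_vec_of_s_eq _ g h1 h14 h15 h12 h5 h6] at hg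
    exact oddPar_injective ((Par.act_one _).symm.trans hg)

theorem irrSupport_eq_oddFamily (h2 : (2 : F) ≠ 0) : IrrSupport F Q Z = oddFamily F p := by
  ext χ
  constructor
  · intro hχ
    obtain ⟨f, hf, hT⟩ := exists_hasPar_of_mem_IrrSupport (p := p) hχ
    obtain ⟨ψ, hψ, rfl⟩ := hT _ (stabPar_eq_base h2 hf).symm
    -- Conjugation moves the parameters to normal form and leaves the induced character unchanged.
    obtain ⟨g, l, hl⟩ := exists_act_eq_oddPar h2 hf
    have := hψ.conjRes (Coord.toXHom g)
    rw [co_toXHom, hl] at this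
    exact ⟨l, (oddLabel_iff l _).mpr ⟨_, this, (ind_conjRes _ _).symm⟩⟩
  · rintro ⟨l, hl⟩
    obtain ⟨ψ, hψ, rfl⟩ := (oddLabel_iff l _).mp hl
    exact hψ.ind_mem_IrrSupport (stabPar_eq_base h2 (oddPar_nondeg l)).symm (oddPar_nondeg l)

theorem odd_main (h2 : (2 : F) ≠ 0) :
    IrrSupport F Q Z = oddFamily F p ∧ IsLabelling (OddLabel (F := F) p) ∧
      (oddFamily F p).ncard = Nat.card F ^ 2 * (Nat.card F - 1) ^ 4 ∧
      ∀ χ ∈ oddFamily F p, χ 1 = (Nat.card F : ℂ) ^ 6 := by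
  refine ⟨irrSupport_eq_oddFamily h2, isLabelling_oddLabel h2, ?_, ?_⟩
  · rw [oddFamily, (isLabelling_oddLabel (p := p) h2).ncard_eq, Nat.card_prod, Nat.card_prod,
      card_centralLabel]
    ring
  · rintro χ ⟨l, hl⟩
    obtain ⟨ψ, -, rfl⟩ := (oddLabel_iff l _).mp hl
    rw [ind_one, index_base, Nat.cast_pow]

end Odd

end Labels

/-! ### Conjugation invariance on the complement -/

section Complement

variable {F : Type*} [Field F]

/-- The element of the complement with the given coordinates. -/
def Coord.ofCompl (s1 s14 s15 s12 s5 s6 : F) : Coord F :=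
  { (1 : Coord F) with s1 := s1, s14 := s14, s15 := s15, s12 := s12, s5 := s5, s6 := s6 }

theorem Coord.ofCompl_mul (s1 s14 s15 s12 s5 s6 s1' s14' s15' s12' s5' s6' : F) :
    Coord.ofCompl s1 s14 s15 s12 s5 s6 * Coord.ofCompl s1' s14' s15' s12' s5' s6' =
      Coord.ofCompl (s1 + s1') (s14 + s14') (s15 + s15') (s12 + s12') (s5 + s5') (s6 + s6') := by
  ext <;> simp [Coord.ofCompl]

theorem Coord.ofCompl_comm (s1 s14 s15 s12 s5 s6 s1' s14' s15' s12' s5' s6' : F) :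
    Coord.ofCompl s1 s14 s15 s12 s5 s6 * Coord.ofCompl s1' s14' s15' s12' s5' s6' =
      Coord.ofCompl s1' s14' s15' s12' s5' s6' * Coord.ofCompl s1 s14 s15 s12 s5 s6 := by
  simp only [Coord.ofCompl_mul, add_comm]

theorem complHom_toXHom_ofCompl_co (y : X F) : complHom (Coord.toXHom (Coord.ofCompl (co y).s1
    (co y).s14 (co y).s15 (co y).s12 (co y).s5 (co y).s6)) = complHom y := by
  rw [complHom_eq_iff, co_toXHom]
  exact ⟨⟨rfl, rfl, rfl⟩, rfl, rfl, rfl⟩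

theorem inv_mul_mem_base {y z : X F} (h : complHom y = complHom z) : y⁻¹ * z ∈ base F := by
  rw [base_eq_ker, MonoidHom.mem_ker, map_mul, map_inv, h, inv_mul_cancel]

/-- Write y as an element of the complement times an element of `base F`. The former commutes with
the argument, and the latter lies in T. Hence the signs at x_{1,14,15} and x_{5,6,12} are invariant
under conjugation. -/
theorem zeroExt_conj_ofCompl {T : Subgroup (X F)} (hT : base F ≤ T) (ψ : T →* ℂˣ) (y : X F)
    (s1 s14 s15 s12 s5 s6 : F) :
    zeroExt ψ (y⁻¹ * Coord.toXHom (Coord.ofCompl s1 s14 s15 s12 s5 s6) * y) =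
      zeroExt ψ (Coord.toXHom (Coord.ofCompl s1 s14 s15 s12 s5 s6)) := by
  obtain ⟨z, hz, hzy⟩ : ∃ z, z = Coord.toXHom (Coord.ofCompl (co y).s1 (co y).s14 (co y).s15
    (co y).s12 (co y).s5 (co y).s6) ∧ z⁻¹ * y ∈ T :=
    ⟨_, rfl, hT (inv_mul_mem_base (complHom_toXHom_ofCompl_co y))⟩
  obtain ⟨w, hw⟩ : ∃ w, w = Coord.toXHom (Coord.ofCompl s1 s14 s15 s12 s5 s6) := ⟨_, rfl⟩
  have hc : z⁻¹ * w * z = w := by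
    rw [mul_assoc, inv_mul_eq_iff_eq_mul, hz, hw, ← map_mul, ← map_mul, Coord.ofCompl_comm]
  have key := zeroExt_conj ψ (g := z⁻¹ * w * z) hzy
  rw [show (z⁻¹ * y)⁻¹ * (z⁻¹ * w * z) * (z⁻¹ * y) = y⁻¹ * w * y by group, hc] at key
  rw [← hw, key]

end Complement

/-! ### Normal forms and stabilizers in characteristic two -/

section Even

variable {F : Type*} [Field F]

theorem x1_14_15_eq (a : CentralLabel F) (t : F) : x1_14_15 a t =
    Coord.toXHom (Coord.ofCompl (t * a.a28) (t * a.a22) (t * a.a21) 0 0 0) := by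
  rw [x1_14_15, ← Coord.toXHom_s1, ← Coord.toXHom_s14, ← Coord.toXHom_s15, ← map_mul, ← map_mul]
  congr 1
  ext <;> simp [Coord.ofCompl, mul_comm]

theorem x5_6_12_eq (a : CentralLabel F) (t : F) : x5_6_12 a t =
    Coord.toXHom (Coord.ofCompl 0 0 0 (t * a.a16) (t * a.a22) (t * a.a21)) := by
  rw [x5_6_12, ← Coord.toXHom_s5, ← Coord.toXHom_s6, ← Coord.toXHom_s12, ← map_mul, ← map_mul]
  congr 1
  ext <;> simp [Coord.ofCompl, mul_comm]

theorem x1_14_15_zero (a : CentralLabel F) : x1_14_15 a 0 = 1 := by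
  simp [x1_14_15, Q.x_zero]

theorem x5_6_12_zero (a : CentralLabel F) : x5_6_12 a 0 = 1 := by
  simp [x5_6_12, Q.x_zero]

theorem CentralLabel.u_ne_zero (a : CentralLabel F) : a.u ≠ 0 := by simp [CentralLabel.u]

theorem CentralLabel.v_ne_zero (a : CentralLabel F) : a.v ≠ 0 := by simp [CentralLabel.v]

/-- The coordinates of `x_{1,14,15}(r) x_{5,6,12}(r')`. -/
def evenCompl (a : CentralLabel F) (r r' : F) : Coord F :=
  Coord.ofCompl (r * a.a28) (r * a.a22) (r * a.a21) (r' * a.a16) (r' * a.a22) (r' * a.a21)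

theorem toXHom_evenCompl (a : CentralLabel F) (r r' : F) :
    Coord.toXHom (evenCompl a r r') = x1_14_15 a r * x5_6_12 a r' := by
  rw [x1_14_15_eq, x5_6_12_eq, ← map_mul, Coord.ofCompl_mul]
  simp [evenCompl]

theorem evenPar_nondeg (a : CentralLabel F) (c c' b2 b4 : F) : (evenPar a c c' b2 b4).Nondeg :=
  ⟨Units.ne_zero _, Units.ne_zero _, Units.ne_zero _, Units.ne_zero _⟩

/-- These elements form the kernels of the two translation maps, so only f2 and f4 move. The three
quadratic terms in each block are equal, and 3 = 1. -/
theorem act_evenCompl (h2 : (2 : F) = 0) (a : CentralLabel F) (c c' b2 b4 r r' : F) :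
    Par.act (evenCompl a r r') (evenPar a c c' b2 b4) =
      evenPar a c c' (b2 + (r * c + r ^ 2 * a.u)) (b4 + (r' * c' + r' ^ 2 * a.v)) := by
  have h28 := a.a28.ne_zero
  have h22 := a.a22.ne_zero
  ext <;> simp only [Par.act, evenPar, evenCompl, Coord.ofCompl, CentralLabel.u, CentralLabel.v]
  · field_simp
    linear_combination -(r * c + 2 * r ^ 2 * a.a28 * a.a22 * a.a21) * h2
  · field_simp
    linear_combination -(2 * r' ^ 2 * a.a16 * a.a22 * a.a21) * h2
  · linear_combination (r * a.a21 * a.a22 : F) * h2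
  · linear_combination -(r' * a.a21 * a.a16 : F) * h2
  · linear_combination -(r' * a.a22 * a.a16 : F) * h2
  · linear_combination (r' * a.a21 * a.a22 : F) * h2
  · linear_combination -(r * a.a21 * a.a28 : F) * h2
  · linear_combination -(r * a.a22 * a.a28 : F) * h2

/-- The invariant functionals give equality of c and of c'. The translation in each block is then
zero, which leaves only the kernel lines, where `act_evenCompl` applies. -/
theorem eq_of_act_evenPar_eq (h2 : (2 : F) = 0) {a a' : CentralLabel F}
    {c c' b2 b4 d d' e2 e4 : F} {g : Coord F}
    (h : Par.act g (evenPar a c c' b2 b4) = evenPar a' d d' e2 e4) :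
    a = a' ∧ c = d ∧ c' = d' ∧ ∃ r r' : F,
      e2 = b2 + (r * c + r ^ 2 * a.u) ∧ e4 = b4 + (r' * c' + r' ^ 2 * a.v) ∧
      (g.s1 = r * a.a28 ∧ g.s14 = r * a.a22 ∧ g.s15 = r * a.a21) ∧
      g.s12 = r' * a.a16 ∧ g.s5 = r' * a.a22 ∧ g.s6 = r' * a.a21 := by
  have ha : a = a' := CentralLabel.ext' (congrArg Par.f16 h) (congrArg Par.f21 h)
    (congrArg Par.f22 h) (congrArg Par.f28 h)
  subst ha
  have h28 := a.a28.ne_zero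
  have h22 := a.a22.ne_zero
  have h21 := a.a21.ne_zero
  have e7 := congrArg Par.f7 h
  have e18 := congrArg Par.f18 h
  have e19 := congrArg Par.f19 h
  have e10 := congrArg Par.f10 h
  have e11 := congrArg Par.f11 h
  have e17 := congrArg Par.f17 h
  simp only [Par.act, evenPar] at e7 e18 e19 e10 e11 e17
  have hc : c = d := by
    -- The combination used is the invariant a28 f7 + a22 f18 + a21 f19, in which all translation
    -- terms occur twice.
    field_simp at e7
    linear_combination e7 + a.a22 * e18 + a.a21 * e19 + g.s1 * a.a21 * a.a22 * h2
  have hc' : c' = d' := by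
    field_simp at e10
    linear_combination e10 + a.a21 * e11 + a.a16 * e17 + g.s12 * a.a21 * a.a22 * h2
  subst hc hc'
  obtain ⟨r, hr1, hr14, hr15⟩ := translation_eq_smul (s₁ := g.s1) (s₂ := g.s14) (s₃ := g.s15)
    (A := a.a21) (B := a.a22) (D := a.a28) h2 h21 (by linear_combination e7)
    (by linear_combination -e18)
  obtain ⟨r', hr12, hr5, hr6⟩ := translation_eq_smul (s₁ := g.s12) (s₂ := g.s5) (s₃ := g.s6)
    (A := a.a21) (B := a.a22) (D := a.a16) h2 h21 (by linear_combination e17)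
    (by linear_combination -e10)
  rw [eq_vec_of_s_eq _ g hr1 hr14 hr15 hr12 hr5 hr6] at h
  have h' := (act_evenCompl h2 a c c' b2 b4 r r').symm.trans h
  exact ⟨rfl, rfl, rfl, r, r', (congrArg Par.f2 h').symm, (congrArg Par.f4 h').symm,
    ⟨hr1, hr14, hr15⟩, hr12, hr5, hr6⟩

theorem mul_add_sq_mul_eq_zero_iff (h2 : (2 : F) = 0) {c u : F} (hu : u ≠ 0) (r : F) :
    r * c + r ^ 2 * u = 0 ↔ r = 0 ∨ r = c / u := by
  have : r * c + r ^ 2 * u = u * (r * (r - c / u)) := by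
    field_simp
    linear_combination r * c * h2
  rw [this, mul_eq_zero_iff_left hu, mul_eq_zero, sub_eq_zero]

theorem act_evenCompl_eq_self_iff (h2 : (2 : F) = 0) (a : CentralLabel F) (c c' b2 b4 r r' : F) :
    Par.act (evenCompl a r r') (evenPar a c c' b2 b4) = evenPar a c c' b2 b4 ↔
      r * c + r ^ 2 * a.u = 0 ∧ r' * c' + r' ^ 2 * a.v = 0 := by
  rw [act_evenCompl h2]
  constructor
  · intro h
    exact ⟨left_eq_add.mp (congrArg Par.f2 h).symm, left_eq_add.mp (congrArg Par.f4 h).symm⟩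
  · rintro ⟨h, h'⟩
    rw [h, h', add_zero, add_zero]

theorem base_le_evenBase (a : CentralLabel F) (c c' : F) : base F ≤ evenBase a c c' := le_sup_left

theorem x1_14_15_mem (a : CentralLabel F) (c c' : F) :
    x1_14_15 a (c / a.u) ∈ evenBase a c c' :=
  Subgroup.mem_sup_right (Subgroup.subset_closure (Set.mem_insert _ _))

theorem x5_6_12_mem (a : CentralLabel F) (c c' : F) :
    x5_6_12 a (c' / a.v) ∈ evenBase a c c' :=
  Subgroup.mem_sup_right (Subgroup.subset_closure (Set.mem_insert_of_mem _ rfl))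

theorem toXHom_evenCompl_mem_stabPar_iff (h2 : (2 : F) = 0) (a : CentralLabel F)
    (c c' b2 b4 r r' : F) : Coord.toXHom (evenCompl a r r') ∈ stabPar (evenPar a c c' b2 b4) ↔
      (r = 0 ∨ r = c / a.u) ∧ (r' = 0 ∨ r' = c' / a.v) := by
  rw [mem_stabPar, co_toXHom, act_evenCompl_eq_self_iff h2,
    mul_add_sq_mul_eq_zero_iff h2 a.u_ne_zero, mul_add_sq_mul_eq_zero_iff h2 a.v_ne_zero]

/-- The stabilizer does not depend on b2 and b4: on the kernel lines it is cut out by rc + r²u = 0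
and r'c' + r'²v = 0. -/
theorem evenBase_eq_stabPar (h2 : (2 : F) = 0) (a : CentralLabel F) (c c' b2 b4 : F) :
    evenBase a c c' = stabPar (evenPar a c c' b2 b4) := by
  apply le_antisymm
  · refine sup_le (base_le_stabPar _) ?_
    rw [Subgroup.closure_le]
    rintro y (rfl | rfl)
    · have := (toXHom_evenCompl_mem_stabPar_iff h2 a c c' b2 b4 (c / a.u) 0).mpr
        ⟨Or.inr rfl, Or.inl rfl⟩
      rwa [toXHom_evenCompl, x5_6_12_zero, mul_one] at this
    · have := (toXHom_evenCompl_mem_stabPar_iff h2 a c c' b2 b4 0 (c' / a.v)).mpr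
        ⟨Or.inl rfl, Or.inr rfl⟩
      rwa [toXHom_evenCompl, x1_14_15_zero, one_mul] at this
  · intro y hy
    obtain ⟨-, -, -, r, r', -, -, ⟨h1, h14, h15⟩, h12, h5, h6⟩ :=
      eq_of_act_evenPar_eq h2 (mem_stabPar.mp hy)
    have hz : complHom (Coord.toXHom (evenCompl a r r')) = complHom y := by
      rw [complHom_eq_iff, co_toXHom]
      exact ⟨⟨h1.symm, h14.symm, h15.symm⟩, h12.symm, h5.symm, h6.symm⟩
    rw [mem_stabPar, ← act_eq_of_complHom_eq hz, ← mem_stabPar,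
      toXHom_evenCompl_mem_stabPar_iff h2] at hy
    have hm : Coord.toXHom (evenCompl a r r') ∈ evenBase a c c' := by
      rw [toXHom_evenCompl]
      obtain ⟨hr, hr'⟩ := hy
      refine mul_mem ?_ ?_
      · rcases hr with rfl | rfl
        · rw [x1_14_15_zero]; exact one_mem _
        · exact x1_14_15_mem a c c'
      · rcases hr' with rfl | rfl
        · rw [x5_6_12_zero]; exact one_mem _
        · exact x5_6_12_mem a c c'
    have := mul_mem hm (base_le_evenBase a c c' (inv_mul_mem_base hz))
    rwa [mul_inv_cancel_left] at this

theorem exists_act_eq_evenPar (h2 : (2 : F) = 0) {f : Par F} (hf : f.Nondeg) :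
    ∃ g a c c' b2 b4, Par.act g f = evenPar a c c' b2 b4 := by
  have h28 := hf.2.2.2
  have h22 := hf.2.2.1
  obtain ⟨s1, s14, s15, h7, h18, h19⟩ := exists_translation_eq h2 hf.2.1
    (B := f.f22) (D := f.f28) (g₁ := f.f7) (g₂ := f.f18) (g₃ := f.f19)
    -- The target is the point of the same level set with f18 = f19 = 0. In the second block the
    -- surviving coordinate is f10.
    (g₁' := (f.f28 * f.f7 + f.f22 * f.f18 + f.f21 * f.f19) / f.f28) (g₂' := 0) (g₃' := 0)
    (by field_simp; ring)
  obtain ⟨s12, s5, s6, h17, h10, h11⟩ := exists_translation_eq h2 hf.2.1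
    (B := f.f22) (D := f.f16) (g₁ := f.f17) (g₂ := f.f10) (g₃ := f.f11) (g₁' := 0)
    (g₂' := (f.f16 * f.f17 + f.f22 * f.f10 + f.f21 * f.f11) / f.f22) (g₃' := 0)
    (by field_simp; ring)
  refine ⟨Coord.ofCompl s1 s14 s15 s12 s5 s6, hf.central, _, _, _, _,
    Par.ext rfl rfl h7 h10 h11 h17 h18 h19 rfl rfl rfl rfl⟩

theorem card_mul_add_sq_mul_eq_zero (h2 : (2 : F) = 0) {c u : F} (hu : u ≠ 0) :
    Nat.card { r : F // r * c + r ^ 2 * u = 0 } = Set.ncard {0, c / u} := by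
  rw [← Nat.card_coe_set_eq]
  exact Nat.card_congr (Equiv.subtypeEquivRight fun r => mul_add_sq_mul_eq_zero_iff h2 hu r)

/-- The set {0, c/u} has one element if c = 0 and two otherwise, so a single formula covers the
degrees of all four families. -/
theorem index_evenBase_mul (h2 : (2 : F) = 0) (a : CentralLabel F) (c c' : F) :
    (evenBase a c c').index * (Set.ncard {0, c / a.u} * Set.ncard {0, c' / a.v}) =
      Nat.card F ^ 6 := by
  rw [evenBase_eq_stabPar h2 a c c' 0 0, ← index_stabPar_mul (evenPar a c c' 0 0),
    ← card_mul_add_sq_mul_eq_zero h2 a.u_ne_zero, ← card_mul_add_sq_mul_eq_zero h2 a.v_ne_zero,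
    ← Nat.card_prod]
  congr 1
  refine Nat.card_congr (Equiv.ofBijective
    (fun w => ⟨(w.1.1 * a.a28, w.1.1 * a.a22, w.1.1 * a.a21, w.2.1 * a.a16, w.2.1 * a.a22,
      w.2.1 * a.a21), (act_evenCompl_eq_self_iff h2 a c c' 0 0 w.1.1 w.2.1).mpr ⟨w.1.2, w.2.2⟩⟩)
    ⟨?_, ?_⟩)
  · rintro ⟨⟨r, hr⟩, ⟨r', hr'⟩⟩ ⟨⟨t, ht⟩, ⟨t', ht'⟩⟩ h0
    have h := mul_right_cancel₀ a.a28.ne_zero (congrArg (fun w => w.1.1) h0)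
    have h' := mul_right_cancel₀ a.a16.ne_zero (congrArg (fun w => w.1.2.2.2.1) h0)
    subst h h'
    rfl
  · rintro ⟨⟨s1, s14, s15, s12, s5, s6⟩, hv⟩
    obtain ⟨-, -, -, r, r', e2, e4, ⟨h1, h14, h15⟩, h12, h5, h6⟩ := eq_of_act_evenPar_eq h2 hv
    dsimp only at h1 h14 h15 h12 h5 h6
    subst h1 h14 h15 h12 h5 h6
    exact ⟨(⟨r, left_eq_add.mp e2⟩, ⟨r', left_eq_add.mp e4⟩), rfl⟩

end Even

/-! ### Signs, including the degenerate parameters -/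

section Signs

variable {F : Type*} [Field F] [Algebra (ZMod 2) F] [Finite F]

theorem sign_zero : sign 0 = 1 := by simp [sign]

theorem sign_mul_self (d : ZMod 2) : sign d * sign d = 1 := by
  rw [sign, ← mul_pow, neg_one_mul, neg_neg, one_pow]

theorem exists_phi_mul_eq_sign_of_imp {w : F} {d : ZMod 2} (h : w = 0 → d = 0) :
    ∃ b : F, phi 2 (b * w) = sign d := by
  by_cases hw : w = 0
  · exact ⟨0, by rw [zero_mul, phi_zero, h hw, sign_zero]⟩
  · exact exists_phi_mul_eq_sign hw d

/-- For c = 0 division by zero makes u/c² = 0, so the hypothesis holds for every δ; the conclusion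
is then surjectivity of squaring. Both cases thus share one statement. -/
theorem exists_mul_add_sq_mul_eq {c u δ : F} (hu : u ≠ 0) (h : phi 2 (δ * (u / c ^ 2)) = 1) :
    ∃ r, r * c + r ^ 2 * u = δ := by
  by_cases hc : c = 0
  · obtain ⟨r, hr⟩ := exists_sq_mul hu δ
    exact ⟨r, by rw [hc, mul_zero, zero_add, hr]⟩
  · exact exists_mul_add_sq_mul hc hu h

theorem phi_mul_add_sq_mul_div (c u r : F) : phi 2 ((r * c + r ^ 2 * u) * (u / c ^ 2)) = 1 := by
  by_cases hc : c = 0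
  · simp [hc, phi_zero]
  · exact phi_mul_add_sq_mul hc r

end Signs

/-! ### Characters in characteristic two, uniformly in c and c' -/

section EvenCharacters

variable {F : Type*} [Field F] [Algebra (ZMod 2) F]

instance (a : CentralLabel F) (c c' : F) : (evenBase a c c').Normal := by
  rw [evenBase_eq_stabPar two_eq_zero_of_algebra a c c' 0 0]
  infer_instance

theorem x1_14_15_mul_self (a : CentralLabel F) (t : F) : x1_14_15 a t * x1_14_15 a t = 1 := by
  rw [x1_14_15_eq, ← map_mul, Coord.ofCompl_mul]
  simp only [add_self_of_algebra]
  exact map_one _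

theorem x5_6_12_mul_self (a : CentralLabel F) (t : F) : x5_6_12 a t * x5_6_12 a t = 1 := by
  rw [x5_6_12_eq, ← map_mul, Coord.ofCompl_mul]
  simp only [add_self_of_algebra]
  exact map_one _

theorem evenBase_char_ext {a : CentralLabel F} {c c' : F} {ψ ψ' : evenBase a c c' →* ℂˣ}
    {f : Par F} (h : HasPar 2 ψ f) (h' : HasPar 2 ψ' f)
    (h1 : zeroExt ψ (x1_14_15 a (c / a.u)) = zeroExt ψ' (x1_14_15 a (c / a.u)))
    (h5 : zeroExt ψ (x5_6_12 a (c' / a.v)) = zeroExt ψ' (x5_6_12 a (c' / a.v))) : ψ = ψ' := by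
  have key : ∀ y (hy : y ∈ evenBase a c c'), ψ ⟨y, hy⟩ = ψ' ⟨y, hy⟩ := by
    intro y hy
    suffices evenBase a c c' ≤ (MonoidHom.eqLocus ψ ψ').map (evenBase a c c').subtype by
      obtain ⟨⟨z, hz⟩, hz', rfl⟩ := this hy
      exact hz'
    have mk : ∀ y ∈ evenBase a c c', zeroExt ψ y = zeroExt ψ' y →
        y ∈ (MonoidHom.eqLocus ψ ψ').map (evenBase a c c').subtype := by
      intro y hy e
      rw [zeroExt_of_mem _ hy, zeroExt_of_mem _ hy] at e
      exact ⟨⟨y, hy⟩, Units.ext e, rfl⟩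
    refine sup_le (fun n hn => ?_) ((Subgroup.closure_le _).mpr ?_)
    · obtain ⟨g, rfl⟩ := exists_toBase_eq hn
      exact mk _ (base_le_evenBase a c c' hn) ((h g).trans (h' g).symm)
    · rintro _ (rfl | rfl)
      · exact mk _ (x1_14_15_mem a c c') h1
      · exact mk _ (x5_6_12_mem a c c') h5
  ext y
  exact congrArg Units.val (key y.1 y.2)

variable [Finite F]

/-- The conditions at 11, 17, 18, 19 make these parameters zero, so those on x_{7,18,19} and
x_{10,11,17} determine f7 and f10. Only f2 and f4 remain free. -/
theorem evenChar_iff {a : CentralLabel F} {c c' : F} {ψ : evenBase a c c' →* ℂˣ} :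
    EvenChar 2 a c c' ψ ↔ ∃ b2 b4, HasPar 2 ψ (evenPar a c c' b2 b4) := by
  have hT := base_le_evenBase a c c'
  have tk := fun n (hn : root n ∈ S \ I) t z => takes_x_iff hT ψ hn t z
  have mem := fun n (hn : root n ∈ S \ I) (t : F) => hT (x_mem_base hn t)
  have h28 := a.a28.ne_zero
  have h22 := a.a22.ne_zero
  have e7 : ∀ {f : Par F}, HasPar 2 ψ f → ∀ t, zeroExt ψ (x7_18_19 a t) =
      phi 2 ((f.f7 * a.a28 + f.f18 * a.a22 + f.f19 * a.a21) * t) := by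
    intro f h t
    rw [x7_18_19, zeroExt_mul ψ (mul_mem (mem 7 (by decide) _) (mem 18 (by decide) _))
      (mem 19 (by decide) _), zeroExt_mul ψ (mem 7 (by decide) _) (mem 18 (by decide) _),
      h.x7, h.x18, h.x19, ← phi_add, ← phi_add]
    congr 1
    ring
  have e10 : ∀ {f : Par F}, HasPar 2 ψ f → ∀ t, zeroExt ψ (x10_11_17 a t) =
      phi 2 ((f.f10 * a.a22 + f.f11 * a.a21 + f.f17 * a.a16) * t) := by
    intro f h t
    rw [x10_11_17, zeroExt_mul ψ (mul_mem (mem 10 (by decide) _) (mem 11 (by decide) _))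
      (mem 17 (by decide) _), zeroExt_mul ψ (mem 10 (by decide) _) (mem 11 (by decide) _),
      h.x10, h.x11, h.x17, ← phi_add, ← phi_add]
    congr 1
    ring
  have m7 : ∀ t, x7_18_19 a t ∈ evenBase a c c' := fun t =>
    mul_mem (mul_mem (mem 7 (by decide) _) (mem 18 (by decide) _)) (mem 19 (by decide) _)
  have m10 : ∀ t, x10_11_17 a t ∈ evenBase a c c' := fun t =>
    mul_mem (mul_mem (mem 10 (by decide) _) (mem 11 (by decide) _)) (mem 17 (by decide) _)
  constructor
  · rintro ⟨hz, h⟩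
    obtain ⟨f, hf⟩ := exists_hasPar (p := 2) hT ψ
    have zero : ∀ {n : ℕ} {b : F}, root n ∈ S \ I → (∀ t, zeroExt ψ (x n t) = phi 2 (b * t)) →
        (∀ t, Takes ψ (x n t) 1) → b = 0 := fun hn hb h1 =>
      eq_of_phi_mul_eq (p := 2) fun t => by
        rw [← hb, (tk _ hn _ _).mp (h1 t), zero_mul, phi_zero]
    have f11 := zero (by decide) hf.x11 fun t => (h t).2.2.1
    have f17 := zero (by decide) hf.x17 fun t => (h t).2.2.2.1
    have f18 := zero (by decide) hf.x18 fun t => (h t).2.2.2.2.1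
    have f19 := zero (by decide) hf.x19 fun t => (h t).2.2.2.2.2
    have f16 : f.f16 = a.a16 := eq_of_phi_mul_eq (p := 2) fun t => by
      rw [← hf.x16, (tk 16 (by decide) _ _).mp (hz t).1]
    have f21 : f.f21 = a.a21 := eq_of_phi_mul_eq (p := 2) fun t => by
      rw [← hf.x21, (tk 21 (by decide) _ _).mp (hz t).2.1]
    have f22 : f.f22 = a.a22 := eq_of_phi_mul_eq (p := 2) fun t => by
      rw [← hf.x22, (tk 22 (by decide) _ _).mp (hz t).2.2.1]
    have f28 : f.f28 = a.a28 := eq_of_phi_mul_eq (p := 2) fun t => by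
      rw [← hf.x28, (tk 28 (by decide) _ _).mp (hz t).2.2.2]
    have f7 : f.f7 * a.a28 = c := eq_of_phi_mul_eq (p := 2) fun t => by
      have := e7 hf t
      rw [((takes_iff _ _ _).mp (h t).1).2, f18, f19, zero_mul, zero_mul, add_zero,
        add_zero] at this
      exact this.symm
    have f10 : f.f10 * a.a22 = c' := eq_of_phi_mul_eq (p := 2) fun t => by
      have := e10 hf t
      rw [((takes_iff _ _ _).mp (h t).2.1).2, f11, f17, zero_mul, zero_mul, add_zero,
        add_zero] at this
      exact this.symm
    refine ⟨f.f2, f.f4, ?_⟩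
    rwa [show evenPar a c c' f.f2 f.f4 = f from Par.ext rfl rfl (eq_div_of_mul_eq h28 f7).symm
      (eq_div_of_mul_eq h22 f10).symm f11.symm f17.symm f18.symm f19.symm f16.symm f21.symm
      f22.symm f28.symm]
  · rintro ⟨b2, b4, h⟩
    have h0 : ∀ {n : ℕ} {t : F}, zeroExt ψ (x n t) = phi 2 (0 * t) → zeroExt ψ (x n t) = 1 :=
      fun e => by rw [e, zero_mul, phi_zero]
    refine ⟨fun t => ⟨(tk 16 (by decide) t _).mpr (h.x16 t), (tk 21 (by decide) t _).mpr (h.x21 t),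
      (tk 22 (by decide) t _).mpr (h.x22 t), (tk 28 (by decide) t _).mpr (h.x28 t)⟩,
      fun t => ⟨(takes_iff _ _ _).mpr ⟨m7 t, ?_⟩, (takes_iff _ _ _).mpr ⟨m10 t, ?_⟩,
      (tk 11 (by decide) t _).mpr (h0 (h.x11 t)), (tk 17 (by decide) t _).mpr (h0 (h.x17 t)),
      (tk 18 (by decide) t _).mpr (h0 (h.x18 t)), (tk 19 (by decide) t _).mpr (h0 (h.x19 t))⟩⟩
    · rw [e7 h]
      congr 2
      simp only [evenPar]
      field_simp
      ring
    · rw [e10 h]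
      congr 2
      simp only [evenPar]
      field_simp
      ring

/-- The character `χ` is induced from a linear character as in `EvenChar`, with the given signs as
its values on the four distinguished elements. -/
def EvenLabel (a : CentralLabel F) (c c' : F) (d1 d2 d4 d5 : ZMod 2) (χ : X F → ℂ) : Prop :=
  ∃ ψ : evenBase a c c' →* ℂˣ, EvenChar 2 a c c' ψ ∧
    Takes ψ (x1_14_15 a (c / a.u)) (sign d1) ∧ Takes ψ (x 2 (a.u / c ^ 2)) (sign d2) ∧
    Takes ψ (x 4 (a.v / c' ^ 2)) (sign d4) ∧ Takes ψ (x5_6_12 a (c' / a.v)) (sign d5) ∧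
    χ = ind ψ

theorem evenLabel_iff {a : CentralLabel F} {c c' : F} {d1 d2 d4 d5 : ZMod 2} {χ : X F → ℂ} :
    EvenLabel a c c' d1 d2 d4 d5 χ ↔ ∃ (ψ : evenBase a c c' →* ℂˣ) (b2 b4 : F),
      HasPar 2 ψ (evenPar a c c' b2 b4) ∧ zeroExt ψ (x1_14_15 a (c / a.u)) = sign d1 ∧
      phi 2 (b2 * (a.u / c ^ 2)) = sign d2 ∧ phi 2 (b4 * (a.v / c' ^ 2)) = sign d4 ∧
      zeroExt ψ (x5_6_12 a (c' / a.v)) = sign d5 ∧ χ = ind ψ := by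
  refine exists_congr fun ψ => ?_
  rw [evenChar_iff, takes_iff, takes_iff ψ (x5_6_12 _ _),
    takes_x_iff (base_le_evenBase a c c') ψ (by decide),
    takes_x_iff (base_le_evenBase a c c') ψ (by decide)]
  constructor
  · rintro ⟨⟨b2, b4, h⟩, h1, h2, h4, h5, rfl⟩
    rw [h.x2] at h2
    rw [h.x4] at h4
    exact ⟨b2, b4, h, h1.2, h2, h4, h5.2, rfl⟩
  · rintro ⟨b2, b4, h, h1, h2, h4, h5, rfl⟩
    refine ⟨⟨b2, b4, h⟩, ⟨x1_14_15_mem a c c', h1⟩, ?_, ?_, ⟨x5_6_12_mem a c c', h5⟩, rfl⟩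
    · rw [h.x2]; exact h2
    · rw [h.x4]; exact h4

/-- The signs d2 and d4 are realised by the choice of b2 and b4, and d1 and d5 by twisting the
extension with κ and κ'. When c or c' is zero, the corresponding signs are evaluated at the identity
and must be trivial. -/
theorem exists_evenLabel {a : CentralLabel F} {c c' : F} {d1 d2 d4 d5 : ZMod 2}
    (h : c = 0 → d1 = 0 ∧ d2 = 0) (h' : c' = 0 → d4 = 0 ∧ d5 = 0) :
    ∃ χ, EvenLabel a c c' d1 d2 d4 d5 χ := by
  obtain ⟨b2, hb2⟩ := exists_phi_mul_eq_sign_of_imp (w := a.u / c ^ 2) (d := d2) fun e =>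
    (h (by simpa [a.u_ne_zero] using e)).2
  obtain ⟨b4, hb4⟩ := exists_phi_mul_eq_sign_of_imp (w := a.v / c' ^ 2) (d := d4) fun e =>
    (h' (by simpa [a.v_ne_zero] using e)).1
  obtain ⟨κ, hκ⟩ := exists_phi_mul_eq_sign_of_imp (w := c / a.u * a.a28) (d := d1) fun e =>
    (h (by simpa [a.u_ne_zero] using e)).1
  obtain ⟨κ', hκ'⟩ := exists_phi_mul_eq_sign_of_imp (w := c' / a.v * a.a16) (d := d5) fun e =>
    (h' (by simpa [a.v_ne_zero] using e)).2
  obtain ⟨ψ, hψ⟩ := exists_char_stabPar (p := 2)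
    (evenBase_eq_stabPar two_eq_zero_of_algebra a c c' b2 b4) κ κ'
  refine ⟨ind ψ, evenLabel_iff.mpr ⟨ψ, b2, b4, hasPar_of_eq (base_le_evenBase a c c') hψ, ?_, hb2,
    hb4, ?_, rfl⟩⟩
  · have hm := x1_14_15_mem a c c'
    rw [x1_14_15_eq] at hm ⊢
    rw [hψ _ hm, ← hκ]
    congr 1
    simp [Par.pair, Coord.ofCompl]
  · have hm := x5_6_12_mem a c c'
    rw [x5_6_12_eq] at hm ⊢
    rw [hψ _ hm, ← hκ']
    congr 1
    simp [Par.pair, Coord.ofCompl]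

/-- Equal signs d2 put b2' + b2 into the image of r ↦ rc + r²u, and likewise for b4. So conjugation
by an element of the kernel lines makes the parameters agree. It preserves d1 and d5, hence the two
linear characters become equal. -/
theorem EvenLabel.eq {a : CentralLabel F} {c c' : F} {d1 d2 d4 d5 : ZMod 2} {χ χ' : X F → ℂ}
    (h : EvenLabel a c c' d1 d2 d4 d5 χ) (h' : EvenLabel a c c' d1 d2 d4 d5 χ') : χ = χ' := by
  obtain ⟨ψ, b2, b4, hψ, h1, h2, h4, h5, rfl⟩ := evenLabel_iff.mp h
  obtain ⟨ψ', b2', b4', hψ', h1', h2', h4', h5', rfl⟩ := evenLabel_iff.mp h'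
  have two : (2 : F) = 0 := two_eq_zero_of_algebra
  obtain ⟨r, hr⟩ := exists_mul_add_sq_mul_eq (c := c) (u := a.u) (δ := b2' + b2) a.u_ne_zero (by
    rw [add_mul, phi_add, h2, h2', sign_mul_self])
  obtain ⟨r', hr'⟩ := exists_mul_add_sq_mul_eq (c := c') (u := a.v) (δ := b4' + b4) a.v_ne_zero (by
    rw [add_mul, phi_add, h4, h4', sign_mul_self])
  have hpar := hψ.conjRes (Coord.toXHom (evenCompl a r r'))
  rw [co_toXHom, act_evenCompl two, hr, hr', add_left_comm, add_self_of_algebra, add_zero,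
    add_left_comm, add_self_of_algebra, add_zero] at hpar
  rw [← ind_conjRes ψ (Coord.toXHom (evenCompl a r r'))]
  congr 1
  refine evenBase_char_ext hpar hψ' ?_ ?_
  · rw [zeroExt_conjRes_self, h1', ← h1, x1_14_15_eq,
      zeroExt_conj_ofCompl (base_le_evenBase a c c')]
  · rw [zeroExt_conjRes_self, h5', ← h5, x5_6_12_eq,
      zeroExt_conj_ofCompl (base_le_evenBase a c c')]

/-- Conjugate parameters share a, c and c'. The values of b2 and b4 change only within classes on
which d2 and d4 are constant, and d1 and d5 are invariant by `zeroExt_conj_ofCompl`. -/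
theorem EvenLabel.label_eq {a a' : CentralLabel F} {c c' e e' : F}
    {d1 d2 d4 d5 d1' d2' d4' d5' : ZMod 2} {χ : X F → ℂ} (h : EvenLabel a c c' d1 d2 d4 d5 χ)
    (h' : EvenLabel a' e e' d1' d2' d4' d5' χ) :
    a = a' ∧ c = e ∧ c' = e' ∧ d1 = d1' ∧ d2 = d2' ∧ d4 = d4' ∧ d5 = d5' := by
  obtain ⟨ψ, b2, b4, hψ, h1, h2, h4, h5, rfl⟩ := evenLabel_iff.mp h
  obtain ⟨ψ', b2', b4', hψ', h1', h2', h4', h5', hχ⟩ := evenLabel_iff.mp h'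
  have two : (2 : F) = 0 := two_eq_zero_of_algebra
  obtain ⟨g, hg⟩ := exists_act_eq_of_ind_eq (base_le_evenBase a c c')
    (base_le_evenBase a' e e') hψ hψ' hχ
  obtain ⟨rfl, rfl, rfl, r, r', hr, hr', -⟩ := eq_of_act_evenPar_eq two hg
  obtain ⟨y, hy⟩ := exists_conjRes_eq_of_ind_eq le_rfl le_rfl ψ ψ' hχ
  rw [conjRes_eq_iff] at hy
  refine ⟨rfl, rfl, rfl, ?_, ?_, ?_, ?_⟩ <;> apply sign_injective
  · have := hy _ (x1_14_15_mem a c c')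
    rw [inv_one, one_mul, mul_one, h1', x1_14_15_eq,
      zeroExt_conj_ofCompl (base_le_evenBase a c c'), ← x1_14_15_eq, h1] at this
    exact this
  · rw [← h2, ← h2', hr, add_mul, phi_add, phi_mul_add_sq_mul_div, mul_one]
  · rw [← h4, ← h4', hr', add_mul, phi_add, phi_mul_add_sq_mul_div, mul_one]
  · have := hy _ (x5_6_12_mem a c c')
    rw [inv_one, one_mul, mul_one, h5', x5_6_12_eq,
      zeroExt_conj_ofCompl (base_le_evenBase a c c'), ← x5_6_12_eq, h5] at this
    exact this

theorem EvenLabel.mem_IrrSupport {a : CentralLabel F} {c c' : F} {d1 d2 d4 d5 : ZMod 2}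
    {χ : X F → ℂ} (h : EvenLabel a c c' d1 d2 d4 d5 χ) : χ ∈ IrrSupport F Q Z := by
  obtain ⟨ψ, b2, b4, hψ, -, -, -, -, rfl⟩ := evenLabel_iff.mp h
  exact hψ.ind_mem_IrrSupport (evenBase_eq_stabPar two_eq_zero_of_algebra a c c' b2 b4)
    (evenPar_nondeg a c c' b2 b4)

theorem exists_evenLabel_of_mem_IrrSupport {χ : X F → ℂ} (hχ : χ ∈ IrrSupport F Q Z) :
    ∃ a c c' d1 d2 d4 d5, EvenLabel a c c' d1 d2 d4 d5 χ := by
  have two : (2 : F) = 0 := two_eq_zero_of_algebra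
  obtain ⟨f, hf, hT⟩ := exists_hasPar_of_mem_IrrSupport (p := 2) hχ
  obtain ⟨g, a, c, c', b2, b4, hg⟩ := exists_act_eq_evenPar two hf
  -- Conjugate parameters have the same stabilizer, since the action factors through an abelian
  -- group.
  have hst : evenBase a c c' = stabPar f := by
    rw [evenBase_eq_stabPar two a c c' b2 b4, ← hg]
    ext y
    have hcomm : ∀ f, Par.act (co y) (Par.act g f) = Par.act g (Par.act (co y) f) := fun f => by
      rw [← Par.act_mul, ← Par.act_mul, ← co_toXHom g, ← map_mul, ← map_mul]
      exact act_eq_of_complHom_eq (by rw [map_mul, map_mul, mul_comm]) f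
    rw [mem_stabPar, mem_stabPar, hcomm]
    refine ⟨fun h => ?_, fun h => by rw [h]⟩
    have := congrArg (Par.act g⁻¹) h
    rwa [← Par.act_mul, ← Par.act_mul, inv_mul_cancel, one_mul, ← Par.act_mul, inv_mul_cancel,
      Par.act_one] at this
  obtain ⟨ψ, hψ, rfl⟩ := hT _ hst
  have hpar := hψ.conjRes (Coord.toXHom g)
  rw [co_toXHom, hg] at hpar
  obtain ⟨ψ', hψ'⟩ : ∃ ψ', ψ' = UD6.conjRes le_rfl ψ (Coord.toXHom g) := ⟨_, rfl⟩
  rw [← hψ'] at hpar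
  -- The distinguished elements square to the identity, so their values are signs.
  have hsq : ∀ y, y * y = 1 → y ∈ evenBase a c c' → ∃ d, zeroExt ψ' y = sign d := by
    intro y hy hm
    apply exists_eq_sign
    rw [← zeroExt_mul ψ' hm hm, hy, zeroExt_one]
  obtain ⟨d1, h1⟩ := hsq _ (x1_14_15_mul_self a _) (x1_14_15_mem a c c')
  obtain ⟨d5, h5⟩ := hsq _ (x5_6_12_mul_self a _) (x5_6_12_mem a c c')
  obtain ⟨d2, h2⟩ := exists_eq_sign (phi_mul_self (b2 * (a.u / c ^ 2)))
  obtain ⟨d4, h4⟩ := exists_eq_sign (phi_mul_self (b4 * (a.v / c' ^ 2)))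
  refine ⟨a, c, c', d1, d2, d4, d5, evenLabel_iff.mpr ⟨ψ', b2, b4, hpar, h1, h2, h4, h5, ?_⟩⟩
  rw [hψ', ind_conjRes]

theorem EvenLabel.eq_zero {a : CentralLabel F} {c' : F} {d1 d2 d4 d5 : ZMod 2} {χ : X F → ℂ}
    (h : EvenLabel a 0 c' d1 d2 d4 d5 χ) : d1 = 0 ∧ d2 = 0 := by
  obtain ⟨ψ, b2, b4, -, h1, h2, -⟩ := evenLabel_iff.mp h
  rw [zero_div, x1_14_15_zero, zeroExt_one] at h1
  rw [zero_pow two_ne_zero, div_zero, mul_zero, phi_zero] at h2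
  rw [← sign_zero] at h1 h2
  exact ⟨(sign_injective h1).symm, (sign_injective h2).symm⟩

theorem EvenLabel.eq_zero' {a : CentralLabel F} {c : F} {d1 d2 d4 d5 : ZMod 2} {χ : X F → ℂ}
    (h : EvenLabel a c 0 d1 d2 d4 d5 χ) : d4 = 0 ∧ d5 = 0 := by
  obtain ⟨ψ, b2, b4, -, -, -, h4, h5, -⟩ := evenLabel_iff.mp h
  rw [zero_div, x5_6_12_zero, zeroExt_one] at h5
  rw [zero_pow two_ne_zero, div_zero, mul_zero, phi_zero] at h4
  rw [← sign_zero] at h4 h5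
  exact ⟨(sign_injective h4).symm, (sign_injective h5).symm⟩

theorem EvenLabel.degree_mul {a : CentralLabel F} {c c' : F} {d1 d2 d4 d5 : ZMod 2}
    {χ : X F → ℂ} (h : EvenLabel a c c' d1 d2 d4 d5 χ) :
    χ 1 * (Set.ncard {0, c / a.u} * Set.ncard {0, c' / a.v} : ℕ) = (Nat.card F : ℂ) ^ 6 := by
  obtain ⟨ψ, -, -, -, -, -, -, -, rfl⟩ := evenLabel_iff.mp h
  rw [ind_one, ← Nat.cast_mul, index_evenBase_mul two_eq_zero_of_algebra, Nat.cast_pow]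

end EvenCharacters

/-! ### The four families in characteristic two -/

section Families

variable {F : Type*} [Field F]

theorem takes_one {G : Type*} [Group G] {T : Subgroup G} (ψ : T →* ℂˣ) : Takes ψ 1 (sign 0) := by
  rw [takes_iff, zeroExt_one, sign_zero]
  exact ⟨one_mem _, rfl⟩

theorem takes_x_zero (n : ℕ) {T : Subgroup (X F)} (ψ : T →* ℂˣ) : Takes ψ (x n 0) (sign 0) := by
  rw [x, Q.x_zero]
  exact takes_one ψ

theorem takes_x1_14_15_zero (a : CentralLabel F) {T : Subgroup (X F)} (ψ : T →* ℂˣ) :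
    Takes ψ (x1_14_15 a 0) (sign 0) := by
  rw [x1_14_15_zero]
  exact takes_one ψ

theorem takes_x5_6_12_zero (a : CentralLabel F) {T : Subgroup (X F)} (ψ : T →* ℂˣ) :
    Takes ψ (x5_6_12 a 0) (sign 0) := by
  rw [x5_6_12_zero]
  exact takes_one ψ

variable [Algebra (ZMod 2) F]

/-- With c = c' = 0 the four sign conditions of `EvenLabel` are evaluated at the identity, since
dividing by zero gives zero. They hold exactly for trivial signs. -/
theorem evenLabel1_iff (a : CentralLabel F) (χ : X F → ℂ) :
    EvenLabel1 2 a χ ↔ EvenLabel a 0 0 0 0 0 0 χ :=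
  exists_congr fun ψ => by simp [takes_x_zero, takes_x1_14_15_zero, takes_x5_6_12_zero]

theorem evenLabel2_iff (l : CentralLabel F × Fˣ × ZMod 2 × ZMod 2) (χ : X F → ℂ) :
    EvenLabel2 2 l χ ↔ EvenLabel l.1 l.2.1 0 l.2.2.1 l.2.2.2 0 0 χ :=
  exists_congr fun ψ => by simp [takes_x_zero, takes_x5_6_12_zero]

theorem evenLabel3_iff (l : CentralLabel F × Fˣ × ZMod 2 × ZMod 2) (χ : X F → ℂ) :
    EvenLabel3 2 l χ ↔ EvenLabel l.1 0 l.2.1 0 0 l.2.2.1 l.2.2.2 χ :=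
  exists_congr fun ψ => by simp [takes_x_zero, takes_x1_14_15_zero]

theorem evenLabel4_iff (l : CentralLabel F × Fˣ × Fˣ × ZMod 2 × ZMod 2 × ZMod 2 × ZMod 2)
    (χ : X F → ℂ) : EvenLabel4 2 l χ ↔
      EvenLabel l.1 l.2.1 l.2.2.1 l.2.2.2.1 l.2.2.2.2.1 l.2.2.2.2.2.1 l.2.2.2.2.2.2 χ :=
  Iff.rfl

variable [Finite F]

theorem isLabelling_evenLabel1 : IsLabelling (EvenLabel1 (F := F) 2) := by
  simp only [IsLabelling, evenLabel1_iff]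
  refine ⟨fun a => ?_, fun a a' χ h h' => (h.label_eq h').1⟩
  obtain ⟨χ, h⟩ := exists_evenLabel (a := a) (c := 0) (c' := 0) (fun _ => ⟨rfl, rfl⟩)
    (fun _ => ⟨rfl, rfl⟩)
  exact ⟨χ, h, fun χ' h' => h'.eq h⟩

theorem isLabelling_evenLabel2 : IsLabelling (EvenLabel2 (F := F) 2) := by
  simp only [IsLabelling, evenLabel2_iff]
  constructor
  · rintro ⟨a, c, d1, d2⟩
    obtain ⟨χ, h⟩ := exists_evenLabel (a := a) (c := c) (c' := 0) (d1 := d1) (d2 := d2)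
      (fun e => absurd e c.ne_zero) (fun _ => ⟨rfl, rfl⟩)
    exact ⟨χ, h, fun χ' h' => h'.eq h⟩
  · rintro ⟨a, c, d1, d2⟩ ⟨a', e, d1', d2'⟩ χ h h'
    obtain ⟨h1, h2, -, h3, h4, -⟩ := h.label_eq h'
    exact Prod.ext h1 (Prod.ext (Units.ext h2) (Prod.ext h3 h4))

theorem isLabelling_evenLabel3 : IsLabelling (EvenLabel3 (F := F) 2) := by
  simp only [IsLabelling, evenLabel3_iff]
  constructor
  · rintro ⟨a, c', d4, d5⟩
    obtain ⟨χ, h⟩ := exists_evenLabel (a := a) (c := 0) (c' := c') (d4 := d4) (d5 := d5)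
      (fun _ => ⟨rfl, rfl⟩) (fun e => absurd e c'.ne_zero)
    exact ⟨χ, h, fun χ' h' => h'.eq h⟩
  · rintro ⟨a, c', d4, d5⟩ ⟨a', e', d4', d5'⟩ χ h h'
    obtain ⟨h1, -, h2, -, -, h3, h4⟩ := h.label_eq h'
    exact Prod.ext h1 (Prod.ext (Units.ext h2) (Prod.ext h3 h4))

theorem isLabelling_evenLabel4 : IsLabelling (EvenLabel4 (F := F) 2) := by
  simp only [IsLabelling, evenLabel4_iff]
  constructor
  · rintro ⟨a, c, c', d1, d2, d4, d5⟩
    obtain ⟨χ, h⟩ := exists_evenLabel (a := a) (c := c) (c' := c') (d1 := d1) (d2 := d2)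
      (d4 := d4) (d5 := d5) (fun e => absurd e c.ne_zero) (fun e => absurd e c'.ne_zero)
    exact ⟨χ, h, fun χ' h' => h'.eq h⟩
  · rintro ⟨a, c, c', d1, d2, d4, d5⟩ ⟨a', e, e', d1', d2', d4', d5'⟩ χ h h'
    obtain ⟨h1, h2, h3, h4, h5, h6, h7⟩ := h.label_eq h'
    exact Prod.ext h1 (Prod.ext (Units.ext h2) (Prod.ext (Units.ext h3)
      (Prod.ext h4 (Prod.ext h5 (Prod.ext h6 h7)))))

theorem irrSupport_eq_evenFamilies : IrrSupport F Q Z =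
    evenFamily1 F 2 ∪ evenFamily2 F 2 ∪ evenFamily3 F 2 ∪ evenFamily4 F 2 := by
  ext χ
  constructor
  · intro hχ
    obtain ⟨a, c, c', d1, d2, d4, d5, h⟩ := exists_evenLabel_of_mem_IrrSupport hχ
    by_cases hc : c = 0
    · subst hc
      obtain ⟨rfl, rfl⟩ := h.eq_zero
      by_cases hc' : c' = 0
      · subst hc'
        obtain ⟨rfl, rfl⟩ := h.eq_zero'
        exact Or.inl (Or.inl (Or.inl ⟨a, (evenLabel1_iff _ _).mpr h⟩))
      · exact Or.inl (Or.inr ⟨(a, Units.mk0 c' hc', d4, d5), (evenLabel3_iff _ _).mpr h⟩)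
    · by_cases hc' : c' = 0
      · subst hc'
        obtain ⟨rfl, rfl⟩ := h.eq_zero'
        exact Or.inl (Or.inl (Or.inr ⟨(a, Units.mk0 c hc, d1, d2), (evenLabel2_iff _ _).mpr h⟩))
      · exact Or.inr ⟨(a, Units.mk0 c hc, Units.mk0 c' hc', d1, d2, d4, d5),
          (evenLabel4_iff _ _).mpr h⟩
  · rintro (((⟨l, h⟩ | ⟨l, h⟩) | ⟨l, h⟩) | ⟨l, h⟩)
    · exact ((evenLabel1_iff _ _).mp h).mem_IrrSupport
    · exact ((evenLabel2_iff _ _).mp h).mem_IrrSupport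
    · exact ((evenLabel3_iff _ _).mp h).mem_IrrSupport
    · exact ((evenLabel4_iff _ _).mp h).mem_IrrSupport

theorem pairwise_disjoint_evenFamilies :
    [evenFamily1 F 2, evenFamily2 F 2, evenFamily3 F 2, evenFamily4 F 2].Pairwise Disjoint := by
  have key : ∀ {L L' : Type _} {R : L → (X F → ℂ) → Prop} {R' : L' → (X F → ℂ) → Prop},
      (∀ l l' χ, R l χ → ¬ R' l' χ) → Disjoint {χ | ∃ l, R l χ} {χ | ∃ l, R' l χ} := fun h =>
    Set.disjoint_left.mpr fun χ ⟨l, hl⟩ ⟨l', hl'⟩ => h l l' χ hl hl'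
  simp only [List.pairwise_cons, List.mem_cons, List.not_mem_nil, or_false, forall_eq_or_imp,
    forall_eq, List.Pairwise.nil, and_true, IsEmpty.forall_iff, implies_true]
  -- The families differ in which of c and c' vanish, and both are determined by the character.
  refine ⟨⟨key ?_, key ?_, key ?_⟩, ⟨key ?_, key ?_⟩, key ?_⟩ <;> intro l l' χ h h'
  · exact l'.2.1.ne_zero
      (((evenLabel1_iff _ _).mp h).label_eq ((evenLabel2_iff _ _).mp h')).2.1.symm
  · exact l'.2.1.ne_zero
      (((evenLabel1_iff _ _).mp h).label_eq ((evenLabel3_iff _ _).mp h')).2.2.1.symm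
  · exact l'.2.1.ne_zero
      (((evenLabel1_iff _ _).mp h).label_eq ((evenLabel4_iff _ _).mp h')).2.1.symm
  · exact l.2.1.ne_zero (((evenLabel2_iff _ _).mp h).label_eq ((evenLabel3_iff _ _).mp h')).2.1
  · exact l'.2.2.1.ne_zero
      (((evenLabel2_iff _ _).mp h).label_eq ((evenLabel4_iff _ _).mp h')).2.2.1.symm
  · exact l'.2.1.ne_zero
      (((evenLabel3_iff _ _).mp h).label_eq ((evenLabel4_iff _ _).mp h')).2.1.symm

theorem even_main :
    IrrSupport F Q Z =
        evenFamily1 F 2 ∪ evenFamily2 F 2 ∪ evenFamily3 F 2 ∪ evenFamily4 F 2 ∧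
      [evenFamily1 F 2, evenFamily2 F 2, evenFamily3 F 2, evenFamily4 F 2].Pairwise Disjoint ∧
      (IsLabelling (EvenLabel1 (F := F) 2) ∧
        (evenFamily1 F 2).ncard = (Nat.card F - 1) ^ 4 ∧
        ∀ χ ∈ evenFamily1 F 2, χ 1 = (Nat.card F : ℂ) ^ 6) ∧
      (IsLabelling (EvenLabel2 (F := F) 2) ∧
        (evenFamily2 F 2).ncard = 4 * (Nat.card F - 1) ^ 5 ∧
        ∀ χ ∈ evenFamily2 F 2, χ 1 = (Nat.card F : ℂ) ^ 6 / 2) ∧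
      (IsLabelling (EvenLabel3 (F := F) 2) ∧
        (evenFamily3 F 2).ncard = 4 * (Nat.card F - 1) ^ 5 ∧
        ∀ χ ∈ evenFamily3 F 2, χ 1 = (Nat.card F : ℂ) ^ 6 / 2) ∧
      (IsLabelling (EvenLabel4 (F := F) 2) ∧
        (evenFamily4 F 2).ncard = 16 * (Nat.card F - 1) ^ 6 ∧
        ∀ χ ∈ evenFamily4 F 2, χ 1 = (Nat.card F : ℂ) ^ 6 / 4) := by
  have one : ∀ w : F, Set.ncard {0, (0 : F) / w} = 1 := by simp
  have two : ∀ (c : Fˣ) {w : F}, w ≠ 0 → Set.ncard {0, (c : F) / w} = 2 := fun c w hw =>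
    Set.ncard_pair (div_ne_zero c.ne_zero hw).symm
  refine ⟨irrSupport_eq_evenFamilies, pairwise_disjoint_evenFamilies,
    ⟨isLabelling_evenLabel1, ?_, ?_⟩, ⟨isLabelling_evenLabel2, ?_, ?_⟩,
    ⟨isLabelling_evenLabel3, ?_, ?_⟩, ⟨isLabelling_evenLabel4, ?_, ?_⟩⟩
  · rw [evenFamily1, isLabelling_evenLabel1.ncard_eq, card_centralLabel]
  · rintro χ ⟨l, h⟩
    have := ((evenLabel1_iff _ _).mp h).degree_mul
    rw [one, one] at this
    simpa using this
  · rw [evenFamily2, isLabelling_evenLabel2.ncard_eq]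
    simp only [Nat.card_prod, card_centralLabel, Nat.card_units, Nat.card_zmod]
    ring
  · rintro χ ⟨l, h⟩
    have := ((evenLabel2_iff _ _).mp h).degree_mul
    rw [one, two _ l.1.u_ne_zero] at this
    rw [← this]
    simp
  · rw [evenFamily3, isLabelling_evenLabel3.ncard_eq]
    simp only [Nat.card_prod, card_centralLabel, Nat.card_units, Nat.card_zmod]
    ring
  · rintro χ ⟨l, h⟩
    have := ((evenLabel3_iff _ _).mp h).degree_mul
    rw [one, two _ l.1.v_ne_zero] at this
    rw [← this]
    simp
  · rw [evenFamily4, isLabelling_evenLabel4.ncard_eq]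
    simp only [Nat.card_prod, card_centralLabel, Nat.card_units, Nat.card_zmod]
    ring
  · rintro χ ⟨l, h⟩
    have := ((evenLabel4_iff _ _).mp h).degree_mul
    rw [two _ l.1.u_ne_zero, two _ l.1.v_ne_zero] at this
    rw [← this]
    norm_num

theorem two_ne_zero_of_algebra (p : ℕ) [Fact p.Prime] (hp : p ≠ 2) (F : Type*) [Field F]
    [Algebra (ZMod p) F] : (2 : F) ≠ 0 := by
  have : CharP F p := charP_of_injective_algebraMap (algebraMap (ZMod p) F).injective p
  intro h
  have h2 : p ∣ 2 := (CharP.cast_eq_zero_iff F p 2).mp (by exact_mod_cast h)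
  exact hp ((Nat.prime_dvd_prime_iff_eq Fact.out Nat.prime_two).mp h2)

end Families

end Core

end UD6

theorem proposition5p2 (p : ℕ) [Fact p.Prime] (F : Type*) [Field F] [Finite F]
    [Algebra (ZMod p) F] :
    (p ≠ 2 →
      UD6.IrrSupport F UD6.Core.Q UD6.Core.Z = UD6.Core.oddFamily F p ∧
      UD6.IsLabelling (UD6.Core.OddLabel (F := F) p) ∧
      (UD6.Core.oddFamily F p).ncard = Nat.card F ^ 2 * (Nat.card F - 1) ^ 4 ∧
      ∀ χ ∈ UD6.Core.oddFamily F p, χ 1 = (Nat.card F : ℂ) ^ 6) ∧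
    (p = 2 →
      UD6.IrrSupport F UD6.Core.Q UD6.Core.Z =
        UD6.Core.evenFamily1 F p ∪ UD6.Core.evenFamily2 F p ∪
          UD6.Core.evenFamily3 F p ∪ UD6.Core.evenFamily4 F p ∧
      [UD6.Core.evenFamily1 F p, UD6.Core.evenFamily2 F p,
        UD6.Core.evenFamily3 F p, UD6.Core.evenFamily4 F p].Pairwise Disjoint ∧
      (UD6.IsLabelling (UD6.Core.EvenLabel1 (F := F) p) ∧
        (UD6.Core.evenFamily1 F p).ncard = (Nat.card F - 1) ^ 4 ∧
        ∀ χ ∈ UD6.Core.evenFamily1 F p, χ 1 = (Nat.card F : ℂ) ^ 6) ∧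
      (UD6.IsLabelling (UD6.Core.EvenLabel2 (F := F) p) ∧
        (UD6.Core.evenFamily2 F p).ncard = 4 * (Nat.card F - 1) ^ 5 ∧
        ∀ χ ∈ UD6.Core.evenFamily2 F p, χ 1 = (Nat.card F : ℂ) ^ 6 / 2) ∧
      (UD6.IsLabelling (UD6.Core.EvenLabel3 (F := F) p) ∧
        (UD6.Core.evenFamily3 F p).ncard = 4 * (Nat.card F - 1) ^ 5 ∧
        ∀ χ ∈ UD6.Core.evenFamily3 F p, χ 1 = (Nat.card F : ℂ) ^ 6 / 2) ∧
      (UD6.IsLabelling (UD6.Core.EvenLabel4 (F := F) p) ∧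
        (UD6.Core.evenFamily4 F p).ncard = 16 * (Nat.card F - 1) ^ 6 ∧
        ∀ χ ∈ UD6.Core.evenFamily4 F p, χ 1 = (Nat.card F : ℂ) ^ 6 / 4)) := by
  refine ⟨fun hp => UD6.Core.odd_main (UD6.Core.two_ne_zero_of_algebra p hp F), ?_⟩
  rintro rfl
  exact UD6.Core.even_main
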